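/- Notation. For a locally finite graph $G=(V,E)$ and $v\in V$ let $N(v,\ell)$ be the number of self-avoiding walks of length $\ell$ in $G$ starting at $v$. The connective constant of an infinite graph $G$ is $\sup_{v}\limsup_{\ell\to\infty}N(v,\ell)^{1/\ell}$. A family $\mathcal G$ of locally finite graphs has connective constant at most $\Delta$ if (i) there are constants $a,c$ such that $\sum_{j=1}^{\ell}N(v,j)\le c\,\Delta^{\ell}$ for every finite graph $G=(V,E)$ in $\mathcal G$, every $v\in V$ and every integer $\ell\ge a\log|V|$, and (ii) every infinite graph in $\mathcal G$ has connective constant at most $\Delta$. For a finite graph, the hard core partition function with vertex activity $\lambda>0$ is $Z_G(\lambda)=\sum_{I}\lambda^{|I|}$, over the independent sets $I$ of $G$. A boundary condition $\sigma=(S,I_S)$ on $G$ is a set $S\subseteq V$ of fixed vertices with an independent set $I_S\subseteq S$ of occupied ones. For finite $G$, $p_v(\sigma,G)$ is the probability that $v\in I$ when $I$ is drawn with probability proportional to $\lambda^{|I|}$ conditioned on $I\cap S=I_S$, and $R_v(\sigma,G)=p_v/(1-p_v)$. For infinite $G$, $R_v(\sigma,G)$ is the limit of $R_v(\sigma|_W,G[W])$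 as the finite set $W\subseteq V$ increases to $V$. (If $\sigma$ fixes $v$ to be occupied, then $R_v=\infty$; the difference of two infinite ratios is read as $0$.) For $\Delta>1$ let $\lambda_c(\Delta)=\Delta^{\Delta}/(\Delta-1)^{\Delta+1}$. Theorem. Let $\mathcal G$ be a family of locally finite (finite or infinite) graphs of connective constant at most $\Delta$, where $\Delta>1$ is real, and let $0<\lambda<\lambda_c(\Delta)$ be real. (1) (FPTAS.) Suppose that rational approximations of $\lambda$ to within $1/m$ can be computed in time polynomial in $m$ (for instance, $\lambda$ rational). Then there is a deterministic algorithm which, given a finite graph $G$ in $\mathcal G$ on $n$ labelled vertices and $\varepsilon>0$ (given as the integer $\lceil 1/\varepsilon\rceil$), outputs a rational number $\hat Z$ with $|\hat Z-Z_G(\lambda)|\le\varepsilon Z_G(\lambda)$ in time polynomial in $n$ and $1/\varepsilon$. (2) (Strong spatial mixing.) There is a constant $0\le c<1$, the same for all graphs of $\mathcal G$, such that the following hold. (a) There are constants $a',M$ such that for every finite $G=(V,E)$ in $\mathcal G$, every $v\in V$, every integer $\ell\ge\max(1,a'\log|V|)$, and all boundary conditions $\sigma,\tau$ on $G$ which differ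 only at distance at least $\ell$ from $v$, $|R_v(\sigma,G)-R_v(\tau,G)|\le M c^{\ell}$. (b) For every infinite $G=(V,E)$ in $\mathcal G$ and $v\in V$ there is a constant $M$ such that for every $\ell\ge 1$ and all boundary conditions $\sigma,\tau$ on $G$ which differ only at distance at least $\ell$ from $v$, the ratios $R_v(\sigma,G)$ and $R_v(\tau,G)$ exist and $|R_v(\sigma,G)-R_v(\tau,G)|\le M c^{\ell}$. -/

import Mathlib

open Filter Topology
open scoped ENNReal

/-! ## Self-avoiding walks and the connective constant -/

/-- `N(v, ℓ)`: the number of self-avoiding walks of length `ℓ` starting at `v`.  (In a locally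
finite graph there are finitely many.) -/
noncomputable def sawCount {V : Type*} (G : SimpleGraph V) (v : V) (ℓ : ℕ) : ℕ :=
  Set.ncard {p : Σ w : V, G.Walk v w | p.2.IsPath ∧ p.2.length = ℓ}

/-- The connective constant `sup_v limsup_ℓ N(v, ℓ)^(1/ℓ)` of a locally finite infinite graph,
as an element of `[0, ∞]`. -/
noncomputable def connectiveConstant {V : Type*} (G : SimpleGraph V) : ℝ≥0∞ :=
  ⨆ v : V, limsup (fun ℓ : ℕ => (sawCount G v ℓ : ℝ≥0∞) ^ ((ℓ : ℝ)⁻¹)) atTop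

/-- A family of locally finite graphs has connective constant at most `Δ`: its finite members
satisfy `∑_{j=1}^ℓ N(v, j) ≤ c Δ^ℓ` for all `ℓ ≥ a log |V|`, with `a`, `c` common to all finite
members, and each infinite member has connective constant at most `Δ`. -/
def ConnectiveConstantAtMost {ι : Type*} {V : ι → Type*} (G : ∀ i, SimpleGraph (V i))
    (Δ : ℝ) : Prop :=
  (∃ a c : ℝ, ∀ i, Finite (V i) → ∀ (v : V i) (ℓ : ℕ),
      a * Real.log (Nat.card (V i)) ≤ ℓ →
        (∑ j ∈ Finset.Icc 1 ℓ, (sawCount (G i) v j : ℝ)) ≤ c * Δ ^ ℓ) ∧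
  (∀ i, Infinite (V i) → connectiveConstant (G i) ≤ ENNReal.ofReal Δ)

/-- `λ_c(Δ) = Δ^Δ / (Δ - 1)^(Δ + 1)`, for real `Δ > 1`. -/
noncomputable def criticalActivity (Δ : ℝ) : ℝ :=
  Δ ^ Δ / (Δ - 1) ^ (Δ + 1)

/-! ## The hard core model -/

open Classical in
/-- The hard core partition function `∑_I lam^|I|`, over the independent sets of a finite graph. -/
noncomputable def hardCoreZ {V : Type*} [Fintype V] (G : SimpleGraph V) (lam : ℝ) : ℝ :=
  ∑ I ∈ Finset.univ.filter (fun I : Finset V => G.IsIndepSet (I : Set V)), lam ^ I.card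

/-- A boundary condition `(S, I)`: a set `dom = S` of vertices whose state is fixed, and an
independent set `occ = I ⊆ S`, the set of fixed vertices that are occupied. -/
structure BoundaryCondition {V : Type*} (G : SimpleGraph V) where
  dom : Set V
  occ : Set V
  occ_subset : occ ⊆ dom
  indep : G.IsIndepSet occ

namespace BoundaryCondition

variable {V : Type*} {G : SimpleGraph V}

/-- `σ` and `τ` differ at `u`: only one of them fixes `u`, or they fix it to different states. -/
def DiffersAt (σ τ : BoundaryCondition G) (u : V) : Prop :=
  ¬ ((u ∈ σ.dom ↔ u ∈ τ.dom) ∧ (u ∈ σ.occ ↔ u ∈ τ.occ))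

/-- `σ` and `τ` differ only at vertices at distance at least `ℓ` from `v` (a vertex outside the
component of `v` is at distance `∞`). -/
def DifferOnlyBeyond (σ τ : BoundaryCondition G) (v : V) (ℓ : ℕ) : Prop :=
  ∀ u, σ.DiffersAt τ u → (ℓ : ℕ∞) ≤ G.edist v u

open Classical in
/-- The independent sets of the finite induced subgraph `G[W]` that agree with `σ` on the vertices
of `W` fixed by `σ`. -/
noncomputable def configs (σ : BoundaryCondition G) (W : Finset V) : Finset (Finset V) :=
  {I ∈ W.powerset | G.IsIndepSet (I : Set V) ∧ ∀ u ∈ W, u ∈ σ.dom → (u ∈ I ↔ u ∈ σ.occ)}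

open Classical in
/-- Occupation probability of `v` in the hard core model on `G[W]`, conditioned on `σ`. -/
noncomputable def occProb (σ : BoundaryCondition G) (lam : ℝ) (W : Finset V) (v : V) : ℝ :=
  (∑ I ∈ σ.configs W with v ∈ I, lam ^ I.card) / ∑ I ∈ σ.configs W, lam ^ I.card

/-- Occupation ratio `R_v = p_v / (1 - p_v)` on `G[W]`, conditioned on `σ`.  (`R_v = ∞`, coded
as `0` here, exactly when `σ` fixes `v ∈ W` to be occupied; boundary conditions which agree at
`v` agree on this, so differences of ratios are not affected.) -/
noncomputable def occRatio (σ : BoundaryCondition G) (lam : ℝ) (W : Finset V) (v : V) : ℝ :=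
  σ.occProb lam W v / (1 - σ.occProb lam W v)

/-- `r` is the occupation ratio of `v` under `σ` in the (infinite) graph `G`: the limit of the
occupation ratios in the finite induced subgraphs `G[W]`, as `W` increases to the vertex set. -/
def IsOccRatio (σ : BoundaryCondition G) (lam : ℝ) (v : V) (r : ℝ) : Prop :=
  Tendsto (fun W : Finset V => σ.occRatio lam W v) atTop (𝓝 r)

end BoundaryCondition

/-- Strong spatial mixing on a family of graphs, with one rate `c < 1` for the family.

For the finite members the bound `|R_v(σ) - R_v(τ)| ≤ M c^ℓ` holds for `ℓ ≥ a log |V|`, where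
`a` and `M` are common to all finite members.  In an infinite member all the ratios exist, and
for each vertex `v` the bound `M c^ℓ` holds for all `ℓ ≥ 1`, with `M` depending on the graph
and on `v`. -/
def StrongSpatialMixing {ι : Type*} {V : ι → Type*} (G : ∀ i, SimpleGraph (V i))
    (lam : ℝ) : Prop :=
  ∃ c : ℝ, 0 ≤ c ∧ c < 1 ∧
    (∃ a M : ℝ, ∀ (i : ι) (_ : Fintype (V i)) (v : V i) (ℓ : ℕ), 1 ≤ ℓ →
      a * Real.log (Fintype.card (V i)) ≤ ℓ →
      ∀ σ τ : BoundaryCondition (G i), σ.DifferOnlyBeyond τ v ℓ →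
        |σ.occRatio lam Finset.univ v - τ.occRatio lam Finset.univ v| ≤ M * c ^ ℓ) ∧
    (∀ i, Infinite (V i) → ∀ v : V i, ∃ M : ℝ, ∀ ℓ : ℕ, 1 ≤ ℓ →
      ∀ σ τ : BoundaryCondition (G i), σ.DifferOnlyBeyond τ v ℓ →
        ∃ r s : ℝ, σ.IsOccRatio lam v r ∧ τ.IsOccRatio lam v s ∧ |r - s| ≤ M * c ^ ℓ)

/-! ## The model of computation

Deterministic while-programs on finite binary trees whose leaves are natural numbers.  Every
elementary operation is charged the full bit size of its argument and of its result, so that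
running times agree with those of Turing machines up to polynomial factors. -/

/-- Data values. -/
inductive Val where
  | num (n : ℕ) : Val
  | pair (x y : Val) : Val

namespace Val

/-- Bit size. -/
def size : Val → ℕ
  | num n => n.size + 1
  | pair x y => x.size + y.size + 1

/-- First component (`0` for a number). -/
def fst : Val → Val
  | num _ => num 0
  | pair x _ => x

/-- Second component (`0` for a number). -/
def snd : Val → Val
  | num _ => num 0
  | pair _ y => y

/-- Apply a binary operation to a pair of numbers (`0` on other values). -/
def arith (f : ℕ → ℕ → ℕ) : Val → Val
  | pair (num a) (num b) => num (f a b)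
  | _ => num 0

/-- Lists as values: the empty list is `0`, and `x :: l` is a pair. -/
def ofList : List Val → Val
  | [] => num 0
  | x :: l => pair x (ofList l)

end Val

/-- Elementary operations; `sub` is truncated subtraction, `div` is integer division, and `le` is
the comparison `a ≤ b`, with value `1` or `0`. -/
inductive Op where
  | id | const (n : ℕ) | fst | snd | add | sub | mul | div | le

/-- The function computed by an elementary operation. -/
def Op.eval : Op → Val → Val
  | .id => fun x => x
  | .const n => fun _ => .num n
  | .fst => Val.fst
  | .snd => Val.snd
  | .add => Val.arith (fun a b => a + b)
  | .sub => Val.arith (fun a b => a - b)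
  | .mul => Val.arith (fun a b => a * b)
  | .div => Val.arith (fun a b => a / b)
  | .le => Val.arith (fun a b => if a ≤ b then 1 else 0)

/-- Programs; each one maps a value to a value, when it halts. -/
inductive Prog where
  | op (o : Op)
  | pair (p q : Prog)
  | comp (p q : Prog)
  | ite (b p q : Prog)
  | loop (b p : Prog)

/-- `Runs p x y t`: on input `x` the program `p` halts with output `y` after time `t`.
Here `comp p q` runs `q` and then `p`; `ite b p q` runs `p` if the test `b` returns something other
than `0`, and otherwise `q`; `loop b p` is "while `b` do `p`". -/
inductive Runs : Prog → Val → Val → ℕ → Prop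
  | op (o : Op) (x : Val) : Runs (.op o) x (o.eval x) (x.size + (o.eval x).size + 1)
  | pair {p q : Prog} {x y z : Val} {s t : ℕ} :
      Runs p x y s → Runs q x z t → Runs (.pair p q) x (.pair y z) (s + t + 1)
  | comp {p q : Prog} {x y z : Val} {s t : ℕ} :
      Runs q x y s → Runs p y z t → Runs (.comp p q) x z (s + t + 1)
  | ite_true {b p q : Prog} {x w y : Val} {s t : ℕ} :
      Runs b x w s → w ≠ .num 0 → Runs p x y t → Runs (.ite b p q) x y (s + t + 1)
  | ite_false {b p q : Prog} {x y : Val} {s t : ℕ} :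
      Runs b x (.num 0) s → Runs q x y t → Runs (.ite b p q) x y (s + t + 1)
  | loop_stop {b p : Prog} {x : Val} {s : ℕ} :
      Runs b x (.num 0) s → Runs (.loop b p) x x (s + x.size + 1)
  | loop_step {b p : Prog} {x w y z : Val} {s t r : ℕ} :
      Runs b x w s → w ≠ .num 0 → Runs p x y t → Runs (.loop b p) y z r →
      Runs (.loop b p) x z (s + t + r + 1)

/-- The nonnegative rational `a / b` as an output value. -/
def fracVal (a b : ℕ) : Val := .pair (.num a) (.num b)

open Classical in
/-- Input encoding of a graph on `{0, …, n - 1}` together with a number `k`: the number `n`, the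
adjacency matrix as a list of rows, and `k`. -/
noncomputable def graphInput {n : ℕ} (H : SimpleGraph (Fin n)) (k : ℕ) : Val :=
  .pair (.num n) (.pair
    (.ofList (List.ofFn fun u => .ofList (List.ofFn fun w => .num (if H.Adj u w then 1 else 0))))
    (.num k))

/-- The real number `lam` can be approximated by rationals to within `1/m` in time polynomial
in `m`. -/
def PolyTimeApproximable (lam : ℝ) : Prop :=
  ∃ (p : Prog) (C : ℕ), ∀ m : ℕ, 1 ≤ m → ∃ a b t : ℕ, 0 < b ∧
    Runs p (.num m) (fracVal a b) t ∧ t ≤ C * m ^ C ∧ |(a : ℝ) / b - lam| ≤ 1 / m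

/-- The partition function of the hard core model with activity `lam` has an FPTAS on the finite
members of the family `G`: one deterministic program which, for every (labelled copy `H` of a)
finite member and every `ε > 0`, given as the integer `⌈1/ε⌉`, outputs a rational number within
a factor `1 ± ε` of the partition function, in time polynomial in the number `n` of vertices
and `1/ε`. -/
def HasFPTAS {ι : Type*} {V : ι → Type*} (G : ∀ i, SimpleGraph (V i)) (lam : ℝ) : Prop :=
  ∃ (p : Prog) (C : ℕ), ∀ (n : ℕ) (H : SimpleGraph (Fin n)), (∃ i, Nonempty (H ≃g G i)) →
    ∀ ε : ℝ, 0 < ε → ∃ a b t : ℕ, 0 < b ∧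
      Runs p (graphInput H ⌈1 / ε⌉₊) (fracVal a b) t ∧
      (t : ℝ) ≤ C * (n + 1 / ε + 1) ^ C ∧
      |(a : ℝ) / b - hardCoreZ H lam| ≤ ε * hardCoreZ H lam

/-! ## The contraction of the hard core recursion -/

/-! Recursion. Let Z(U) be the partition function of the subgraph induced on U. Deleting the
vertices of a list L one at a time makes Z(U \ L)/Z(U) telescope into factors Z(U-u)/Z(U) = 1/(1 + λ
Z((U-u) \ N(u))/Z(U-u)). Each new ratio has the same shape, with N(u) as its list
(`deletionRatio_eq_prod`). Unfolding gives a form of Weitz's tree: the nodes at depth ℓ below v are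
distinct self-avoiding walks from v (`levelCount_le_sawCount`). The occupation ratio of v is λ times
the ratio for the list N(v) after deleting v, and 1/Z is the ratio for the list of all vertices.

Decay. In the coordinate y = arsinh √R one step of the recursion, with value f, has differential
-tanh f · ∑ tanh(y_i) δ_i. Hölder's inequality with an exponent fitted to D > 1, together with two
one-variable maximisations, yields `messageUpdate_contraction`: for λ ≤ λ_c(D), the q-th power of
the change at a node is at most 1/D times the sum of the q-th powers of the changes at its children,
however many there are. Errors are thus summed over the leaves, so the number of walks matters and
not the maximum degree. Cutting the tree at depth ℓ costs at most a constant times (D^(-ℓ)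
N(v,ℓ))^(1/q) (`truncRatio_error`). Since λ_c is continuous, λ < λ_c(D) for some D > Δ, and the cost
is exponentially small in ℓ.

Mixing. A boundary condition amounts to deleting vertices
(`BoundaryCondition.occRatio_eq_rootRatio`), and the tree cut at depth ℓ only consults the ball of
radius ℓ (`truncRatio_congr`). Two conditions that agree near v therefore have the same truncated
value, close to both ratios.

Algorithm. At depth of order log(n/ε) the truncated tree is accurate, and the bound on the number of
walks makes its size polynomial. A stack machine evaluates it in exact rational arithmetic
(`machine_frame_run`), with λ replaced by a rational approximation; its numbers stay of polynomial
bit size (`StackInv.step`), and log Z is Lipschitz in log λ (`abs_log_partitionOn_sub_le`). -/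

theorem le_of_hasDerivAt_sign {g g' : ℝ → ℝ} {a b x : ℝ} (hx : x ∈ Set.Ioo a b)
    (hg : ∀ z ∈ Set.Ioo a b, HasDerivAt g (g' z) z)
    (hpos : ∀ z ∈ Set.Ioo a b, z < x → 0 ≤ g' z) (hneg : ∀ z ∈ Set.Ioo a b, x < z → g' z ≤ 0)
    {z : ℝ} (hz : z ∈ Set.Ioo a b) : g z ≤ g x := by
  rcases lt_trichotomy z x with h | h | h
  · have hsub : Set.Icc z x ⊆ Set.Ioo a b := fun w hw => ⟨hz.1.trans_le hw.1, hw.2.trans_lt hx.2⟩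
    obtain ⟨c, hc, hceq⟩ := exists_hasDerivAt_eq_slope g g' h
      (fun w hw => (hg w (hsub hw)).continuousAt.continuousWithinAt)
      (fun w hw => hg w (hsub (Set.Ioo_subset_Icc_self hw)))
    have h0 := hpos c (hsub (Set.Ioo_subset_Icc_self hc)) hc.2
    rw [hceq, le_div_iff₀ (by linarith)] at h0
    linarith
  · rw [h]
  · have hsub : Set.Icc x z ⊆ Set.Ioo a b := fun w hw => ⟨hx.1.trans_le hw.1, hw.2.trans_lt hz.2⟩
    obtain ⟨c, hc, hceq⟩ := exists_hasDerivAt_eq_slope g g' h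
      (fun w hw => (hg w (hsub hw)).continuousAt.continuousWithinAt)
      (fun w hw => hg w (hsub (Set.Ioo_subset_Icc_self hw)))
    have h0 := hneg c (hsub (Set.Ioo_subset_Icc_self hc)) hc.1
    rw [hceq, div_le_iff₀ (by linarith)] at h0
    linarith

/-- The quotient log(1+t)/t decreases in t; this is Bernoulli's inequality (1+t)^(s/t) ≤ 1+s after
taking logarithms. -/
theorem log_one_add_mul_le {s t : ℝ} (hs : 0 < s) (hst : s ≤ t) :
    s * Real.log (1 + t) ≤ t * Real.log (1 + s) := by
  have ht : 0 < t := hs.trans_le hst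
  have h := rpow_one_add_le_one_add_mul_self (s := t) (p := s / t) (by linarith)
    (by positivity) ((div_le_one ht).2 hst)
  rw [div_mul_cancel₀ _ ht.ne'] at h
  have h2 := Real.log_le_log (by positivity) h
  rw [Real.log_rpow (by linarith), div_mul_eq_mul_div, div_le_iff₀ ht] at h2
  linarith

/-- Half of the Hölder exponent attached to the fixed point `x` of the critical recursion. -/
noncomputable def halfExponent (x : ℝ) : ℝ := x / Real.log (1 + x)

/-- Guarantees that the Hölder exponent 2a exceeds 1 and so has a conjugate. -/
theorem one_lt_halfExponent {x : ℝ} (hx : 0 < x) : 1 < halfExponent x := by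
  rw [halfExponent, one_lt_div (Real.log_pos (by linarith))]
  have := Real.log_lt_sub_one_of_pos (x := 1 + x) (by linarith) (by linarith)
  linarith

theorem halfExponent_mul_log {x : ℝ} (hx : 0 < x) :
    halfExponent x * Real.log (1 + x) = x :=
  div_mul_cancel₀ _ (Real.log_pos (by linarith)).ne'

/-- The function (z/(1+z))^a / log(1+z) is largest at z = x: its logarithmic derivative has the sign
of a log(1+z) - z, which changes sign only once because log(1+z)/z decreases, and a is chosen to put
the zero at x. -/
theorem rpow_occupation_le {x z : ℝ} (hx : 0 < x) (hz : 0 ≤ z) :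
    (z / (1 + z)) ^ halfExponent x ≤
      (x / (1 + x)) ^ halfExponent x * (Real.log (1 + z) / Real.log (1 + x)) := by
  set a := halfExponent x with ha
  have ha1 : 1 < a := one_lt_halfExponent hx
  have hax : a * Real.log (1 + x) = x := halfExponent_mul_log hx
  rcases hz.eq_or_lt with rfl | hz
  · simp [Real.zero_rpow (by linarith : a ≠ 0)]
  have hlx : 0 < Real.log (1 + x) := Real.log_pos (by linarith)
  have hlz : 0 < Real.log (1 + z) := Real.log_pos (by linarith)
  have key : a * (Real.log z - Real.log (1 + z)) - Real.log (Real.log (1 + z)) ≤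
      a * (Real.log x - Real.log (1 + x)) - Real.log (Real.log (1 + x)) := by
    refine le_of_hasDerivAt_sign
      (g := fun z => a * (Real.log z - Real.log (1 + z)) - Real.log (Real.log (1 + z)))
      (g' := fun z => (a * Real.log (1 + z) - z) / (z * (1 + z) * Real.log (1 + z)))
      (a := 0) (b := max x z + 1) ⟨hx, by linarith [le_max_left x z]⟩ ?_ ?_ ?_
      ⟨hz, by linarith [le_max_right x z]⟩
    · intro w hw
      have hw0 : 0 < w := hw.1
      have hlw : 0 < Real.log (1 + w) := Real.log_pos (by linarith)
      have h1 : HasDerivAt (fun z : ℝ => Real.log (1 + z)) (1 / (1 + w)) w :=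
        ((hasDerivAt_id w).const_add 1).log (by simp; linarith)
      have h2 := (((Real.hasDerivAt_log hw0.ne').sub h1).const_mul a).sub (h1.log hlw.ne')
      refine h2.congr_deriv ?_
      field_simp
      ring
    · intro w hw hwx
      have hw0 : 0 < w := hw.1
      have hlw : 0 < Real.log (1 + w) := Real.log_pos (by linarith)
      have h := log_one_add_mul_le hw0 hwx.le
      refine div_nonneg ?_ (by positivity)
      rw [ha, halfExponent, div_mul_eq_mul_div, sub_nonneg, le_div_iff₀ hlx]
      exact h
    · intro w hw hwx
      have hw0 : 0 < w := hw.1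
      have hlw : 0 < Real.log (1 + w) := Real.log_pos (by linarith)
      have h := log_one_add_mul_le hx hwx.le
      refine div_nonpos_of_nonpos_of_nonneg ?_ (by positivity)
      rw [ha, halfExponent, div_mul_eq_mul_div, sub_nonpos, div_le_iff₀ hlx]
      exact h
  rw [← Real.log_le_log_iff (by positivity) (by positivity), Real.log_rpow (by positivity),
    Real.log_mul (by positivity) (by positivity), Real.log_rpow (by positivity),
    Real.log_div (by positivity) (by positivity), Real.log_div (by positivity) (by positivity),
    Real.log_div (by positivity) (by positivity)]
  linarith

/-- For L equal to the critical value L', the left side as a function of f is largest at f = x,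
where the right side is its value. Smaller L only decreases the logarithm. -/
theorem rpow_occupation_mul_log_le {x f L : ℝ} (hx : 0 < x) (hf : 0 < f)
    (hL : L ≤ x * (1 + x) ^ (1 + x⁻¹)) (hfL : f ≤ L) :
    (f / (1 + f)) ^ halfExponent x * Real.log (L / f) ≤
      (x / (1 + x)) ^ halfExponent x * ((1 + x⁻¹) * Real.log (1 + x)) := by
  set a := halfExponent x with ha
  have ha1 : 1 < a := one_lt_halfExponent hx
  have hax : a * Real.log (1 + x) = x := halfExponent_mul_log hx
  have hlx : 0 < Real.log (1 + x) := Real.log_pos (by linarith)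
  set L' := x * (1 + x) ^ (1 + x⁻¹) with hL'
  have hL'0 : 0 < L' := by positivity
  have hL0 : 0 < L := hf.trans_le hfL
  have hlogL' : Real.log L' = Real.log x + (1 + x⁻¹) * Real.log (1 + x) := by
    rw [hL', Real.log_mul hx.ne' (by positivity), Real.log_rpow (by linarith)]
  have hxL' : x < L' := by
    have : 1 < (1 + x) ^ (1 + x⁻¹) := Real.one_lt_rpow (by linarith) (by positivity)
    nlinarith
  clear_value L'
  have hrhs : 0 < (x / (1 + x)) ^ a * ((1 + x⁻¹) * Real.log (1 + x)) := by positivity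
  have hmono : (f / (1 + f)) ^ a * Real.log (L / f) ≤
      (f / (1 + f)) ^ a * (Real.log L' - Real.log f) := by
    rw [Real.log_div hL0.ne' hf.ne']
    have := Real.log_le_log hL0 hL
    gcongr
  refine hmono.trans ?_
  rcases (hfL.trans hL).eq_or_lt with h | hfL'
  · rw [h, sub_self, mul_zero]; exact hrhs.le
  have hpos : ∀ w, 0 < w → w < L' → 0 < Real.log L' - Real.log w := fun w h0 h1 =>
    sub_pos.2 (Real.log_lt_log h0 h1)
  have key : a * (Real.log f - Real.log (1 + f)) + Real.log (Real.log L' - Real.log f) ≤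
      a * (Real.log x - Real.log (1 + x)) + Real.log (Real.log L' - Real.log x) := by
    -- The numerator of the logarithmic derivative vanishes at x: the exponent fitted to the first
    -- maximisation serves the second one too, because L' is critical.
    have hnum : a * (Real.log L' - Real.log x) = 1 + x := by
      rw [hlogL', add_sub_cancel_left, mul_left_comm, hax]; field_simp; ring
    refine le_of_hasDerivAt_sign
      (g := fun z => a * (Real.log z - Real.log (1 + z)) + Real.log (Real.log L' - Real.log z))
      (g' := fun z => (a * (Real.log L' - Real.log z) - (1 + z)) /
        (z * (1 + z) * (Real.log L' - Real.log z)))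
      (a := 0) (b := L') ⟨hx, hxL'⟩ ?_ ?_ ?_ ⟨hf, hfL'⟩
    · intro w hw
      have hw0 : 0 < w := hw.1
      have hlw := hpos w hw0 hw.2
      have h1 : HasDerivAt (fun z : ℝ => Real.log (1 + z)) (1 / (1 + w)) w :=
        ((hasDerivAt_id w).const_add 1).log (by simp; linarith)
      have h2 := (((Real.hasDerivAt_log hw0.ne').sub h1).const_mul a).add
        (((Real.hasDerivAt_log hw0.ne').const_sub (Real.log L')).log hlw.ne')
      refine h2.congr_deriv ?_
      field_simp
      ring
    · intro w hw hwx
      have hw0 : 0 < w := hw.1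
      have hlw := hpos w hw0 hw.2
      refine div_nonneg ?_ (by positivity)
      have := Real.log_lt_log hw0 hwx
      nlinarith
    · intro w hw hwx
      have hw0 : 0 < w := hw.1
      have hlw := hpos w hw0 hw.2
      refine div_nonpos_of_nonpos_of_nonneg ?_ (by positivity)
      have := Real.log_lt_log hx hwx
      nlinarith
  have hlf := hpos f hf hfL'
  have hlhs : Real.log ((f / (1 + f)) ^ a * (Real.log L' - Real.log f)) =
      a * (Real.log f - Real.log (1 + f)) + Real.log (Real.log L' - Real.log f) := by
    rw [Real.log_mul (by positivity) hlf.ne', Real.log_rpow (by positivity),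
      Real.log_div (by positivity) (by positivity)]
  rw [← Real.log_le_log_iff (by positivity) hrhs, hlhs, Real.log_mul (by positivity)
    (by positivity), Real.log_rpow (by positivity), Real.log_div (by positivity) (by positivity)]
  rw [hlogL', add_sub_cancel_left] at key
  rw [hlogL']
  exact key

/-- Parametrises D = 1 + 1/x by the fixed point x of the critical recursion z ↦ λ_c(D)/(1+z)^D. -/
theorem criticalActivity_eq {x : ℝ} (hx : 0 < x) :
    criticalActivity (1 + x⁻¹) = x * (1 + x) ^ (1 + x⁻¹) := by
  have h1 : (1 + x⁻¹ : ℝ) = (1 + x) / x := by field_simp; ring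
  have h2 : (1 + x⁻¹ - 1 : ℝ) = x⁻¹ := by ring
  rw [criticalActivity, h2, Real.rpow_add_one (by positivity), Real.inv_rpow hx.le]
  nth_rewrite 1 [h1]
  rw [Real.div_rpow (by linarith) hx.le]
  have : 0 < x ^ (1 + x⁻¹) := by positivity
  field_simp

/-- The first maximisation bounds each summand by a multiple of log(1 + z i). These logarithms add
up to log(lam/f), so the number of children drops out, and the second maximisation bounds what
remains. At the extremal point both occupation probabilities are x/(1+x) = 1/D, which gives D ·
D^(-2a). -/
theorem occupation_sum_le {ι : Type*} (s : Finset ι) {x lam : ℝ} (hx : 0 < x) (hlam : 0 < lam)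
    (hcrit : lam ≤ criticalActivity (1 + x⁻¹)) {z : ι → ℝ} (hz : ∀ i, 0 ≤ z i) {f : ℝ}
    (hf : f = lam * ∏ i ∈ s, (1 + z i)⁻¹) :
    (f / (1 + f)) ^ halfExponent x * ∑ i ∈ s, (z i / (1 + z i)) ^ halfExponent x ≤
      (1 + x⁻¹) ^ (1 - 2 * halfExponent x) := by
  set a := halfExponent x with ha
  have hlx : 0 < Real.log (1 + x) := Real.log_pos (by linarith)
  have hz1 : ∀ i, 0 < 1 + z i := fun i => by linarith [hz i]
  have hprod : 0 < ∏ i ∈ s, (1 + z i)⁻¹ := Finset.prod_pos fun i _ => inv_pos.2 (hz1 i)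
  have hf0 : 0 < f := hf ▸ mul_pos hlam hprod
  have hprod1 : ∏ i ∈ s, (1 + z i)⁻¹ ≤ 1 :=
    Finset.prod_le_one (fun i _ => (inv_pos.2 (hz1 i)).le)
      fun i _ => inv_le_one_of_one_le₀ (by linarith [hz i])
  have hflam : f ≤ lam := by rw [hf]; nlinarith
  have hsum : ∑ i ∈ s, Real.log (1 + z i) = Real.log (lam / f) := by
    rw [hf, Real.log_div hlam.ne' (mul_pos hlam hprod).ne', Real.log_mul hlam.ne' hprod.ne',
      Real.log_prod (fun i _ => (inv_pos.2 (hz1 i)).ne')]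
    simp [Real.log_inv]
  have hA : ∑ i ∈ s, (z i / (1 + z i)) ^ a ≤
      (x / (1 + x)) ^ a * (Real.log (lam / f) / Real.log (1 + x)) := by
    rw [← hsum, Finset.sum_div, Finset.mul_sum]
    exact Finset.sum_le_sum fun i _ => rpow_occupation_le hx (hz i)
  have hB := rpow_occupation_mul_log_le hx hf0 (hcrit.trans_eq (criticalActivity_eq hx)) hflam
  rw [← ha] at hB
  have hc : 0 ≤ (x / (1 + x)) ^ a / Real.log (1 + x) := by positivity
  calc (f / (1 + f)) ^ a * ∑ i ∈ s, (z i / (1 + z i)) ^ a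
      ≤ (f / (1 + f)) ^ a * ((x / (1 + x)) ^ a * (Real.log (lam / f) / Real.log (1 + x))) := by
        gcongr
    _ = (x / (1 + x)) ^ a / Real.log (1 + x) * ((f / (1 + f)) ^ a * Real.log (lam / f)) := by ring
    _ ≤ (x / (1 + x)) ^ a / Real.log (1 + x) *
        ((x / (1 + x)) ^ a * ((1 + x⁻¹) * Real.log (1 + x))) := by gcongr
    _ = (1 + x⁻¹) ^ (1 - 2 * a) := by
        have h : x / (1 + x) = (1 + x⁻¹)⁻¹ := by field_simp; ring
        have hD : 0 < 1 + x⁻¹ := by positivity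
        rw [Real.rpow_sub hD, Real.rpow_one, mul_comm 2 a, Real.rpow_mul hD.le, h,
          Real.inv_rpow hD.le]
        rw [Real.rpow_two]
        field_simp


/-! ### The contracting coordinate arsinh √R. -/

/-- The hard core recursion in the coordinate `y = arsinh √R`. -/
noncomputable def messageUpdate {ι : Type*} (s : Finset ι) (lam : ℝ) (y : ι → ℝ) : ℝ :=
  Real.arsinh (√lam * ∏ i ∈ s, (Real.cosh (y i))⁻¹)

theorem sq_tanh_eq (y : ℝ) : Real.tanh y ^ 2 = Real.sinh y ^ 2 / (1 + Real.sinh y ^ 2) := by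
  rw [Real.tanh_eq_sinh_div_cosh, div_pow, Real.cosh_sq, add_comm]

theorem tanh_nonneg {y : ℝ} (hy : 0 ≤ y) : 0 ≤ Real.tanh y := by
  rw [Real.tanh_eq_sinh_div_cosh]
  exact div_nonneg (Real.sinh_nonneg_iff.2 hy) (Real.cosh_pos y).le

theorem tanh_rpow_eq {y : ℝ} (hy : 0 ≤ y) (a : ℝ) :
    Real.tanh y ^ (2 * a) = (Real.sinh y ^ 2 / (1 + Real.sinh y ^ 2)) ^ a := by
  rw [← sq_tanh_eq, Real.rpow_mul (tanh_nonneg hy), Real.rpow_two]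

theorem sinh_messageUpdate_sq {ι : Type*} (s : Finset ι) {lam : ℝ} (hlam : 0 < lam) (y : ι → ℝ) :
    Real.sinh (messageUpdate s lam y) ^ 2 = lam * ∏ i ∈ s, (1 + Real.sinh (y i) ^ 2)⁻¹ := by
  rw [messageUpdate, Real.sinh_arsinh, mul_pow, Real.sq_sqrt hlam.le, ← Finset.prod_pow]
  congr 1
  exact Finset.prod_congr rfl fun i _ => by rw [inv_pow, Real.cosh_sq, add_comm]

theorem messageUpdate_nonneg {ι : Type*} (s : Finset ι) (lam : ℝ) (y : ι → ℝ) :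
    0 ≤ messageUpdate s lam y :=
  Real.arsinh_nonneg_iff.2 <| mul_nonneg (Real.sqrt_nonneg _) <|
    Finset.prod_nonneg fun _ _ => (inv_pos.2 (Real.cosh_pos _)).le

/-- Since tanh² y = R/(1+R), Hölder's inequality reduces the bound on the differential to the 2a-th
root of `occupation_sum_le`, and (1-2a)/(2a) = -1/q. -/
theorem tanh_sum_le {ι : Type*} (s : Finset ι) {x lam : ℝ} (hx : 0 < x) (hlam : 0 < lam)
    (hcrit : lam ≤ criticalActivity (1 + x⁻¹)) {y : ι → ℝ} (hy : ∀ i, 0 ≤ y i) (δ : ι → ℝ)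
    {q : ℝ} (hq : (2 * halfExponent x).HolderConjugate q) :
    Real.tanh (messageUpdate s lam y) * |∑ i ∈ s, Real.tanh (y i) * δ i| ≤
      ((1 + x⁻¹)⁻¹ * ∑ i ∈ s, |δ i| ^ q) ^ (1 / q) := by
  set a := halfExponent x with ha
  set T := Real.tanh (messageUpdate s lam y) with hT
  have hT0 : 0 ≤ T := tanh_nonneg (messageUpdate_nonneg s lam y)
  have hD : 0 < 1 + x⁻¹ := by positivity
  have hp : 0 < 2 * a := hq.pos
  have hS0 : 0 ≤ ∑ i ∈ s, |δ i| ^ q :=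
    Finset.sum_nonneg fun i _ => Real.rpow_nonneg (abs_nonneg _) _
  have hP0 : 0 ≤ ∑ i ∈ s, Real.tanh (y i) ^ (2 * a) :=
    Finset.sum_nonneg fun i _ => Real.rpow_nonneg (tanh_nonneg (hy i)) _
  have h1 : |∑ i ∈ s, Real.tanh (y i) * δ i| ≤
      (∑ i ∈ s, Real.tanh (y i) ^ (2 * a)) ^ (1 / (2 * a)) * (∑ i ∈ s, |δ i| ^ q) ^ (1 / q) := by
    refine (Finset.abs_sum_le_sum_abs _ _).trans ?_
    have h := Real.inner_le_Lp_mul_Lq_of_nonneg s hq (f := fun i => Real.tanh (y i))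
      (g := fun i => |δ i|) (fun i _ => tanh_nonneg (hy i)) (fun i _ => abs_nonneg _)
    simpa only [abs_mul, abs_of_nonneg (tanh_nonneg (hy _))] using h
  have h2 : T ^ (2 * a) * ∑ i ∈ s, Real.tanh (y i) ^ (2 * a) ≤ (1 + x⁻¹) ^ (1 - 2 * a) := by
    rw [hT, tanh_rpow_eq (messageUpdate_nonneg s lam y)]
    simp only [fun i => tanh_rpow_eq (hy i) a]
    exact occupation_sum_le s hx hlam hcrit (fun i => sq_nonneg _)
      (sinh_messageUpdate_sq s hlam y)
  have h3 : T * (∑ i ∈ s, Real.tanh (y i) ^ (2 * a)) ^ (1 / (2 * a)) ≤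
      (1 + x⁻¹) ^ (-(1 / q)) := by
    have hexp : (1 - 2 * a) * (1 / (2 * a)) = -(1 / q) := by
      have := hq.inv_add_inv_eq_one
      have hne : a ≠ 0 := by linarith
      rw [one_div q, ← sub_eq_iff_eq_add'.2 this.symm]
      field_simp
      ring
    have hTT : T = (T ^ (2 * a)) ^ (1 / (2 * a)) := by
      rw [← Real.rpow_mul hT0, mul_one_div_cancel hp.ne', Real.rpow_one]
    rw [hTT, ← Real.mul_rpow (Real.rpow_nonneg hT0 _) hP0, ← hexp, Real.rpow_mul hD.le]
    exact Real.rpow_le_rpow (mul_nonneg (Real.rpow_nonneg hT0 _) hP0) h2 (by positivity)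
  calc T * |∑ i ∈ s, Real.tanh (y i) * δ i|
      ≤ T * ((∑ i ∈ s, Real.tanh (y i) ^ (2 * a)) ^ (1 / (2 * a)) *
          (∑ i ∈ s, |δ i| ^ q) ^ (1 / q)) := by gcongr
    _ = T * (∑ i ∈ s, Real.tanh (y i) ^ (2 * a)) ^ (1 / (2 * a)) *
          (∑ i ∈ s, |δ i| ^ q) ^ (1 / q) := by ring
    _ ≤ (1 + x⁻¹) ^ (-(1 / q)) * (∑ i ∈ s, |δ i| ^ q) ^ (1 / q) := by gcongr
    _ = ((1 + x⁻¹)⁻¹ * ∑ i ∈ s, |δ i| ^ q) ^ (1 / q) := by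
        rw [Real.mul_rpow (by positivity) hS0, Real.inv_rpow hD.le, Real.rpow_neg hD.le]

/-- This is where the coordinate pays off: log cosh has derivative tanh, and the outer arsinh turns
sinh f into tanh f, so parent and children enter symmetrically. -/
theorem hasDerivAt_messageUpdate {ι : Type*} (s : Finset ι) (lam : ℝ) (z δ : ι → ℝ) (θ : ℝ) :
    HasDerivAt (fun θ => messageUpdate s lam fun i => z i + θ * δ i)
      (-(Real.tanh (messageUpdate s lam fun i => z i + θ * δ i) *
        ∑ i ∈ s, Real.tanh (z i + θ * δ i) * δ i)) θ := by
  have hexp : ∀ y : ι → ℝ, messageUpdate s lam y =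
      Real.arsinh (√lam * Real.exp (-∑ i ∈ s, Real.log (Real.cosh (y i)))) := by
    intro y
    rw [messageUpdate, Real.exp_neg, Real.exp_sum, Finset.prod_inv_distrib]
    simp only [Real.exp_log (Real.cosh_pos _)]
  simp only [hexp]
  have h1 : ∀ i ∈ s, HasDerivAt (fun θ => Real.log (Real.cosh (z i + θ * δ i)))
      (Real.tanh (z i + θ * δ i) * δ i) θ := by
    intro i _
    have h := ((((hasDerivAt_id θ).mul_const (δ i)).const_add (z i)).cosh).log
      (Real.cosh_pos _).ne'
    refine h.congr_deriv ?_
    simp only [id, one_mul, Real.tanh_eq_sinh_div_cosh]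
    ring
  refine (((HasDerivAt.fun_sum h1).fun_neg.exp.const_mul √lam).arsinh).congr_deriv ?_
  rw [Real.tanh_arsinh, smul_eq_mul]
  ring

/-- Mean value inequality along the segment from z to y, which stays in the nonnegative orthant,
where the bound on the differential is uniform. -/
theorem messageUpdate_contraction {ι : Type*} (s : Finset ι) {x lam : ℝ} (hx : 0 < x)
    (hlam : 0 < lam) (hcrit : lam ≤ criticalActivity (1 + x⁻¹)) {y z : ι → ℝ}
    (hy : ∀ i, 0 ≤ y i) (hz : ∀ i, 0 ≤ z i)
    {q : ℝ} (hq : (2 * halfExponent x).HolderConjugate q) :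
    |messageUpdate s lam y - messageUpdate s lam z| ^ q ≤
      (1 + x⁻¹)⁻¹ * ∑ i ∈ s, |y i - z i| ^ q := by
  have hS0 : 0 ≤ (1 + x⁻¹)⁻¹ * ∑ i ∈ s, |y i - z i| ^ q :=
    mul_nonneg (by positivity) (Finset.sum_nonneg fun i _ => Real.rpow_nonneg (abs_nonneg _) _)
  have h := norm_image_sub_le_of_norm_deriv_le_segment_01'
    (f := fun θ => messageUpdate s lam fun i => z i + θ * (y i - z i))
    (C := ((1 + x⁻¹)⁻¹ * ∑ i ∈ s, |y i - z i| ^ q) ^ (1 / q))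
    (fun θ _ => (hasDerivAt_messageUpdate s lam z (fun i => y i - z i) θ).hasDerivWithinAt) (by
      intro θ hθ
      rw [norm_neg, norm_mul, Real.norm_eq_abs, Real.norm_eq_abs,
        abs_of_nonneg (tanh_nonneg (messageUpdate_nonneg _ _ _))]
      refine tanh_sum_le s hx hlam hcrit (fun i => ?_) (fun i => y i - z i) hq
      nlinarith [hy i, hz i, hθ.1, hθ.2, mul_nonneg hθ.1 (hy i),
        mul_nonneg (sub_nonneg.2 hθ.2.le) (hz i)])
  simp only [one_mul, zero_mul, add_zero, add_sub_cancel, Real.norm_eq_abs] at h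
  calc _ ≤ (((1 + x⁻¹)⁻¹ * ∑ i ∈ s, |y i - z i| ^ q) ^ (1 / q)) ^ q :=
        Real.rpow_le_rpow (abs_nonneg _) h hq.symm.pos.le
    _ = _ := by rw [← Real.rpow_mul hS0, one_div_mul_cancel hq.symm.pos.ne', Real.rpow_one]

/-! ## The partition function on vertex subsets -/

open Classical in
/-- The weight of a set of vertices in the hard core model. -/
noncomputable def indepWeight {V : Type*} (G : SimpleGraph V) (lam : ℝ) (I : Finset V) : ℝ :=
  if G.IsIndepSet (I : Set V) then lam ^ I.card else 0

/-- The hard core partition function of the subgraph induced on a finite set of vertices. -/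
noncomputable def partitionOn {V : Type*} (G : SimpleGraph V) (lam : ℝ) (U : Finset V) : ℝ :=
  ∑ I ∈ U.powerset, indepWeight G lam I

section PartitionOn

variable {V : Type*} {G : SimpleGraph V} {lam : ℝ}

theorem indepWeight_of_indep {I : Finset V} (h : G.IsIndepSet (I : Set V)) :
    indepWeight G lam I = lam ^ I.card := if_pos h

theorem indepWeight_of_not_indep {I : Finset V} (h : ¬ G.IsIndepSet (I : Set V)) :
    indepWeight G lam I = 0 := if_neg h

theorem indepWeight_nonneg (hlam : 0 < lam) (I : Finset V) : 0 ≤ indepWeight G lam I := by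
  rw [indepWeight]; split_ifs <;> positivity

theorem partitionOn_pos (hlam : 0 < lam) (U : Finset V) : 0 < partitionOn G lam U :=
  Finset.sum_pos' (fun I _ => indepWeight_nonneg hlam I)
    ⟨∅, by simp, by rw [indepWeight_of_indep (by simp)]; simp⟩

theorem hardCoreZ_eq_partitionOn [Fintype V] : hardCoreZ G lam = partitionOn G lam Finset.univ := by
  classical
  rw [hardCoreZ, partitionOn, Finset.sum_filter, Finset.powerset_univ]
  rfl

instance symm_not_adj (G : SimpleGraph V) : Std.Symm fun v w => ¬ G.Adj v w :=
  ⟨fun _ _ h h' => h h'.symm⟩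

theorem isIndepSet_insert [DecidableEq V] {u : V} {I : Finset V} (hu : u ∉ I) :
    G.IsIndepSet ((insert u I : Finset V) : Set V) ↔
      G.IsIndepSet (I : Set V) ∧ ∀ w ∈ I, ¬ G.Adj u w := by
  rw [SimpleGraph.IsIndepSet, SimpleGraph.IsIndepSet, Finset.coe_insert,
    Set.pairwise_insert_of_symm_of_notMem (by simpa using hu)]
  simp

/-- Sets containing a neighbour of u have weight zero once u is inserted. The set U' is given by its
members, so that callers may describe it through their own neighbour lists. -/
theorem sum_indepWeight_insert [DecidableEq V] {u : V} {U U' : Finset V} (hu : u ∉ U)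
    (hU' : ∀ w, w ∈ U' ↔ w ∈ U ∧ ¬ G.Adj u w) :
    ∑ I ∈ U.powerset, indepWeight G lam (insert u I) = lam * partitionOn G lam U' := by
  rw [partitionOn, Finset.mul_sum]
  symm
  have hsub : U'.powerset ⊆ U.powerset := Finset.powerset_mono.2 fun w hw => ((hU' w).1 hw).1
  rw [← Finset.sum_subset hsub]
  · refine Finset.sum_congr rfl fun I hI => ?_
    rw [Finset.mem_powerset] at hI
    have huI : u ∉ I := fun h => hu ((hU' _).1 (hI h)).1
    have hiff := isIndepSet_insert (G := G) huI
    by_cases h : G.IsIndepSet (I : Set V)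
    · rw [indepWeight_of_indep h, indepWeight_of_indep (hiff.2 ⟨h, fun w hw => ((hU' w).1 (hI hw)).2⟩),
        Finset.card_insert_of_notMem huI, pow_succ']
    · rw [indepWeight_of_not_indep h, indepWeight_of_not_indep fun h' => h (hiff.1 h').1, mul_zero]
  · intro I hI hI'
    rw [Finset.mem_powerset] at hI hI'
    have hiff := isIndepSet_insert (G := G) (fun h => hu (hI h) : u ∉ I)
    refine indepWeight_of_not_indep fun h => hI' fun w hw => ?_
    exact (hU' w).2 ⟨hI hw, (hiff.1 h).2 w hw⟩

theorem partitionOn_eq_erase_add [DecidableEq V] {u : V} {U U' : Finset V} (hu : u ∈ U)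
    (hU' : ∀ w, w ∈ U' ↔ w ∈ U.erase u ∧ ¬ G.Adj u w) :
    partitionOn G lam U = partitionOn G lam (U.erase u) + lam * partitionOn G lam U' := by
  rw [← sum_indepWeight_insert (Finset.notMem_erase u U) hU', partitionOn, partitionOn]
  conv_lhs => rw [← Finset.insert_erase hu]
  exact Finset.sum_powerset_insert (Finset.notMem_erase u U) _

theorem partitionOn_mono (hlam : 0 < lam) {U U' : Finset V} (h : U ⊆ U') :
    partitionOn G lam U ≤ partitionOn G lam U' :=
  Finset.sum_le_sum_of_subset_of_nonneg (Finset.powerset_mono.2 h)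
    fun I _ _ => indepWeight_nonneg hlam I

theorem partitionOn_activity_mono {mu : ℝ} (hlam : 0 < lam) (h : lam ≤ mu) (U : Finset V) :
    partitionOn G lam U ≤ partitionOn G mu U := by
  refine Finset.sum_le_sum fun I _ => ?_
  rw [indepWeight, indepWeight]
  split_ifs
  · gcongr
  · rfl

/-- No set in the sum has more than |U| elements. With monotonicity this makes log Z Lipschitz in
the logarithm of the activity. -/
theorem partitionOn_activity_le {mu : ℝ} (hlam : 0 < lam) (h : lam ≤ mu) (U : Finset V) :
    partitionOn G mu U ≤ (mu / lam) ^ U.card * partitionOn G lam U := by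
  rw [partitionOn, partitionOn, Finset.mul_sum]
  refine Finset.sum_le_sum fun I hI => ?_
  rw [indepWeight, indepWeight]
  split_ifs
  · have hI := Finset.card_le_card (Finset.mem_powerset.1 hI)
    have h1 : 1 ≤ mu / lam := (one_le_div hlam).2 h
    calc mu ^ I.card = (mu / lam) ^ I.card * lam ^ I.card := by
          rw [← mul_pow, div_mul_cancel₀ _ hlam.ne']
      _ ≤ _ := by gcongr
  · simp

end PartitionOn

/-! ## The recursion on the tree of self-avoiding walks -/

section Recursion

variable {V : Type*} [DecidableEq V]

/-- The vertices of `L` present in `U`, each paired with what is left of `U` once it and its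
predecessors are deleted. -/
def children (U : Finset V) : List V → List (Finset V × V)
  | [] => []
  | u :: L => if u ∈ U then (U.erase u, u) :: children (U.erase u) L else children U L

/-- The recursion for the ratio `Z(U \ L) / Z(U)`, cut off at depth `ℓ`. -/
noncomputable def truncRatio (lam : ℝ) (nb : V → List V) : ℕ → Finset V → List V → ℝ
  | 0, _, _ => 1
  | ℓ + 1, U, L =>
    ((children U L).map fun c => (1 + lam * truncRatio lam nb ℓ c.1 (nb c.2))⁻¹).prod

/-- The number of nodes at depth `ℓ` below `v` in the recursion tree. -/
def levelCount (nb : V → List V) : ℕ → Finset V → V → ℕ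
  | 0, _, _ => 1
  | ℓ + 1, U, v => ((children U (nb v)).map fun c => levelCount nb ℓ c.1 c.2).sum

/-- The number of nodes of the recursion tree cut off at depth `ℓ`. -/
def nodeCount (nb : V → List V) : ℕ → Finset V → List V → ℕ
  | 0, _, _ => 1
  | ℓ + 1, U, L => 1 + ((children U L).map fun c => nodeCount nb ℓ c.1 (nb c.2)).sum

/-- The ratio `Z(U \ L) / Z(U)`. -/
noncomputable def deletionRatio (G : SimpleGraph V) (lam : ℝ) (U : Finset V) (L : List V) : ℝ :=
  partitionOn G lam (U \ L.toFinset) / partitionOn G lam U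

variable {G : SimpleGraph V} {lam : ℝ} {nb : V → List V}

theorem deletionRatio_nonneg (hlam : 0 < lam) (U : Finset V) (L : List V) :
    0 ≤ deletionRatio G lam U L :=
  div_nonneg (partitionOn_pos hlam _).le (partitionOn_pos hlam _).le

theorem deletionRatio_le_one (hlam : 0 < lam) (U : Finset V) (L : List V) :
    deletionRatio G lam U L ≤ 1 :=
  (div_le_one (partitionOn_pos hlam _)).2 (partitionOn_mono hlam Finset.sdiff_subset)

theorem partitionOn_eq_erase_mul (hlam : 0 < lam) (hnb : ∀ v w, w ∈ nb v ↔ G.Adj v w) {u : V}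
    {U : Finset V} (hu : u ∈ U) :
    partitionOn G lam U = partitionOn G lam (U.erase u) *
      (1 + lam * deletionRatio G lam (U.erase u) (nb u)) := by
  have h := (partitionOn_pos (G := G) hlam (U.erase u)).ne'
  rw [partitionOn_eq_erase_add (U' := U.erase u \ (nb u).toFinset) hu (fun w => by simp [hnb]),
    deletionRatio, mul_add, mul_one, mul_left_comm, mul_div_cancel₀ _ h]

/-- Telescoping over the vertices of L: a present vertex contributes the factor Z(U-u)/Z(U), in
which a ratio for the list `nb u` reappears, and an absent vertex contributes nothing. -/
theorem deletionRatio_eq_prod (hlam : 0 < lam) (hnb : ∀ v w, w ∈ nb v ↔ G.Adj v w)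
    (U : Finset V) (L : List V) :
    deletionRatio G lam U L =
      ((children U L).map fun c => (1 + lam * deletionRatio G lam c.1 (nb c.2))⁻¹).prod := by
  induction L generalizing U with
  | nil => simp [children, deletionRatio, (partitionOn_pos hlam U).ne']
  | cons u L ih =>
    by_cases hu : u ∈ U
    · have h : U \ (u :: L).toFinset = U.erase u \ L.toFinset := by
        ext w; simp; tauto
      rw [children, if_pos hu, List.map_cons, List.prod_cons, ← ih, deletionRatio, h,
        partitionOn_eq_erase_mul hlam hnb hu, deletionRatio, mul_comm (partitionOn G lam (U.erase u)),
        ← div_div, div_right_comm, div_eq_inv_mul]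
      rfl
    · have h : U \ (u :: L).toFinset = U \ L.toFinset := by
        ext w
        simp only [Finset.mem_sdiff, List.mem_toFinset, List.mem_cons, not_or]
        exact ⟨fun h => ⟨h.1, h.2.2⟩, fun h => ⟨h.1, fun hw => hu (hw ▸ h.1), h.2⟩⟩
      rw [children, if_neg hu, ← ih, deletionRatio, h, deletionRatio]

theorem truncRatio_nonneg (hlam : 0 < lam) (ℓ : ℕ) (U : Finset V) (L : List V) :
    0 ≤ truncRatio lam nb ℓ U L := by
  induction ℓ generalizing U L with
  | zero => simp [truncRatio]
  | succ ℓ ih =>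
    refine List.prod_nonneg fun a ha => ?_
    obtain ⟨c, -, rfl⟩ := List.mem_map.1 ha
    have := ih c.1 (nb c.2)
    positivity

theorem list_prod_le_one {L : List ℝ} (h : ∀ a ∈ L, 0 ≤ a ∧ a ≤ 1) : L.prod ≤ 1 := by
  induction L with
  | nil => simp
  | cons a L ih =>
    rw [List.prod_cons]
    have h1 := h a (by simp)
    exact mul_le_one₀ h1.2 (List.prod_nonneg fun b hb => (h b (by simp [hb])).1)
      (ih fun b hb => h b (by simp [hb]))

theorem truncRatio_le_one (hlam : 0 < lam) (ℓ : ℕ) (U : Finset V) (L : List V) :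
    truncRatio lam nb ℓ U L ≤ 1 := by
  cases ℓ with
  | zero => simp [truncRatio]
  | succ ℓ =>
    refine list_prod_le_one fun a ha => ?_
    obtain ⟨c, -, rfl⟩ := List.mem_map.1 ha
    have := truncRatio_nonneg (nb := nb) hlam ℓ c.1 (nb c.2)
    exact ⟨by positivity, inv_le_one_of_one_le₀ (by nlinarith)⟩

/-! ### Truncation error -/

/-- The coordinate in which the recursion contracts. -/
noncomputable def message (r : ℝ) : ℝ := Real.arsinh √r

theorem message_nonneg (r : ℝ) : 0 ≤ message r := Real.arsinh_nonneg_iff.2 (Real.sqrt_nonneg r)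

theorem message_mono {r s : ℝ} (h : r ≤ s) : message r ≤ message s :=
  Real.arsinh_le_arsinh.2 (Real.sqrt_le_sqrt h)

theorem sinh_message_sq {r : ℝ} (hr : 0 ≤ r) : Real.sinh (message r) ^ 2 = r := by
  rw [message, Real.sinh_arsinh, Real.sq_sqrt hr]

theorem message_prod (hlam : 0 < lam) {α : Type*} (L : List α) {r : α → ℝ}
    (hr : ∀ c, 0 ≤ r c) : message (lam * (L.map fun c => (1 + r c)⁻¹).prod) =
      messageUpdate Finset.univ lam fun i : Fin L.length => message (r L[i]) := by
  have h : lam * (L.map fun c => (1 + r c)⁻¹).prod =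
      Real.sinh (messageUpdate Finset.univ lam fun i : Fin L.length => message (r L[i])) ^ 2 := by
    rw [sinh_messageUpdate_sq _ hlam]
    simp only [sinh_message_sq (hr _)]
    rw [← Fin.prod_univ_fun_getElem L (fun c => (1 + r c)⁻¹)]
    rfl
  rw [h, message, Real.sqrt_sq (Real.sinh_nonneg_iff.2 (messageUpdate_nonneg _ _ _)),
    Real.arsinh_sinh]

theorem message_prod_contraction {x q : ℝ} (hx : 0 < x) (hlam : 0 < lam)
    (hcrit : lam ≤ criticalActivity (1 + x⁻¹)) (hq : (2 * halfExponent x).HolderConjugate q)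
    {α : Type*} (L : List α) {r r' : α → ℝ} (hr : ∀ c, 0 ≤ r c) (hr' : ∀ c, 0 ≤ r' c) :
    |message (lam * (L.map fun c => (1 + r c)⁻¹).prod) -
        message (lam * (L.map fun c => (1 + r' c)⁻¹).prod)| ^ q ≤
      (1 + x⁻¹)⁻¹ * (L.map fun c => |message (r c) - message (r' c)| ^ q).sum := by
  rw [message_prod hlam L hr, message_prod hlam L hr',
    ← Fin.sum_univ_fun_getElem L (fun c => |message (r c) - message (r' c)| ^ q)]
  exact messageUpdate_contraction _ hx hlam hcrit (fun _ => message_nonneg _)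
    (fun _ => message_nonneg _) hq

/-- At depth 0 both messages lie between 0 and `message lam`. Each level above multiplies by 1/D and
adds up the q-th powers over the children, so every leaf at depth ℓ is charged D^(-ℓ). -/
theorem message_truncRatio_error {x q : ℝ} (hx : 0 < x) (hlam : 0 < lam)
    (hcrit : lam ≤ criticalActivity (1 + x⁻¹)) (hq : (2 * halfExponent x).HolderConjugate q)
    (hnb : ∀ v w, w ∈ nb v ↔ G.Adj v w) (ℓ : ℕ) (U : Finset V) (v : V) :
    |message (lam * deletionRatio G lam U (nb v)) -
        message (lam * truncRatio lam nb ℓ U (nb v))| ^ q ≤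
      message lam ^ q * ((1 + x⁻¹)⁻¹ ^ ℓ * levelCount nb ℓ U v) := by
  induction ℓ generalizing U v with
  | zero =>
    simp only [truncRatio, levelCount, mul_one, pow_zero, Nat.cast_one]
    refine Real.rpow_le_rpow (abs_nonneg _) ?_ hq.symm.pos.le
    have h := message_mono (mul_le_of_le_one_right hlam.le (deletionRatio_le_one (G := G) hlam U (nb v)))
    rw [abs_sub_le_iff]
    constructor <;> linarith [message_nonneg (lam * deletionRatio G lam U (nb v)),
      message_nonneg lam]
  | succ ℓ ih =>
    rw [deletionRatio_eq_prod hlam hnb, truncRatio, levelCount]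
    refine (message_prod_contraction hx hlam hcrit hq (children U (nb v))
      (fun c => mul_nonneg hlam.le (deletionRatio_nonneg (G := G) hlam c.1 (nb c.2)))
      (fun c => mul_nonneg hlam.le (truncRatio_nonneg (nb := nb) hlam ℓ c.1 (nb c.2)))).trans ?_
    have h : ∀ C : List (Finset V × V), (C.map fun c =>
        |message (lam * deletionRatio G lam c.1 (nb c.2)) -
          message (lam * truncRatio lam nb ℓ c.1 (nb c.2))| ^ q).sum ≤
        message lam ^ q * ((1 + x⁻¹)⁻¹ ^ ℓ *
          ((C.map fun c => levelCount nb ℓ c.1 c.2).sum : ℕ)) := by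
      intro C
      induction C with
      | nil => simp
      | cons c C ihC =>
        simp only [List.map_cons, List.sum_cons, Nat.cast_add]
        linarith [ih c.1 c.2]
    have hD : 0 ≤ (1 + x⁻¹)⁻¹ := by positivity
    refine (mul_le_mul_of_nonneg_left (h _) hD).trans_eq ?_
    ring

/-- The inverse coordinate sinh² has derivative 2 sinh cosh ≤ sinh² + cosh² ≤ 1 + 2 lam on the
relevant interval. -/
theorem abs_sub_le_message {r s : ℝ} (hr : 0 ≤ r) (hs : 0 ≤ s) (hrl : r ≤ lam) (hsl : s ≤ lam) :
    |r - s| ≤ 2 * (1 + lam) * |message r - message s| := by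
  have h := Convex.norm_image_sub_le_of_norm_hasDerivWithin_le
    (f := fun y => Real.sinh y ^ 2) (f' := fun y => 2 * Real.sinh y * Real.cosh y)
    (s := Set.Icc 0 (message lam)) (C := 2 * (1 + lam)) (x := message s) (y := message r)
    (fun y _ => by
      have := ((Real.hasDerivAt_sinh y).fun_pow 2).hasDerivWithinAt (s := Set.Icc 0 (message lam))
      simpa using this)
    (fun y hy => by
      have h0 : 0 ≤ Real.sinh y := Real.sinh_nonneg_iff.2 hy.1
      have hc := Real.cosh_pos y
      have h1 : Real.sinh y ^ 2 ≤ lam := by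
        rw [← sinh_message_sq (hr.trans hrl)]
        have := Real.sinh_le_sinh.2 hy.2
        gcongr
      rw [Real.norm_of_nonneg (by positivity)]
      nlinarith [Real.cosh_sq y, sq_nonneg (Real.sinh y - Real.cosh y)])
    (convex_Icc _ _) ⟨message_nonneg _, message_mono hsl⟩ ⟨message_nonneg _, message_mono hrl⟩
  simpa [sinh_message_sq hr, sinh_message_sq hs] using h

/-- Truncation at depth `ℓ` perturbs the occupation ratio by at most
`K ((1 + x⁻¹)⁻¹ ^ ℓ · levelCount)^{1/q}`. -/
theorem truncRatio_error {x q : ℝ} (hx : 0 < x) (hlam : 0 < lam)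
    (hcrit : lam ≤ criticalActivity (1 + x⁻¹)) (hq : (2 * halfExponent x).HolderConjugate q)
    (hnb : ∀ v w, w ∈ nb v ↔ G.Adj v w) (ℓ : ℕ) (U : Finset V) (v : V) :
    |lam * deletionRatio G lam U (nb v) - lam * truncRatio lam nb ℓ U (nb v)| ≤
      2 * (1 + lam) * message lam * ((1 + x⁻¹)⁻¹ ^ ℓ * levelCount nb ℓ U v) ^ (1 / q) := by
  have hq0 := hq.symm.pos
  have h := Real.rpow_le_rpow (Real.rpow_nonneg (abs_nonneg _) _)
    (message_truncRatio_error hx hlam hcrit hq hnb ℓ U v) (one_div_nonneg.2 hq0.le)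
  rw [← Real.rpow_mul (abs_nonneg _), mul_one_div_cancel hq0.ne', Real.rpow_one,
    Real.mul_rpow (Real.rpow_nonneg (message_nonneg _) _) (by positivity),
    ← Real.rpow_mul (message_nonneg _), mul_one_div_cancel hq0.ne', Real.rpow_one] at h
  have h2 := abs_sub_le_message
    (mul_nonneg hlam.le (deletionRatio_nonneg (G := G) hlam U (nb v)))
    (mul_nonneg hlam.le (truncRatio_nonneg (nb := nb) hlam ℓ U (nb v)))
    (mul_le_of_le_one_right hlam.le (deletionRatio_le_one hlam _ _))
    (mul_le_of_le_one_right hlam.le (truncRatio_le_one hlam _ _ _))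
  refine h2.trans ?_
  rw [mul_assoc (2 * (1 + lam))]
  gcongr

/-! ### Locality -/

/-- The relation P u W W' stands for "W and W' look alike from u". It must survive the deletion of
one vertex from both sets, because the sets shrink along the list, and it depends on u because each
child looks from its own position. -/
theorem children_map_congr {β : Type*} {f : Finset V × V → β} {U U' : Finset V} {L : List V}
    {P : V → Finset V → Finset V → Prop} (hP : ∀ u ∈ L, ∀ w W W', P u W W' →
      P u (W.erase w) (W'.erase w)) (hmem : ∀ u ∈ L, ∀ W W', P u W W' → (u ∈ W ↔ u ∈ W'))
    (hf : ∀ u ∈ L, ∀ W W', P u W W' → f (W, u) = f (W', u)) (h : ∀ u ∈ L, P u U U') :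
    (children U L).map f = (children U' L).map f := by
  induction L generalizing U U' with
  | nil => rfl
  | cons u L ih =>
    have hu : u ∈ u :: L := List.mem_cons_self
    have ih' : ∀ {W W' : Finset V}, (∀ v ∈ L, P v W W') →
        (children W L).map f = (children W' L).map f := fun hW =>
      ih (fun v hv => hP v (List.mem_cons_of_mem _ hv))
        (fun v hv => hmem v (List.mem_cons_of_mem _ hv))
        (fun v hv => hf v (List.mem_cons_of_mem _ hv)) hW
    have hiff := hmem u hu U U' (h u hu)
    by_cases hU : u ∈ U
    · rw [children, children, if_pos hU, if_pos (hiff.1 hU), List.map_cons, List.map_cons,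
        hf u hu _ _ (hP u hu u _ _ (h u hu)),
        ih' fun v hv => hP v (List.mem_cons_of_mem _ hv) u _ _ (h v (List.mem_cons_of_mem _ hv))]
    · rw [children, children, if_neg hU, if_neg (fun h' => hU (hiff.2 h')),
        ih' fun v hv => h v (List.mem_cons_of_mem _ hv)]

theorem truncRatio_congr (hnb : ∀ v w, w ∈ nb v ↔ G.Adj v w) (ℓ : ℕ) {U U' : Finset V} {v : V}
    (h : ∀ u, G.edist v u ≤ ℓ → (u ∈ U ↔ u ∈ U')) :
    truncRatio lam nb ℓ U (nb v) = truncRatio lam nb ℓ U' (nb v) := by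
  induction ℓ generalizing U U' v with
  | zero => rfl
  | succ ℓ ih =>
    rw [truncRatio, truncRatio]
    congr 1
    refine children_map_congr
      (P := fun u W W' => ∀ w, G.edist u w ≤ ℓ → (w ∈ W ↔ w ∈ W')) ?_ ?_ ?_ ?_
    · intro u _ w W W' hW z hz
      rw [Finset.mem_erase, Finset.mem_erase, hW z hz]
    · intro u _ W W' hW
      exact hW u (by simp)
    · intro u _ W W' hW
      simp only [ih hW]
    · intro u hu w hw
      refine h w ((SimpleGraph.edist_triangle (v := u)).trans ?_)
      have h1 : G.edist v u ≤ 1 := by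
        rw [SimpleGraph.edist_eq_one_iff_adj.2 ((hnb v u).1 hu)]
      push_cast
      rw [add_comm (ℓ : ℕ∞)]
      exact add_le_add h1 hw

/-! ### Counting nodes -/

theorem nodeCount_le_sum_levelCount (nb : V → List V) (ℓ : ℕ) (U : Finset V) (v : V) :
    nodeCount nb ℓ U (nb v) ≤ ∑ j ∈ Finset.range (ℓ + 1), levelCount nb j U v := by
  induction ℓ generalizing U v with
  | zero => simp [nodeCount, levelCount]
  | succ ℓ ih =>
    have h : ∀ C : List (Finset V × V), (C.map fun c => nodeCount nb ℓ c.1 (nb c.2)).sum ≤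
        ∑ j ∈ Finset.range (ℓ + 1), (C.map fun c => levelCount nb j c.1 c.2).sum := by
      intro C
      induction C with
      | nil => simp
      | cons c C ihC =>
        simp only [List.map_cons, List.sum_cons, Finset.sum_add_distrib]
        exact add_le_add (ih c.1 c.2) ihC
    rw [Finset.sum_range_succ', nodeCount, add_comm 1]
    exact add_le_add (h _) le_rfl

theorem mem_children {U : Finset V} {L : List V} {c : Finset V × V} (hc : c ∈ children U L) :
    c.1 ⊆ U.erase c.2 ∧ c.2 ∈ U ∧ c.2 ∈ L := by
  induction L generalizing U with
  | nil => simp [children] at hc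
  | cons u L ih =>
    by_cases hu : u ∈ U
    · rw [children, if_pos hu, List.mem_cons] at hc
      rcases hc with rfl | hc
      · exact ⟨subset_rfl, hu, List.mem_cons_self⟩
      · obtain ⟨h1, h2, h3⟩ := ih hc
        exact ⟨h1.trans (Finset.erase_subset_erase _ (Finset.erase_subset _ _)),
          Finset.mem_of_mem_erase h2, List.mem_cons_of_mem _ h3⟩
    · rw [children, if_neg hu] at hc
      obtain ⟨h1, h2, h3⟩ := ih hc
      exact ⟨h1, h2, List.mem_cons_of_mem _ h3⟩

theorem pairwise_children (U : Finset V) (L : List V) :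
    (children U L).Pairwise fun c c' => c.2 ≠ c'.2 := by
  induction L generalizing U with
  | nil => simp [children]
  | cons u L ih =>
    by_cases hu : u ∈ U
    · rw [children, if_pos hu, List.pairwise_cons]
      refine ⟨fun c hc => ?_, ih _⟩
      have := (mem_children hc).2.1
      exact (Finset.ne_of_mem_erase this).symm
    · rw [children, if_neg hu]; exact ih U

/-- The root-to-node paths of the recursion tree at depth `ℓ`, as lists of vertices. -/
def levelPaths (nb : V → List V) : ℕ → Finset V → V → List (List V)
  | 0, _, _ => [[]]
  | ℓ + 1, U, v =>
    (children U (nb v)).flatMap fun c => (levelPaths nb ℓ c.1 c.2).map (c.2 :: ·)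

theorem length_levelPaths (nb : V → List V) (ℓ : ℕ) (U : Finset V) (v : V) :
    (levelPaths nb ℓ U v).length = levelCount nb ℓ U v := by
  induction ℓ generalizing U v with
  | zero => rfl
  | succ ℓ ih => simp [levelPaths, levelCount, List.length_flatMap, ih]

theorem nodup_levelPaths (nb : V → List V) (ℓ : ℕ) (U : Finset V) (v : V) :
    (levelPaths nb ℓ U v).Nodup := by
  induction ℓ generalizing U v with
  | zero => simp [levelPaths]
  | succ ℓ ih =>
    rw [levelPaths, List.nodup_flatMap]
    refine ⟨fun c _ => (ih c.1 c.2).map (List.cons_injective), ?_⟩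
    refine (pairwise_children U (nb v)).imp fun {c c'} hne => ?_
    rw [Function.onFun, List.disjoint_left]
    rintro l hl hl'
    obtain ⟨l₁, -, rfl⟩ := List.mem_map.1 hl
    obtain ⟨l₂, -, h⟩ := List.mem_map.1 hl'
    exact hne (List.cons.inj h).1.symm

/-- A visited vertex is deleted for the whole branch below it, so the walk never returns to it; the
hypothesis `v ∉ U` takes care of the root. -/
theorem exists_path_of_mem_levelPaths (hnb : ∀ v w, w ∈ nb v ↔ G.Adj v w) {ℓ : ℕ} {U : Finset V}
    {v : V} (hv : v ∉ U) {l : List V} (hl : l ∈ levelPaths nb ℓ U v) :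
    ∃ p : Σ w : V, G.Walk v w, (p.2.IsPath ∧ p.2.length = ℓ) ∧ p.2.support = v :: l ∧
      ∀ w ∈ l, w ∈ U := by
  induction ℓ generalizing U v l with
  | zero =>
    rw [levelPaths, List.mem_singleton] at hl
    subst hl
    exact ⟨⟨v, .nil⟩, by simp, by simp, by simp⟩
  | succ ℓ ih =>
    rw [levelPaths, List.mem_flatMap] at hl
    obtain ⟨c, hc, hl⟩ := hl
    obtain ⟨l', hl', rfl⟩ := List.mem_map.1 hl
    obtain ⟨h1, h2, h3⟩ := mem_children hc
    obtain ⟨p, ⟨hp, hlen⟩, hsupp, hU⟩ := ih (fun h => (Finset.notMem_erase _ _) (h1 h)) hl'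
    have hU' : ∀ w ∈ c.2 :: l', w ∈ U := by
      intro w hw
      rcases List.mem_cons.1 hw with rfl | hw
      · exact h2
      · exact Finset.mem_of_mem_erase (h1 (hU w hw))
    refine ⟨⟨p.1, .cons ((hnb v c.2).1 h3) p.2⟩, ⟨?_, by simp [hlen]⟩, by simp [hsupp], hU'⟩
    rw [SimpleGraph.Walk.cons_isPath_iff]
    exact ⟨hp, fun h => hv (hU' v (hsupp ▸ h))⟩

/-- Needed because `Set.ncard` is 0 on infinite sets: without finiteness, bounds by `sawCount` would
say nothing. -/
theorem finite_walks (hnb : ∀ v w, w ∈ nb v ↔ G.Adj v w) (v : V) (ℓ : ℕ) :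
    {p : Σ w : V, G.Walk v w | p.2.length = ℓ}.Finite := by
  induction ℓ generalizing v with
  | zero =>
    refine (Set.finite_singleton (⟨v, .nil⟩ : Σ w : V, G.Walk v w)).subset ?_
    rintro ⟨w, p⟩ hp
    cases p with
    | nil => rfl
    | cons h p => simp at hp
  | succ ℓ ih =>
    have hfin : (⋃ u ∈ {u | u ∈ nb v}, {p : Σ w : V, G.Walk v w | ∃ (h : G.Adj v u),
        ∃ r ∈ {r : Σ w : V, G.Walk u w | r.2.length = ℓ}, p = ⟨r.1, .cons h r.2⟩}).Finite := by
      refine ((nb v).toFinset.finite_toSet.subset (by intro u; simp)).biUnion fun u hu => ?_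
      have h := (hnb v u).1 hu
      refine ((ih u).image fun r => (⟨r.1, .cons h r.2⟩ : Σ w : V, G.Walk v w)).subset ?_
      rintro p ⟨_, r, hr, rfl⟩
      exact ⟨r, hr, rfl⟩
    refine hfin.subset ?_
    rintro ⟨w, p⟩ hp
    cases p with
    | nil => simp at hp
    | cons h p =>
      simp only [Set.mem_iUnion]
      exact ⟨_, (hnb _ _).2 h, h, ⟨w, p⟩, by simpa using hp, rfl⟩

/-- The lists in `levelPaths` have no repetition, and each is the support, without its first vertex,
of some self-avoiding walk. -/
theorem levelCount_le_sawCount (hnb : ∀ v w, w ∈ nb v ↔ G.Adj v w) (ℓ : ℕ) {U : Finset V}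
    {v : V} (hv : v ∉ U) : levelCount nb ℓ U v ≤ sawCount G v ℓ := by
  have hfin : {p : Σ w : V, G.Walk v w | p.2.IsPath ∧ p.2.length = ℓ}.Finite :=
    (finite_walks hnb v ℓ).subset fun p hp => hp.2
  rw [← length_levelPaths, ← List.toFinset_card_of_nodup (nodup_levelPaths nb ℓ U v),
    ← Set.ncard_coe_finset]
  refine le_trans (Set.ncard_le_ncard ?_ (hfin.image fun p => p.2.support.tail))
    (Set.ncard_image_le hfin)
  intro l hl
  obtain ⟨p, hp, hsupp, -⟩ := exists_path_of_mem_levelPaths hnb hv (by simpa using hl)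
  exact ⟨p, hp, by simp [hsupp]⟩

end Recursion

/-! ## Strong spatial mixing -/

/-- By continuity of λ_c at Δ, the strict inequality survives at some D > Δ, and x = 1/(D-1). The
midpoint Δ' of Δ and D leaves room on both sides: Δ' > Δ bounds the walks, and Δ'/D < 1 is the
decay. -/
theorem exists_supercritical_parameters {Δ lam : ℝ} (hΔ : 1 < Δ)
    (hlam : lam < criticalActivity Δ) : ∃ x q Δ' : ℝ, 0 < x ∧
      (2 * halfExponent x).HolderConjugate q ∧ Δ < Δ' ∧ Δ' < 1 + x⁻¹ ∧
      lam < criticalActivity (1 + x⁻¹) := by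
  have hcont : ContinuousAt criticalActivity Δ := by
    unfold criticalActivity
    refine ContinuousAt.div ?_ ?_ (Real.rpow_pos_of_pos (by linarith) _).ne'
    · exact continuousAt_id.rpow continuousAt_id (Or.inl (by simp; linarith))
    · exact (continuousAt_id.sub continuousAt_const).rpow (continuousAt_id.add continuousAt_const)
        (Or.inl (by simp; linarith))
  have hev : ∀ᶠ D in 𝓝[>] Δ, lam < criticalActivity D ∧ Δ < D :=
    ((hcont.eventually (lt_mem_nhds hlam)).filter_mono nhdsWithin_le_nhds).and
      self_mem_nhdsWithin
  obtain ⟨D, hD, hΔD⟩ := hev.exists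
  have hx : 0 < (D - 1)⁻¹ := inv_pos.2 (by linarith)
  have hxD : 1 + ((D - 1)⁻¹)⁻¹ = D := by rw [inv_inv]; ring
  have ha := one_lt_halfExponent hx
  refine ⟨(D - 1)⁻¹, _, (Δ + D) / 2, hx, Real.HolderConjugate.conjExponent (by linarith),
    by linarith, by rw [hxD]; linarith, by rwa [hxD]⟩

theorem exists_sawCount_le {V : Type*} {G : SimpleGraph V} {Δ Δ' : ℝ} (hΔ : 0 ≤ Δ)
    (hΔ' : Δ < Δ') (hG : connectiveConstant G ≤ ENNReal.ofReal Δ) (v : V) :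
    ∃ C : ℝ, 0 ≤ C ∧ ∀ ℓ, (sawCount G v ℓ : ℝ) ≤ C * Δ' ^ ℓ := by
  have hpos : 0 < Δ' := hΔ.trans_lt hΔ'
  have h1 : limsup (fun ℓ : ℕ => (sawCount G v ℓ : ℝ≥0∞) ^ ((ℓ : ℝ)⁻¹)) atTop <
      ENNReal.ofReal Δ' :=
    ((le_iSup (fun v => limsup (fun ℓ : ℕ => (sawCount G v ℓ : ℝ≥0∞) ^ ((ℓ : ℝ)⁻¹)) atTop)
      v).trans hG).trans_lt ((ENNReal.ofReal_lt_ofReal_iff hpos).2 hΔ')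
  obtain ⟨N, hN⟩ := eventually_atTop.1 (eventually_lt_of_limsup_lt h1)
  -- Length 0 is excluded because the exponent ℓ⁻¹ is then 0 by convention. The finitely many
  -- lengths below the threshold are absorbed into the sum S.
  have h2 : ∀ ℓ, max N 1 ≤ ℓ → (sawCount G v ℓ : ℝ) ≤ Δ' ^ ℓ := by
    intro ℓ hℓ
    have hℓ0 : (ℓ : ℝ) ≠ 0 := by
      have := (le_max_right N 1).trans hℓ
      positivity
    have h := ENNReal.rpow_le_rpow (hN ℓ ((le_max_left _ _).trans hℓ)).le (Nat.cast_nonneg ℓ)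
    rw [← ENNReal.rpow_mul, inv_mul_cancel₀ hℓ0, ENNReal.rpow_one, ENNReal.rpow_natCast,
      ← ENNReal.ofReal_pow hpos.le, ← ENNReal.ofReal_natCast,
      ENNReal.ofReal_le_ofReal_iff (by positivity)] at h
    exact h
  set S := ∑ j ∈ Finset.range (max N 1), (sawCount G v j : ℝ) / Δ' ^ j with hS
  have hS0 : 0 ≤ S := Finset.sum_nonneg fun j _ => by positivity
  refine ⟨1 + S, by linarith, fun ℓ => ?_⟩
  rcases le_or_gt (max N 1) ℓ with h | h
  · exact (h2 ℓ h).trans (le_mul_of_one_le_left (by positivity) (by linarith))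
  · have h3 : (sawCount G v ℓ : ℝ) / Δ' ^ ℓ ≤ S :=
      Finset.single_le_sum (f := fun j => (sawCount G v j : ℝ) / Δ' ^ j)
        (fun j _ => by positivity) (Finset.mem_range.2 h)
    rw [← div_le_iff₀ (by positivity)]
    linarith

/-! ### Dependence of the root ratio on distant vertices. -/

section RootRatio

variable {V : Type*} [DecidableEq V] {G : SimpleGraph V} {lam : ℝ} {nb : V → List V}

/-- The occupation ratio of `v` in the subgraph induced on `U`, and `0` if `v ∉ U`. -/
noncomputable def rootRatio (G : SimpleGraph V) (lam : ℝ) (nb : V → List V) (U : Finset V)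
    (v : V) : ℝ :=
  if v ∈ U then lam * deletionRatio G lam (U.erase v) (nb v) else 0

theorem rootRatio_nonneg (hlam : 0 < lam) (U : Finset V) (v : V) :
    0 ≤ rootRatio G lam nb U v := by
  rw [rootRatio]
  split_ifs
  · exact mul_nonneg hlam.le (deletionRatio_nonneg hlam _ _)
  · rfl

theorem rootRatio_le (hlam : 0 < lam) (U : Finset V) (v : V) :
    rootRatio G lam nb U v ≤ lam := by
  rw [rootRatio]
  split_ifs
  · exact mul_le_of_le_one_right hlam.le (deletionRatio_le_one hlam _ _)
  · exact hlam.le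

theorem truncRatio_error_of_sawCount_le {x q : ℝ} (hx : 0 < x) (hlam : 0 < lam)
    (hcrit : lam ≤ criticalActivity (1 + x⁻¹)) (hq : (2 * halfExponent x).HolderConjugate q)
    (hnb : ∀ v w, w ∈ nb v ↔ G.Adj v w) {C Δ' : ℝ} (hC : 0 ≤ C) (hΔ' : 0 ≤ Δ') {k : ℕ} {v : V}
    (hsaw : (sawCount G v k : ℝ) ≤ C * Δ' ^ k) {U : Finset V} (hv : v ∉ U) :
    |lam * deletionRatio G lam U (nb v) - lam * truncRatio lam nb k U (nb v)| ≤
      2 * (1 + lam) * message lam * C ^ (1 / q) * ((Δ' * (1 + x⁻¹)⁻¹) ^ (1 / q)) ^ k := by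
  have hq0 := hq.symm.pos
  have hD : 0 ≤ (1 + x⁻¹)⁻¹ := by positivity
  refine (truncRatio_error hx hlam hcrit hq hnb k U v).trans ?_
  have h : (1 + x⁻¹)⁻¹ ^ k * (levelCount nb k U v : ℝ) ≤ C * (Δ' * (1 + x⁻¹)⁻¹) ^ k := by
    have h1 : (levelCount nb k U v : ℝ) ≤ C * Δ' ^ k :=
      le_trans (by exact_mod_cast levelCount_le_sawCount hnb k hv) hsaw
    calc (1 + x⁻¹)⁻¹ ^ k * (levelCount nb k U v : ℝ) ≤ (1 + x⁻¹)⁻¹ ^ k * (C * Δ' ^ k) := by gcongr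
      _ = _ := by rw [mul_pow]; ring
  have h2 := Real.rpow_le_rpow (by positivity) h (one_div_nonneg.2 hq0.le)
  rw [Real.mul_rpow hC (by positivity), ← Real.rpow_natCast (Δ' * (1 + x⁻¹)⁻¹) k,
    ← Real.rpow_mul (by positivity), mul_comm (k : ℝ), Real.rpow_mul (by positivity),
    Real.rpow_natCast] at h2
  have hm := message_nonneg lam
  rw [mul_assoc (2 * (1 + lam) * message lam)]
  gcongr

/-- Both ratios are compared with the same truncated value, since U and U' agree on the ball that it
consults; hence the factor 2. -/
theorem rootRatio_sub_le {x q : ℝ} (hx : 0 < x) (hlam : 0 < lam)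
    (hcrit : lam ≤ criticalActivity (1 + x⁻¹)) (hq : (2 * halfExponent x).HolderConjugate q)
    (hnb : ∀ v w, w ∈ nb v ↔ G.Adj v w) {C Δ' : ℝ} (hC : 0 ≤ C) (hΔ' : 0 ≤ Δ') {k : ℕ} {v : V}
    (hsaw : (sawCount G v k : ℝ) ≤ C * Δ' ^ k) {U U' : Finset V}
    (hU : ∀ u, G.edist v u ≤ k → (u ∈ U ↔ u ∈ U')) :
    |rootRatio G lam nb U v - rootRatio G lam nb U' v| ≤
      2 * (2 * (1 + lam) * message lam * C ^ (1 / q)) *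
        ((Δ' * (1 + x⁻¹)⁻¹) ^ (1 / q)) ^ k := by
  have hm := message_nonneg lam
  have hv := hU v (by simp)
  by_cases h : v ∈ U
  · rw [rootRatio, rootRatio, if_pos h, if_pos (hv.1 h)]
    have h1 := truncRatio_error_of_sawCount_le hx hlam hcrit hq hnb hC hΔ' hsaw
      (Finset.notMem_erase v U)
    have h2 := truncRatio_error_of_sawCount_le hx hlam hcrit hq hnb hC hΔ' hsaw
      (Finset.notMem_erase v U')
    rw [truncRatio_congr hnb k (U' := U'.erase v) (fun u hu => by
      rw [Finset.mem_erase, Finset.mem_erase, hU u hu])] at h1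
    rw [abs_le] at h1 h2 ⊢
    constructor <;> linarith [h1.1, h1.2, h2.1, h2.2]
  · rw [rootRatio, rootRatio, if_neg h, if_neg fun h' => h (hv.2 h'), sub_self, abs_zero]
    positivity

end RootRatio

/-! ### Boundary conditions as deletion of vertices. -/

namespace BoundaryCondition

variable {V : Type*} {G : SimpleGraph V}

open Classical in
/-- The vertices of `W` that are not fixed by `σ` and have no occupied fixed neighbour in `W`. -/
noncomputable def freeVertices (σ : BoundaryCondition G) (W : Finset V) : Finset V :=
  {u ∈ W | u ∉ σ.dom ∧ ∀ w ∈ W, w ∈ σ.occ → ¬ G.Adj u w}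

open Classical in
/-- The occupied fixed vertices of `W`. -/
noncomputable def occVertices (σ : BoundaryCondition G) (W : Finset V) : Finset V :=
  {u ∈ W | u ∈ σ.occ}

theorem mem_freeVertices {σ : BoundaryCondition G} {W : Finset V} {u : V} :
    u ∈ σ.freeVertices W ↔ u ∈ W ∧ u ∉ σ.dom ∧ ∀ w ∈ W, w ∈ σ.occ → ¬ G.Adj u w := by
  simp [freeVertices]

theorem mem_occVertices {σ : BoundaryCondition G} {W : Finset V} {u : V} :
    u ∈ σ.occVertices W ↔ u ∈ W ∧ u ∈ σ.occ := by
  simp [occVertices]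

theorem mem_configs {σ : BoundaryCondition G} {W I : Finset V} :
    I ∈ σ.configs W ↔ I ⊆ W ∧ G.IsIndepSet (I : Set V) ∧
      ∀ u ∈ W, u ∈ σ.dom → (u ∈ I ↔ u ∈ σ.occ) := by
  simp [configs]

theorem disjoint_freeVertices (σ : BoundaryCondition G) (W : Finset V) {u : V}
    (hu : u ∈ σ.freeVertices W) : u ∉ σ.occVertices W := fun h =>
  (mem_freeVertices.1 hu).2.1 (σ.occ_subset (mem_occVertices.1 h).2)

theorem union_mem_configs [DecidableEq V] {σ : BoundaryCondition G} {W J : Finset V}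
    (hJ : J ⊆ σ.freeVertices W) (hind : G.IsIndepSet (J : Set V)) :
    J ∪ σ.occVertices W ∈ σ.configs W := by
  refine mem_configs.2 ⟨?_, ?_, ?_⟩
  · intro u hu
    rcases Finset.mem_union.1 hu with hu | hu
    · exact (mem_freeVertices.1 (hJ hu)).1
    · exact (mem_occVertices.1 hu).1
  · intro u hu w hw hne
    rw [Finset.mem_coe, Finset.mem_union] at hu hw
    rcases hu with hu | hu <;> rcases hw with hw | hw
    · exact hind hu hw hne
    · exact (mem_freeVertices.1 (hJ hu)).2.2 w (mem_occVertices.1 hw).1 (mem_occVertices.1 hw).2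
    · exact fun h => (mem_freeVertices.1 (hJ hw)).2.2 u (mem_occVertices.1 hu).1
        (mem_occVertices.1 hu).2 h.symm
    · exact σ.indep (mem_occVertices.1 hu).2 (mem_occVertices.1 hw).2 hne
  · intro u huW hud
    rw [Finset.mem_union]
    constructor
    · rintro (hu | hu)
      · exact absurd hud (mem_freeVertices.1 (hJ hu)).2.1
      · exact (mem_occVertices.1 hu).2
    · exact fun hu => Or.inr (mem_occVertices.2 ⟨huW, hu⟩)

theorem sdiff_subset_freeVertices [DecidableEq V] {σ : BoundaryCondition G} {W I : Finset V}
    (hI : I ∈ σ.configs W) : I \ σ.occVertices W ⊆ σ.freeVertices W := by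
  obtain ⟨hIW, hind, hagree⟩ := mem_configs.1 hI
  intro u hu
  obtain ⟨huI, huO⟩ := Finset.mem_sdiff.1 hu
  refine mem_freeVertices.2 ⟨hIW huI, fun hd => huO (mem_occVertices.2
    ⟨hIW huI, (hagree u (hIW huI) hd).1 huI⟩), fun w hw hwo hadj => ?_⟩
  exact hind huI ((hagree w hw (σ.occ_subset hwo)).2 hwo) hadj.ne hadj

theorem occVertices_subset_of_mem_configs {σ : BoundaryCondition G} {W I : Finset V}
    (hI : I ∈ σ.configs W) : σ.occVertices W ⊆ I := fun u hu =>
  ((mem_configs.1 hI).2.2 u (mem_occVertices.1 hu).1 (σ.occ_subset (mem_occVertices.1 hu).2)).2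
    (mem_occVertices.1 hu).2

/-- An admissible set is the occupied fixed vertices together with an arbitrary independent set of
free vertices. The test function P covers the numerator and the denominator of the occupation
probability at once. -/
theorem sum_configs [DecidableEq V] (σ : BoundaryCondition G) (lam : ℝ) (W : Finset V)
    (P : Finset V → ℝ) :
    ∑ I ∈ σ.configs W, P I * lam ^ I.card = lam ^ (σ.occVertices W).card *
      ∑ J ∈ (σ.freeVertices W).powerset, P (J ∪ σ.occVertices W) * indepWeight G lam J := by
  classical
  have h : ∑ J ∈ (σ.freeVertices W).powerset, P (J ∪ σ.occVertices W) * indepWeight G lam J =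
      ∑ J ∈ (σ.freeVertices W).powerset.filter fun J : Finset V => G.IsIndepSet (J : Set V),
        P (J ∪ σ.occVertices W) * lam ^ J.card := by
    rw [Finset.sum_filter]
    refine Finset.sum_congr rfl fun J _ => ?_
    rw [indepWeight]
    split_ifs <;> simp
  rw [h, Finset.mul_sum]
  refine Finset.sum_nbij' (fun I => I \ σ.occVertices W) (fun J => J ∪ σ.occVertices W)
    ?_ ?_ ?_ ?_ ?_
  · intro I hI
    refine Finset.mem_filter.2 ⟨Finset.mem_powerset.2 (sdiff_subset_freeVertices hI), ?_⟩
    exact Set.Pairwise.mono (by simp) (mem_configs.1 hI).2.1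
  · intro J hJ
    obtain ⟨h1, h2⟩ := Finset.mem_filter.1 hJ
    exact union_mem_configs (Finset.mem_powerset.1 h1) h2
  · intro I hI
    exact Finset.sdiff_union_of_subset (occVertices_subset_of_mem_configs hI)
  · intro J hJ
    refine Finset.union_sdiff_cancel_right (Finset.disjoint_left.2 fun u hu => ?_)
    exact disjoint_freeVertices σ W (Finset.mem_powerset.1 (Finset.mem_filter.1 hJ).1 hu)
  · intro I hI
    have hsub := occVertices_subset_of_mem_configs hI
    simp only [Finset.sdiff_union_of_subset hsub]
    rw [← Finset.card_sdiff_add_card_eq_card hsub, pow_add]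
    ring

theorem sum_filter_mem_indepWeight [DecidableEq V] {lam : ℝ} (U : Finset V) (v : V) :
    ∑ J ∈ U.powerset, (if v ∈ J then 1 else 0) * indepWeight G lam J =
      partitionOn G lam U - partitionOn G lam (U.erase v) := by
  have hsub : (U.erase v).powerset ⊆ U.powerset := Finset.powerset_mono.2 (Finset.erase_subset _ _)
  rw [partitionOn, partitionOn, ← Finset.sum_sdiff hsub, ← Finset.sum_sdiff hsub (f := indepWeight G lam),
    add_sub_cancel_right]
  rw [Finset.sum_eq_zero (s := (U.erase v).powerset), add_zero]
  · refine Finset.sum_congr rfl fun J hJ => ?_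
    rw [if_pos, one_mul]
    by_contra h
    rw [Finset.mem_sdiff, Finset.mem_powerset, Finset.mem_powerset] at hJ
    exact hJ.2 (Finset.subset_erase.2 ⟨hJ.1, h⟩)
  · intro J hJ
    rw [if_neg (fun h => Finset.notMem_erase v U (Finset.mem_powerset.1 hJ h)), zero_mul]

/-- The factor from the fixed occupied vertices cancels, leaving the hard core model on the free
vertices F. For free v the ratio is (Z(F) - Z(F-v))/Z(F-v). -/
theorem occRatio_eq_rootRatio [DecidableEq V] (σ : BoundaryCondition G) {lam : ℝ} (hlam : 0 < lam)
    {nb : V → List V} (hnb : ∀ v w, w ∈ nb v ↔ G.Adj v w) (W : Finset V) (v : V) :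
    σ.occRatio lam W v = rootRatio G lam nb (σ.freeVertices W) v := by
  classical
  have hO : lam ^ (σ.occVertices W).card ≠ 0 := (pow_pos hlam _).ne'
  have hZ := (partitionOn_pos (G := G) hlam (σ.freeVertices W)).ne'
  have hden : ∑ I ∈ σ.configs W, lam ^ I.card =
      lam ^ (σ.occVertices W).card * partitionOn G lam (σ.freeVertices W) := by
    have h := σ.sum_configs lam W fun _ => 1
    simp only [one_mul] at h
    exact h
  have hnum : (∑ I ∈ σ.configs W with v ∈ I, lam ^ I.card) = lam ^ (σ.occVertices W).card *
      ∑ J ∈ (σ.freeVertices W).powerset,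
        (if v ∈ J ∪ σ.occVertices W then 1 else 0) * indepWeight G lam J := by
    rw [← σ.sum_configs lam W fun I => if v ∈ I then 1 else 0, Finset.sum_filter]
    exact Finset.sum_congr rfl fun I _ => by split_ifs <;> simp
  have hp : σ.occProb lam W v = (∑ J ∈ (σ.freeVertices W).powerset,
      (if v ∈ J ∪ σ.occVertices W then 1 else 0) * indepWeight G lam J) /
        partitionOn G lam (σ.freeVertices W) := by
    rw [occProb, hden,
      ← mul_div_mul_left _ (partitionOn G lam (σ.freeVertices W)) hO, ← hnum]
    congr!
  rw [occRatio, hp, rootRatio]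
  by_cases hv : v ∈ σ.freeVertices W
  · have hvO := disjoint_freeVertices σ W hv
    have hsimp : ∀ J : Finset V, v ∈ J ∪ σ.occVertices W ↔ v ∈ J := fun J => by simp [hvO]
    simp only [hsimp]
    rw [sum_filter_mem_indepWeight, if_pos hv]
    have hZ' := (partitionOn_pos (G := G) hlam ((σ.freeVertices W).erase v)).ne'
    have hrec := partitionOn_eq_erase_mul hlam hnb hv
    have h1 : 1 - (partitionOn G lam (σ.freeVertices W) -
        partitionOn G lam ((σ.freeVertices W).erase v)) / partitionOn G lam (σ.freeVertices W) =
        partitionOn G lam ((σ.freeVertices W).erase v) / partitionOn G lam (σ.freeVertices W) := by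
      field_simp; ring
    rw [h1, div_div_div_cancel_right₀ hZ, hrec]
    field_simp
    ring
  · rw [if_neg hv]
    -- For v fixed as occupied the probability is 1 and division by zero gives 0; otherwise the
    -- numerator vanishes. Both match the value 0 of `rootRatio`.
    by_cases hvO : v ∈ σ.occVertices W
    · have hsimp : ∀ J : Finset V, v ∈ J ∪ σ.occVertices W ↔ True := fun J => by simp [hvO]
      simp only [hsimp, if_true, one_mul]
      rw [← partitionOn, div_self hZ, sub_self, div_zero]
    · rw [Finset.sum_eq_zero]
      · simp
      · intro J hJ
        rw [if_neg, zero_mul]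
        rw [Finset.mem_union, not_or]
        exact ⟨fun h => hv (Finset.mem_powerset.1 hJ h), hvO⟩

/-- Whether u is free depends on the condition at u and at its neighbours, so one step of distance
is lost; `k + 2` makes the conditions agree up to distance k + 1. -/
theorem freeVertices_congr_boundary {σ τ : BoundaryCondition G} {v : V} {k : ℕ}
    (h : σ.DifferOnlyBeyond τ v (k + 2)) (W : Finset V) {u : V} (hu : G.edist v u ≤ k) :
    u ∈ σ.freeVertices W ↔ u ∈ τ.freeVertices W := by
  have hagree : ∀ w, G.edist v w ≤ (k + 1 : ℕ) →
      (w ∈ σ.dom ↔ w ∈ τ.dom) ∧ (w ∈ σ.occ ↔ w ∈ τ.occ) := by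
    intro w hw
    by_contra hd
    have h2 := (h w hd).trans hw
    rw [Nat.cast_le] at h2
    omega
  have hnear : ∀ w, G.Adj u w → G.edist v w ≤ (k + 1 : ℕ) := by
    intro w hadj
    refine (SimpleGraph.edist_triangle (v := u)).trans ?_
    push_cast
    exact add_le_add hu (SimpleGraph.edist_eq_one_iff_adj.2 hadj).le
  have hu' := (hagree u (hu.trans (by exact_mod_cast Nat.le_succ k))).1
  rw [mem_freeVertices, mem_freeVertices, hu']
  refine and_congr_right fun _ => and_congr_right fun _ => forall₂_congr fun w _ => ?_
  by_cases hadj : G.Adj u w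
  · rw [(hagree w (hnear w hadj)).2]
  · simp [hadj]

theorem freeVertices_congr_window (σ : BoundaryCondition G) {v : V} {k : ℕ} {W W' : Finset V}
    (hW : ∀ w, G.edist v w ≤ (k + 1 : ℕ) → (w ∈ W ↔ w ∈ W')) {u : V} (hu : G.edist v u ≤ k) :
    u ∈ σ.freeVertices W ↔ u ∈ σ.freeVertices W' := by
  have hnear : ∀ w, G.Adj u w → G.edist v w ≤ (k + 1 : ℕ) := by
    intro w hadj
    refine (SimpleGraph.edist_triangle (v := u)).trans ?_
    push_cast
    exact add_le_add hu (SimpleGraph.edist_eq_one_iff_adj.2 hadj).le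
  rw [mem_freeVertices, mem_freeVertices, hW u (hu.trans (by exact_mod_cast Nat.le_succ k))]
  refine and_congr_right fun _ => and_congr_right fun _ => forall_congr' fun w => ?_
  by_cases hadj : G.Adj u w
  · rw [hW w (hnear w hadj)]
  · simp [hadj]

end BoundaryCondition

theorem finite_ball {V : Type*} {G : SimpleGraph V} (hfin : ∀ v, (G.neighborSet v).Finite) (v : V)
    (k : ℕ) : {w | G.edist v w ≤ k}.Finite := by
  have hnb : ∀ v w, w ∈ (hfin v).toFinset.toList ↔ G.Adj v w := by simp
  have h : (⋃ j ∈ Finset.range (k + 1), (fun p : Σ w : V, G.Walk v w => p.1) ''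
      {p | p.2.length = j}).Finite :=
    (Finset.range (k + 1)).finite_toSet.biUnion fun j _ => by
      classical exact (finite_walks hnb v j).image _
  refine h.subset fun w hw => ?_
  have hne : G.edist v w ≠ ⊤ := ne_top_of_le_ne_top (ENat.natCast_ne_top k) hw
  obtain ⟨p, hp⟩ := SimpleGraph.exists_walk_of_edist_ne_top hne
  simp only [Set.mem_iUnion]
  refine ⟨p.length, Finset.mem_range.2 ?_, ⟨w, p⟩, rfl, rfl⟩
  rw [Set.mem_ofPred_eq, ← hp, Nat.cast_le] at hw
  omega

/-- Adds the walk of length 0, which the family's bound omits, and makes the constant nonnegative.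
-/
theorem sawCount_le_of_sum_le {V : Type*} {G : SimpleGraph V} {v : V} {k : ℕ} {c Δ : ℝ}
    (hfin : ∀ v, (G.neighborSet v).Finite)
    (hΔ : 0 ≤ Δ) (h : (∑ j ∈ Finset.Icc 1 k, (sawCount G v j : ℝ)) ≤ c * Δ ^ k) :
    (∑ j ∈ Finset.range (k + 1), (sawCount G v j : ℝ)) ≤ 1 + max c 0 * Δ ^ k := by
  classical
  have h0 : (sawCount G v 0 : ℝ) ≤ 1 := by
    have : sawCount G v 0 ≤ 1 := by
      rw [sawCount, Set.ncard_le_one_iff (by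
        refine (finite_walks (G := G) (nb := fun v => (hfin v).toFinset.toList) (by simp) v 0).subset
          fun p hp => hp.2)]
      rintro ⟨w, p⟩ ⟨w', p'⟩ ⟨-, hp⟩ ⟨-, hp'⟩
      cases p with
      | nil => cases p' with
        | nil => rfl
        | cons h p => simp at hp'
      | cons h p => simp at hp
    exact_mod_cast this
  rw [Finset.sum_range_succ']
  have h1 : ∑ j ∈ Finset.range k, (sawCount G v (j + 1) : ℝ) =
      ∑ j ∈ Finset.Icc 1 k, (sawCount G v j : ℝ) := by
    rw [Finset.range_eq_Ico, Finset.sum_Ico_add' (fun j => (sawCount G v j : ℝ)) 0 k 1]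
    rfl
  rw [h1, add_comm]
  have : c * Δ ^ k ≤ max c 0 * Δ ^ k := by gcongr; exact le_max_left _ _
  linarith

theorem strongSpatialMixing {ι : Type*} {V : ι → Type*} (G : ∀ i, SimpleGraph (V i))
    (hfin : ∀ (i : ι) (v : V i), ((G i).neighborSet v).Finite)
    (Δ lam : ℝ) (hΔ : 1 < Δ) (hG : ConnectiveConstantAtMost G Δ)
    (hlam : 0 < lam) (hcrit : lam < criticalActivity Δ) : StrongSpatialMixing G lam := by
  classical
  obtain ⟨x, q, Δ', hx, hq, hΔΔ', hΔ'x, hcrit'⟩ := exists_supercritical_parameters hΔ hcrit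
  have hq0 := hq.symm.pos
  have hΔ'0 : 0 < Δ' := by linarith
  have hD : 0 < 1 + x⁻¹ := by positivity
  set c := (Δ' * (1 + x⁻¹)⁻¹) ^ (1 / q) with hc
  have hc0 : 0 < c := by positivity
  have hc1 : c < 1 := by
    refine Real.rpow_lt_one (by positivity) ?_ (one_div_pos.2 hq0)
    rwa [← div_eq_mul_inv, div_lt_one hD]
  set nb : ∀ i, V i → List (V i) := fun i v => (hfin i v).toFinset.toList
  have hnb : ∀ i v w, w ∈ nb i v ↔ (G i).Adj v w := fun i v w => by simp [nb]
  set K := 2 * (2 * (1 + lam) * message lam) with hK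
  have hK0 : 0 ≤ K := by have := message_nonneg lam; positivity
  have hroot : ∀ (i) (C : ℝ), 0 ≤ C → ∀ (k : ℕ) (v : V i), (sawCount (G i) v k : ℝ) ≤ C * Δ' ^ k →
      ∀ U U' : Finset (V i), (∀ u, (G i).edist v u ≤ k → (u ∈ U ↔ u ∈ U')) →
      |rootRatio (G i) lam (nb i) U v - rootRatio (G i) lam (nb i) U' v| ≤
        K * C ^ (1 / q) * c ^ k := by
    intro i C hC k v hsaw U U' hU
    have h := rootRatio_sub_le hx hlam hcrit'.le hq (hnb i) hC hΔ'0.le hsaw hU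
    rwa [← mul_assoc 2] at h
  -- One estimate for every finite window W serves both the finite and the infinite graphs. Dividing
  -- by c ^ 2 pays for the loss of two steps of distance, and the summand lam covers ℓ = 1, where
  -- both ratios lie in [0, lam].
  have hdiff : ∀ (i) (C : ℝ), 0 ≤ C → ∀ (ℓ : ℕ) (v : V i), 1 ≤ ℓ →
      (2 ≤ ℓ → (sawCount (G i) v (ℓ - 2) : ℝ) ≤ C * Δ' ^ (ℓ - 2)) →
      ∀ (W : Finset (V i)) (σ τ : BoundaryCondition (G i)), σ.DifferOnlyBeyond τ v ℓ →
      |σ.occRatio lam W v - τ.occRatio lam W v| ≤ (K * C ^ (1 / q) + lam) / c ^ 2 * c ^ ℓ := by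
    intro i C hC ℓ v hℓ hsaw W σ τ hστ
    rw [σ.occRatio_eq_rootRatio hlam (hnb i), τ.occRatio_eq_rootRatio hlam (hnb i)]
    have hKC : 0 ≤ K * C ^ (1 / q) := by positivity
    by_cases h2 : 2 ≤ ℓ
    · obtain ⟨k, rfl⟩ := Nat.exists_eq_add_of_le' h2
      rw [Nat.add_sub_cancel] at hsaw
      refine (hroot i C hC k v (hsaw h2) _ _ fun u hu =>
        BoundaryCondition.freeVertices_congr_boundary hστ W hu).trans ?_
      rw [pow_add, div_mul_eq_mul_div, le_div_iff₀ (by positivity), ← mul_assoc]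
      gcongr
      linarith
    · obtain rfl : ℓ = 1 := by omega
      have h1 : |rootRatio (G i) lam (nb i) (σ.freeVertices W) v -
          rootRatio (G i) lam (nb i) (τ.freeVertices W) v| ≤ lam := by
        have h1 := rootRatio_le (G := G i) (nb := nb i) hlam (σ.freeVertices W) v
        have h2 := rootRatio_le (G := G i) (nb := nb i) hlam (τ.freeVertices W) v
        have h3 := rootRatio_nonneg (G := G i) (nb := nb i) hlam (σ.freeVertices W) v
        have h4 := rootRatio_nonneg (G := G i) (nb := nb i) hlam (τ.freeVertices W) v
        rw [abs_le]; constructor <;> linarith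
      refine h1.trans ?_
      rw [div_mul_eq_mul_div, le_div_iff₀ (by positivity)]
      nlinarith [mul_nonneg hKC hc0.le, mul_pos hlam hc0]
  refine ⟨c, hc0.le, hc1, ?_, ?_⟩
  · obtain ⟨a, c₀, hac⟩ := hG.1
    -- The second summand makes ℓ - 2 still at least a log |V| when |V| ≥ 2; for |V| = 1 the
    -- logarithm is 0.
    refine ⟨|a| + 2 / Real.log 2, (K * (1 + max c₀ 0) ^ (1 / q) + lam) / c ^ 2, ?_⟩
    intro i _ v ℓ hℓ hlog σ τ hστ
    refine hdiff i (1 + max c₀ 0) (by positivity) ℓ v hℓ (fun h2 => ?_) _ σ τ hστ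
    have hlog2 : 0 < Real.log 2 := Real.log_pos one_lt_two
    have hfinV : Finite (V i) := inferInstance
    have hge : a * Real.log (Nat.card (V i)) ≤ ((ℓ - 2 : ℕ) : ℝ) := by
      rw [Nat.card_eq_fintype_card]
      rcases Nat.lt_or_ge 1 (Fintype.card (V i)) with hcard | hcard
      · have h3 : Real.log 2 ≤ Real.log (Fintype.card (V i)) :=
          Real.log_le_log two_pos (by exact_mod_cast hcard)
        have h4 : 2 ≤ 2 / Real.log 2 * Real.log (Fintype.card (V i)) := by
          rw [div_mul_eq_mul_div, le_div_iff₀ hlog2]; linarith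
        have h5 : a * Real.log (Fintype.card (V i)) ≤ |a| * Real.log (Fintype.card (V i)) :=
          mul_le_mul_of_nonneg_right (le_abs_self a) (by linarith)
        push_cast [h2]
        linarith
      · have : Fintype.card (V i) = 1 := le_antisymm hcard (Fintype.card_pos_iff.2 ⟨v⟩)
        rw [this]
        simp
    have h6 := sawCount_le_of_sum_le (hfin i) (by linarith) (hac i hfinV v (ℓ - 2) hge)
    have h7 := Finset.single_le_sum (f := fun j => (sawCount (G i) v j : ℝ))
      (fun j _ => Nat.cast_nonneg _) (Finset.mem_range.2 (Nat.lt_succ_self (ℓ - 2)))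
    refine (h7.trans h6).trans ?_
    rw [add_mul, one_mul]
    have h8 : (1 : ℝ) ≤ Δ' ^ (ℓ - 2) := one_le_pow₀ (by linarith)
    have h9 : Δ ^ (ℓ - 2) ≤ Δ' ^ (ℓ - 2) := by gcongr
    have h10 : max c₀ 0 * Δ ^ (ℓ - 2) ≤ max c₀ 0 * Δ' ^ (ℓ - 2) := by gcongr
    linarith
  · intro i hi v
    obtain ⟨C, hC, hsaw⟩ := exists_sawCount_le (by linarith) hΔΔ' (hG.2 i hi) v
    -- Cauchy criterion: any window containing the ball of radius k + 1 has the same free vertices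
    -- up to distance k, so its ratio is within the decaying bound.
    have hlim : ∀ σ : BoundaryCondition (G i), ∃ r, σ.IsOccRatio lam v r := by
      intro σ
      refine cauchySeq_tendsto_of_complete (Metric.cauchySeq_iff'.2 fun ε hε => ?_)
      have ht : Tendsto (fun k : ℕ => K * C ^ (1 / q) * c ^ k) atTop (𝓝 0) := by
        have := (tendsto_pow_atTop_nhds_zero_of_lt_one hc0.le hc1).const_mul (K * C ^ (1 / q))
        simpa using this
      obtain ⟨k, hk⟩ := (ht.eventually (gt_mem_nhds hε)).exists
      refine ⟨(finite_ball (hfin i) v (k + 1)).toFinset, fun W hW => ?_⟩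
      rw [Real.dist_eq, σ.occRatio_eq_rootRatio hlam (hnb i), σ.occRatio_eq_rootRatio hlam (hnb i)]
      refine (hroot i C hC k v (hsaw k) _ _ fun u hu =>
        σ.freeVertices_congr_window (fun w hw => ?_) hu).trans_lt hk
      have hmem : w ∈ (finite_ball (hfin i) v (k + 1)).toFinset := by simpa using hw
      exact ⟨fun _ => hmem, fun _ => hW hmem⟩
    refine ⟨(K * C ^ (1 / q) + lam) / c ^ 2, fun ℓ hℓ σ τ hστ => ?_⟩
    obtain ⟨r, hr⟩ := hlim σ
    obtain ⟨s, hs⟩ := hlim τ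
    refine ⟨r, s, hr, hs, le_of_tendsto (Filter.Tendsto.sub hr hs).abs
      (Eventually.of_forall fun W => ?_)⟩
    exact hdiff i C hC ℓ v hℓ (fun _ => hsaw _) W σ τ hστ

/-! ## Loop-free programs run in linear time -/

theorem Val.one_le_size (x : Val) : 1 ≤ x.size := by
  cases x <;> simp [Val.size]

@[simp] theorem Val.fst_pair (x y : Val) : (Val.pair x y).fst = x := rfl

@[simp] theorem Val.snd_pair (x y : Val) : (Val.pair x y).snd = y := rfl

@[simp] theorem Val.arith_pair (f : ℕ → ℕ → ℕ) (a b : ℕ) :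
    Val.arith f (.pair (.num a) (.num b)) = .num (f a b) := rfl

theorem Val.size_fst_le (x : Val) : x.fst.size ≤ x.size := by
  cases x with
  | num n => simp [Val.fst, Val.size]
  | pair x y => simp only [Val.fst, Val.size]; omega

theorem Val.size_snd_le (x : Val) : x.snd.size ≤ x.size := by
  cases x with
  | num n => simp [Val.snd, Val.size]
  | pair x y => simp only [Val.snd, Val.size]; omega

theorem Val.size_arith_le {f : ℕ → ℕ → ℕ} (hf : ∀ a b, (f a b).size ≤ a.size + b.size + 1)
    (x : Val) : (Val.arith f x).size ≤ x.size := by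
  unfold Val.arith
  split
  · rename_i a b
    have := hf a b
    simp only [Val.size]
    omega
  · exact x.one_le_size

/-- Writing the output is charged, so time bounds double as size bounds for intermediate results. -/
theorem Runs.size_le {p : Prog} {x y : Val} {t : ℕ} (h : Runs p x y t) : y.size ≤ t := by
  induction h with
  | op o x => omega
  | pair _ _ ih₁ ih₂ => simp only [Val.size]; omega
  | comp _ _ _ ih => omega
  | ite_true _ _ _ _ ih => omega
  | ite_false _ _ _ ih => omega
  | loop_stop _ _ => omega
  | loop_step _ _ _ _ _ _ ih => omega

namespace Prog

/-- Programs without loops. -/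
def LoopFree : Prog → Prop
  | .op _ => True
  | .pair p q => p.LoopFree ∧ q.LoopFree
  | .comp p q => p.LoopFree ∧ q.LoopFree
  | .ite b p q => b.LoopFree ∧ p.LoopFree ∧ q.LoopFree
  | .loop _ _ => False

open Classical in
/-- The function computed by a loop-free program. -/
noncomputable def ev : Prog → Val → Val
  | .op o => o.eval
  | .pair p q => fun x => .pair (p.ev x) (q.ev x)
  | .comp p q => fun x => p.ev (q.ev x)
  | .ite b p q => fun x => if b.ev x = .num 0 then q.ev x else p.ev x
  | .loop _ _ => fun x => x

end Prog

theorem Nat.size_le_add_of_le {a b c : ℕ} (h : c ≤ a) : c.size ≤ a.size + b.size + 1 :=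
  (Nat.size_le_size h).trans (by omega)

theorem Nat.size_add_le (a b : ℕ) : (a + b).size ≤ a.size + b.size + 1 := by
  rw [Nat.size_le, pow_succ, pow_add]
  have ha := Nat.lt_size_self a
  have hb := Nat.lt_size_self b
  have ha' := Nat.one_le_two_pow (n := a.size)
  have hb' := Nat.one_le_two_pow (n := b.size)
  nlinarith

theorem Nat.size_mul_le (a b : ℕ) : (a * b).size ≤ a.size + b.size := by
  rw [Nat.size_le, pow_add]
  exact Nat.mul_lt_mul'' (Nat.lt_size_self a) (Nat.lt_size_self b)

theorem Op.size_eval_le (o : Op) : ∃ C, ∀ x : Val, (o.eval x).size ≤ C * x.size := by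
  cases o with
  | id => exact ⟨1, fun x => by simp [Op.eval]⟩
  | const n =>
    refine ⟨n.size + 1, fun x => ?_⟩
    have := x.one_le_size
    simp only [Op.eval, Val.size]
    nlinarith
  | fst => exact ⟨1, fun x => by simpa [Op.eval] using x.size_fst_le⟩
  | snd => exact ⟨1, fun x => by simpa [Op.eval] using x.size_snd_le⟩
  | add => exact ⟨1, fun x => by simpa [Op.eval] using Val.size_arith_le Nat.size_add_le x⟩
  | sub => exact ⟨1, fun x => by
      simpa [Op.eval] using Val.size_arith_le (fun a b => Nat.size_le_add_of_le (Nat.sub_le a b)) x⟩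
  | mul => exact ⟨1, fun x => by
      simpa [Op.eval] using Val.size_arith_le (fun a b => (Nat.size_mul_le a b).trans (by omega)) x⟩
  | div => exact ⟨1, fun x => by
      simpa [Op.eval] using
        Val.size_arith_le (fun a b => Nat.size_le_add_of_le (Nat.div_le_self a b)) x⟩
  | le => exact ⟨1, fun x => by
      simpa [Op.eval] using Val.size_arith_le (fun a b => by
        split_ifs
        · simp
        · simp) x⟩

/-- Each operation enlarges its argument by at most a constant factor, and the number of operations
is fixed by the program text. -/
theorem Prog.LoopFree.runs {p : Prog} (hp : p.LoopFree) :
    ∃ C, ∀ x, ∃ t, Runs p x (p.ev x) t ∧ t ≤ C * x.size := by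
  induction p with
  | op o =>
    obtain ⟨C, hC⟩ := o.size_eval_le
    refine ⟨C + 2, fun x => ⟨_, Runs.op o x, ?_⟩⟩
    have := hC x
    have := x.one_le_size
    nlinarith
  | pair p q ihp ihq =>
    obtain ⟨C, hC⟩ := ihp hp.1
    obtain ⟨C', hC'⟩ := ihq hp.2
    refine ⟨C + C' + 1, fun x => ?_⟩
    obtain ⟨s, hs, hsC⟩ := hC x
    obtain ⟨t, ht, htC⟩ := hC' x
    have := x.one_le_size
    exact ⟨_, Runs.pair hs ht, by nlinarith⟩
  | comp p q ihp ihq =>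
    obtain ⟨C, hC⟩ := ihp hp.1
    obtain ⟨C', hC'⟩ := ihq hp.2
    refine ⟨C' + C * C' + 1, fun x => ?_⟩
    obtain ⟨s, hs, hsC⟩ := hC' x
    obtain ⟨t, ht, htC⟩ := hC (q.ev x)
    have h1 := x.one_le_size
    have h2 := Nat.mul_le_mul_left C (hs.size_le.trans hsC)
    exact ⟨_, Runs.comp hs ht, by nlinarith⟩
  | ite b p q ihb ihp ihq =>
    obtain ⟨C, hC⟩ := ihb hp.1
    obtain ⟨C', hC'⟩ := ihp hp.2.1
    obtain ⟨C'', hC''⟩ := ihq hp.2.2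
    refine ⟨C + C' + C'' + 1, fun x => ?_⟩
    obtain ⟨r, hr, hrC⟩ := hC x
    obtain ⟨s, hs, hsC⟩ := hC' x
    obtain ⟨t, ht, htC⟩ := hC'' x
    have := x.one_le_size
    by_cases h : b.ev x = .num 0
    · rw [show (Prog.ite b p q).ev x = q.ev x from if_pos h]
      exact ⟨_, Runs.ite_false (h ▸ hr) ht, by nlinarith⟩
    · rw [show (Prog.ite b p q).ev x = p.ev x from if_neg h]
      exact ⟨_, Runs.ite_true hr h hs, by nlinarith⟩
  | loop b p => exact hp.elim

theorem Prog.LoopFree.runs_loop {b p : Prog} (hb : b.LoopFree) (hp : p.LoopFree) :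
    ∃ C, ∀ (k B : ℕ) (x : Val), (∀ j < k, b.ev (p.ev^[j] x) ≠ .num 0) →
      b.ev (p.ev^[k] x) = .num 0 → (∀ j ≤ k, (p.ev^[j] x).size ≤ B) →
      ∃ t, Runs (.loop b p) x (p.ev^[k] x) t ∧ t ≤ C * ((k + 1) * B) := by
  obtain ⟨C, hC⟩ := hb.runs
  obtain ⟨C', hC'⟩ := hp.runs
  refine ⟨C + C' + 2, fun k B => ?_⟩
  induction k with
  | zero =>
    intro x _ h0 hB
    obtain ⟨s, hs, hsC⟩ := hC x
    have h1 := hB 0 le_rfl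
    have h2 := x.one_le_size
    rw [Function.iterate_zero, id] at h0 h1 ⊢
    refine ⟨_, Runs.loop_stop (h0 ▸ hs), ?_⟩
    have h3 := Nat.mul_le_mul_left C h1
    nlinarith
  | succ k ih =>
    intro x hne h0 hB
    obtain ⟨s, hs, hsC⟩ := hC x
    obtain ⟨t, ht, htC⟩ := hC' x
    obtain ⟨r, hr, hrC⟩ := ih (p.ev x) (fun j hj => hne (j + 1) (by omega)) h0
      (fun j hj => hB (j + 1) (by omega))
    have h1 : x.size ≤ B := hB 0 (Nat.zero_le _)
    have h2 := x.one_le_size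
    refine ⟨_, Runs.loop_step hs (hne 0 (Nat.succ_pos k)) ht hr, ?_⟩
    have h3 := Nat.mul_le_mul_left C h1
    have h4 := Nat.mul_le_mul_left C' h1
    nlinarith

/-! ## The stack machine -/

/-- An activation record of the recursion: `budget` has as many bits as there are levels left,
`deleted` is the set of deleted vertices as a bit mask, `bit` the bit of the vertex under
consideration, `rows` its adjacency row and those of the later vertices, `flags` tells which of
them belong to the list the recursion runs over, and `num / den` is the product so far. -/
structure Frame where
  budget : ℕ
  deleted : ℕ
  bit : ℕ
  rows : Val
  flags : Val
  num : ℕ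
  den : ℕ

/-- The data that stay fixed: the adjacency matrix and the activity `num / den`. -/
structure Instance where
  rows : Val
  num : ℕ
  den : ℕ

namespace Frame

/-- The record after the current vertex has been passed. -/
def advance (f : Frame) (deleted : ℕ) : Frame :=
  ⟨f.budget, deleted, 2 * f.bit, f.rows.snd, f.flags.snd, f.num, f.den⟩

/-- The record that computes the ratio for the neighbours of the current vertex. -/
def child (f : Frame) (I : Instance) : Frame :=
  ⟨f.budget / 2, f.deleted + f.bit, 1, I.rows, f.rows.fst, 1, 1⟩

/-- The record after the result of a child has been multiplied in. -/
def absorb (f c : Frame) (I : Instance) : Frame :=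
  ⟨f.budget, f.deleted, f.bit, f.rows, f.flags, f.num * (I.den * c.den),
    f.den * (I.den * c.den + I.num * c.num)⟩

/-- The record has its result. -/
def Done (f : Frame) : Prop := f.budget = 0 ∨ f.rows = .num 0

/-- The current vertex is in the list and has not been deleted. -/
def Visits (f : Frame) : Prop := f.flags.fst ≠ .num 0 ∧ f.deleted / f.bit % 2 = 0

/-- Encoding of activation records. -/
def enc (f : Frame) : Val :=
  .pair (.num f.budget) (.pair (.num f.deleted) (.pair (.num f.bit) (.pair f.rows
    (.pair f.flags (.pair (.num f.num) (.num f.den))))))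

end Frame

open Classical in
/-- One step of the stack machine. -/
noncomputable def machineStep (I : Instance) : List Frame → List Frame
  | f :: g :: S =>
    if f.Done then g.absorb f I :: S
    else if f.Visits then f.child I :: f.advance (f.deleted + f.bit) :: g :: S
    else f.advance f.deleted :: g :: S
  | S => S

/-- Encoding of the states of the stack machine. -/
def encState (I : Instance) (S : List Frame) : Val :=
  .pair (.ofList (S.map Frame.enc)) (.pair I.rows (.pair (.num I.num) (.num I.den)))

/-! ### The program for the stack machine. -/

namespace Prog

/-- First component of the result. -/
abbrev fst (p : Prog) : Prog := .comp (.op .fst) p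

/-- Second component of the result. -/
abbrev snd (p : Prog) : Prog := .comp (.op .snd) p

/-- Binary operation applied to two results. -/
abbrev bin (o : Op) (p q : Prog) : Prog := .comp (.op o) (.pair p q)

/-- A constant. -/
abbrev const (n : ℕ) : Prog := .op (.const n)

/-- The input. -/
abbrev inp : Prog := .op .id

/-- The top of the stack. -/
abbrev top : Prog := inp.fst.fst

/-- The second record on the stack. -/
abbrev second : Prog := inp.fst.snd.fst

/-- The budget of the top record. -/
abbrev budget : Prog := top.fst

/-- The deleted set of the top record. -/
abbrev deleted : Prog := top.snd.fst

/-- The current bit of the top record. -/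
abbrev bit : Prog := top.snd.snd.fst

/-- The remaining rows of the top record. -/
abbrev rows : Prog := top.snd.snd.snd.fst

/-- The remaining flags of the top record. -/
abbrev flags : Prog := top.snd.snd.snd.snd.fst

/-- The numerator and the denominator of the top record. -/
abbrev result : Prog := top.snd.snd.snd.snd.snd

/-- The program that passes the current vertex. -/
abbrev advance (d : Prog) : Prog :=
  .pair budget (.pair d (.pair (bin .add bit bit) (.pair rows.snd (.pair flags.snd result))))

/-- The program that sets up the record of a child. -/
abbrev child : Prog :=
  .pair (bin .div budget (const 2)) (.pair (bin .add deleted bit) (.pair (const 1)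
    (.pair inp.snd.fst (.pair rows.fst (.pair (const 1) (const 1))))))

/-- The program that multiplies the result of a child into the record below it. -/
abbrev absorb : Prog :=
  .pair second.fst (.pair second.snd.fst (.pair second.snd.snd.fst (.pair second.snd.snd.snd.fst
    (.pair second.snd.snd.snd.snd.fst (.pair
      (bin .mul second.snd.snd.snd.snd.snd.fst (bin .mul inp.snd.snd.snd result.snd))
      (bin .mul second.snd.snd.snd.snd.snd.snd
        (bin .add (bin .mul inp.snd.snd.snd result.snd)
          (bin .mul inp.snd.snd.fst result.fst))))))))

/-- The membership bit of the current vertex in the deleted set. -/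
abbrev deletedBit : Prog :=
  bin .sub (bin .div deleted bit) (bin .mul (const 2) (bin .div (bin .div deleted bit) (const 2)))

/-- The program for one step of the stack machine. -/
def machineStep : Prog :=
  let pop : Prog := .pair (.pair absorb inp.fst.snd.snd) inp.snd
  let push : Prog := .pair (.pair child (.pair (advance (bin .add deleted bit)) inp.fst.snd)) inp.snd
  let skip : Prog := .pair (.pair (advance deleted) inp.fst.snd) inp.snd
  .ite budget (.ite rows (.ite flags.fst (.ite deletedBit skip push) skip) pop) pop

/-- The test whether the stack has more than one record. -/
def machineRunning : Prog := inp.fst.snd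

theorem loopFree_machineStep : machineStep.LoopFree := by
  simp [machineStep, LoopFree]

theorem loopFree_machineRunning : machineRunning.LoopFree := by
  simp [machineRunning, LoopFree]

end Prog

theorem ev_machineRunning (I : Instance) (f : Frame) (S : List Frame) :
    Prog.machineRunning.ev (encState I (f :: S)) = .ofList (S.map Frame.enc) := rfl

theorem ev_machineStep (I : Instance) (f g : Frame) (S : List Frame) :
    Prog.machineStep.ev (encState I (f :: g :: S)) =
      encState I (machineStep I (f :: g :: S)) := by
  -- The parity of the quotient must be expressed through division and subtraction, as there is no
  -- remainder operation.
  have hbit : f.deleted / f.bit - 2 * (f.deleted / f.bit / 2) = f.deleted / f.bit % 2 := by omega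
  have htwo : f.bit + f.bit = 2 * f.bit := by omega
  have hnum : ∀ a : ℕ, Val.num a = .num 0 ↔ a = 0 := fun a => by simp
  simp only [Prog.machineStep, Prog.ev, Op.eval, encState, List.map_cons, Val.ofList, Frame.enc,
    Val.fst_pair, Val.snd_pair, Val.arith_pair, hnum, hbit, htwo, machineStep, Frame.Done, Frame.Visits]
  by_cases h1 : f.budget = 0
  · simp [h1, Frame.absorb, Val.ofList, Frame.enc]
  by_cases h2 : f.rows = .num 0
  · simp [h1, h2, Frame.absorb, Val.ofList, Frame.enc]
  by_cases h3 : f.flags.fst = .num 0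
  · simp [h1, h2, h3, Frame.advance, Val.ofList, Frame.enc]
  by_cases h4 : f.deleted / f.bit % 2 = 0
  · simp [h1, h2, h3, h4, Frame.advance, Frame.child, Val.ofList, Frame.enc]
  · have h5 : f.deleted / f.bit % 2 = 1 := by omega
    simp [h1, h2, h3, h5, Frame.advance, Val.ofList, Frame.enc]

/-! ### The size of the stack -/

/-- What holds of the stack after `j` steps. -/
structure StackInv (I : Instance) (B j : ℕ) (S : List Frame) : Prop where
  budget_le : ∀ f ∈ S, f.budget ≤ B
  deleted_le : ∀ f ∈ S, f.deleted ≤ 2 ^ j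
  bit_le : ∀ f ∈ S, f.bit ≤ 2 ^ j
  rows_le : ∀ f ∈ S, f.rows.size ≤ I.rows.size
  flags_le : ∀ f ∈ S, f.flags.size ≤ I.rows.size
  num_le : ∀ f ∈ S, f.num ≤ f.den
  den_pos : ∀ f ∈ S, 1 ≤ f.den
  prod_le : (S.map Frame.den).prod ≤ (I.num + I.den) ^ j
  length_le : S.length ≤ j + 2

/-- Absorbing a child multiplies two denominators, so bounds on single records would square. The
product over the whole stack grows by a factor of at most `I.num + I.den`, because each numerator is
at most its denominator, and a new record starts with denominator 1. -/
theorem StackInv.step {I : Instance} (hI : 0 < I.den) {B j : ℕ} {S : List Frame}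
    (h : StackInv I B j S) : StackInv I B (j + 1) (machineStep I S) := by
  have h2 : 2 ^ j ≤ 2 ^ (j + 1) := Nat.pow_le_pow_right two_pos (Nat.le_succ j)
  have hp : (I.num + I.den) ^ j ≤ (I.num + I.den) ^ (j + 1) :=
    Nat.pow_le_pow_right (by omega) (Nat.le_succ j)
  match S, h with
  | [], h => exact ⟨by simp [machineStep], by simp [machineStep], by simp [machineStep],
      by simp [machineStep], by simp [machineStep], by simp [machineStep], by simp [machineStep],
      h.prod_le.trans hp, by simp [machineStep]⟩
  | [f], h => exact ⟨h.budget_le, fun g hg => (h.deleted_le g hg).trans h2,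
      fun g hg => (h.bit_le g hg).trans h2, h.rows_le, h.flags_le, h.num_le, h.den_pos,
      h.prod_le.trans hp, by simp [machineStep]⟩
  | f :: g :: S, h =>
    obtain ⟨b1, b2, b3, b4, b5, b6, b7, b8, b9⟩ := h
    simp only [List.forall_mem_cons] at b1 b2 b3 b4 b5 b6 b7
    simp only [List.map_cons, List.prod_cons, List.length_cons] at b8 b9
    obtain ⟨f1, g1, s1⟩ := b1
    obtain ⟨f2, g2, s2⟩ := b2
    obtain ⟨f3, g3, s3⟩ := b3
    obtain ⟨f4, g4, s4⟩ := b4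
    obtain ⟨f5, g5, s5⟩ := b5
    obtain ⟨f6, g6, s6⟩ := b6
    obtain ⟨f7, g7, s7⟩ := b7
    have s2' : ∀ x ∈ S, x.deleted ≤ 2 ^ (j + 1) := fun x hx => (s2 x hx).trans h2
    have s3' : ∀ x ∈ S, x.bit ≤ 2 ^ (j + 1) := fun x hx => (s3 x hx).trans h2
    have f4' := f.rows.size_fst_le
    have f4'' := f.rows.size_snd_le
    have f5'' := f.flags.size_snd_le
    have hdiv := Nat.div_le_self f.budget 2
    have hpow : 2 ^ (j + 1) = 2 ^ j + 2 ^ j := by ring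
    have hone : 1 ≤ 2 ^ (j + 1) := Nat.one_le_two_pow
    rw [machineStep]
    split_ifs with hd hv
    · have hden : I.den * f.den + I.num * f.num ≤ (I.num + I.den) * f.den := by
        have := Nat.mul_le_mul_left I.num f6
        nlinarith
      have hden1 : 1 ≤ I.den * f.den + I.num * f.num := by
        have := Nat.mul_pos hI f7
        omega
      refine ⟨?_, ?_, ?_, ?_, ?_, ?_, ?_, ?_, ?_⟩ <;>
        simp only [List.forall_mem_cons, Frame.absorb, List.map_cons, List.prod_cons,
          List.length_cons]
      · exact ⟨g1, s1⟩
      · exact ⟨g2.trans h2, s2'⟩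
      · exact ⟨g3.trans h2, s3'⟩
      · exact ⟨g4, s4⟩
      · exact ⟨g5, s5⟩
      · exact ⟨Nat.mul_le_mul g6 (by omega), s6⟩
      · exact ⟨Nat.mul_pos g7 hden1, s7⟩
      · calc g.den * (I.den * f.den + I.num * f.num) * (S.map Frame.den).prod
            ≤ g.den * ((I.num + I.den) * f.den) * (S.map Frame.den).prod := by gcongr
          _ = f.den * (g.den * (S.map Frame.den).prod) * (I.num + I.den) := by ring
          _ ≤ (I.num + I.den) ^ j * (I.num + I.den) := by gcongr
          _ = _ := by ring
      · omega
    · refine ⟨?_, ?_, ?_, ?_, ?_, ?_, ?_, ?_, ?_⟩ <;>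
        simp only [List.forall_mem_cons, Frame.advance, Frame.child, List.map_cons,
          List.prod_cons, List.length_cons]
      · exact ⟨by omega, f1, g1, s1⟩
      · exact ⟨by omega, by omega, g2.trans h2, s2'⟩
      · exact ⟨hone, by omega, g3.trans h2, s3'⟩
      · exact ⟨le_rfl, by omega, g4, s4⟩
      · exact ⟨by omega, by omega, g5, s5⟩
      · exact ⟨le_rfl, f6, g6, s6⟩
      · exact ⟨le_rfl, f7, g7, s7⟩
      · rw [one_mul]; exact b8.trans hp
      · omega
    · refine ⟨?_, ?_, ?_, ?_, ?_, ?_, ?_, ?_, ?_⟩ <;>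
        simp only [List.forall_mem_cons, Frame.advance, List.map_cons,
          List.prod_cons, List.length_cons]
      · exact ⟨f1, g1, s1⟩
      · exact ⟨f2.trans h2, g2.trans h2, s2'⟩
      · exact ⟨by omega, g3.trans h2, s3'⟩
      · exact ⟨by omega, g4, s4⟩
      · exact ⟨by omega, g5, s5⟩
      · exact ⟨f6, g6, s6⟩
      · exact ⟨f7, g7, s7⟩
      · exact b8.trans hp
      · omega

theorem Nat.size_pow_le (a j : ℕ) : (a ^ j).size ≤ j * a.size + 1 := by
  rw [Nat.size_le, pow_succ, mul_comm j, pow_mul]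
  have h := Nat.pow_le_pow_left (Nat.lt_size_self a).le j
  have h' : 0 < (2 ^ a.size) ^ j := by positivity
  omega

/-- A bound for the size of the state after at most `j` steps, given the size `b` of the budget,
`s` of the adjacency matrix, and `w` of the activity. -/
def stateBound (b s w j : ℕ) : ℕ := (j + 2) * (b + 2 * s + 2 * w * j + 2 * j + 16) + s + 2 * w + 8

theorem StackInv.size_le {I : Instance} {B j : ℕ} {S : List Frame} (h : StackInv I B j S) :
    (encState I S).size ≤ stateBound B.size I.rows.size (I.num + I.den).size j := by
  set w := (I.num + I.den).size with hw
  have hden : ∀ f ∈ S, f.den ≤ (I.num + I.den) ^ j := fun f hf =>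
    (List.single_le_prod (l := S.map Frame.den) (by
      intro x hx
      obtain ⟨g, hg, rfl⟩ := List.mem_map.1 hx
      exact h.den_pos g hg) _ (List.mem_map_of_mem hf)).trans h.prod_le
  have hpow : (2 ^ j).size ≤ j + 1 := by rw [Nat.size_pow]
  have hframe : ∀ f ∈ S, f.enc.size ≤ B.size + 2 * I.rows.size + 2 * w * j + 2 * j + 15 := by
    intro f hf
    have h1 := Nat.size_le_size (h.budget_le f hf)
    have h2 := (Nat.size_le_size (h.deleted_le f hf)).trans hpow
    have h3 := (Nat.size_le_size (h.bit_le f hf)).trans hpow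
    have h4 := h.rows_le f hf
    have h5 := h.flags_le f hf
    have h6 := (Nat.size_le_size (hden f hf)).trans (Nat.size_pow_le _ j)
    have h7 := (Nat.size_le_size (h.num_le f hf)).trans h6
    rw [← hw, mul_comm j w] at h6 h7
    simp only [Frame.enc, Val.size]
    rw [mul_assoc 2 w j]
    omega
  have hlist : ∀ (T : List Frame) (c : ℕ), (∀ f ∈ T, f.enc.size ≤ c) →
      (Val.ofList (T.map Frame.enc)).size ≤ T.length * (c + 1) + 1 := by
    intro T c
    induction T with
    | nil => simp [Val.ofList, Val.size]
    | cons f T ih =>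
      intro hT
      rw [List.forall_mem_cons] at hT
      have := ih hT.2
      have := hT.1
      simp only [List.map_cons, Val.ofList, Val.size, List.length_cons]
      rw [add_mul]
      omega
  have h1 := hlist S _ hframe
  have h2 := Nat.mul_le_mul_right
    (B.size + 2 * I.rows.size + 2 * w * j + 2 * j + 15 + 1) h.length_le
  have h3 : I.num.size ≤ w := Nat.size_le_size (Nat.le_add_right _ _)
  have h4 : I.den.size ≤ w := Nat.size_le_size (Nat.le_add_left _ _)
  simp only [encState, Val.size]
  change _ ≤ (j + 2) * (B.size + 2 * I.rows.size + 2 * w * j + 2 * j + 15 + 1) +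
    I.rows.size + 2 * w + 8
  omega

theorem stateBound_mono {b s w j k : ℕ} (h : j ≤ k) : stateBound b s w j ≤ stateBound b s w k := by
  unfold stateBound
  gcongr

/-! ## Correctness of the stack machine -/

/-- Bit i is clear, so the addition produces no carry: adding the power deletes exactly vertex i. -/
theorem Nat.testBit_add_two_pow {D i : ℕ} (h : D / 2 ^ i % 2 = 0) (j : ℕ) :
    (D + 2 ^ i).testBit j = (D.testBit j || decide (j = i)) := by
  obtain ⟨c, hc⟩ : ∃ c, D / 2 ^ i = 2 * c := ⟨D / 2 ^ i / 2, by omega⟩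
  have hr : D % 2 ^ i < 2 ^ i := Nat.mod_lt _ (by positivity)
  have h1 : D = 2 ^ i * (2 * c) + D % 2 ^ i := by rw [← hc, Nat.div_add_mod]
  have h2 : D + 2 ^ i = 2 ^ i * (2 * c + 1) + D % 2 ^ i := by
    conv_lhs => rw [h1]
    ring
  rw [h2]
  conv_rhs => rw [h1]
  rw [Nat.testBit_two_pow_mul_add _ hr, Nat.testBit_two_pow_mul_add _ hr]
  rcases lt_trichotomy j i with hj | rfl | hj
  · simp [hj, hj.ne]
  · simp
  · obtain ⟨k, rfl⟩ := Nat.exists_eq_add_of_lt hj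
    have h3 : i + k + 1 - i = k + 1 := by omega
    rw [if_neg (by omega), if_neg (by omega), h3, Nat.testBit_succ, Nat.testBit_succ,
      decide_eq_false (by omega), Bool.or_false]
    congr 1
    omega

theorem Nat.size_half {B ℓ : ℕ} (h : B.size = ℓ + 1) : (B / 2).size = ℓ := by
  refine le_antisymm ?_ ?_
  · have := Nat.lt_size_self B
    rw [h, pow_succ] at this
    rw [Nat.size_le]
    omega
  · cases ℓ with
    | zero => exact Nat.zero_le _
    | succ k =>
      have : 2 ^ (k + 1) ≤ B := Nat.lt_size.1 (by omega)
      rw [pow_succ] at this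
      rw [Nat.succ_le_iff, Nat.lt_size]
      omega

section Adjacency

variable {n : ℕ} (H : SimpleGraph (Fin n))

open Classical in
/-- A row of the adjacency matrix. -/
noncomputable def adjRow (u : Fin n) : Val :=
  .ofList ((List.finRange n).map fun w => .num (if H.Adj u w then 1 else 0))

/-- The adjacency matrix. -/
noncomputable def adjMatrixVal : Val := .ofList ((List.finRange n).map (adjRow H))

open Classical in
/-- The neighbours of a vertex in increasing order. -/
noncomputable def adjList (u : Fin n) : List (Fin n) :=
  (List.finRange n).filter fun w => H.Adj u w

theorem mem_adjList (u w : Fin n) : w ∈ adjList H u ↔ H.Adj u w := by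
  simp [adjList]

theorem graphInput_eq (k : ℕ) :
    graphInput H k = .pair (.num n) (.pair (adjMatrixVal H) (.num k)) := by
  simp only [graphInput, adjMatrixVal, List.ofFn_eq_map]
  rfl

theorem drop_finRange {i : ℕ} (hi : i < n) :
    (List.finRange n).drop i = ⟨i, hi⟩ :: (List.finRange n).drop (i + 1) := by
  rw [List.drop_eq_getElem_cons (by simpa using hi)]
  simp

end Adjacency

open Classical in
/-- The vertices of a list that carry a nonzero flag. -/
noncomputable def flagged {n : ℕ} (μ : Fin n → Val) (L : List (Fin n)) : List (Fin n) :=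
  L.filter fun u => μ u ≠ .num 0

open Classical in
theorem flagged_adj {n : ℕ} (H : SimpleGraph (Fin n)) (u : Fin n) :
    flagged (fun w => .num (if H.Adj u w then 1 else 0)) (List.finRange n) = adjList H u := by
  refine List.filter_congr fun w _ => ?_
  by_cases h : H.Adj u w <;> simp [h]

/-- The root record uses the adjacency rows as its flags: a row of a nonempty matrix is a pair,
hence nonzero, and every vertex is listed. -/
theorem flagged_adjRow {n : ℕ} (H : SimpleGraph (Fin n)) :
    flagged (adjRow H) (List.finRange n) = List.finRange n := by
  refine List.filter_eq_self.2 fun w _ => ?_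
  have hn : 0 < n := w.pos
  have h := drop_finRange hn
  rw [List.drop_zero] at h
  rw [adjRow, h]
  simp [Val.ofList]

theorem mul_ratio_step {p q X Y X' Y' : ℕ} (hq : 0 < q) (hY : 0 < Y) :
    ((q * Y * X' : ℕ) : ℝ) / ((q * Y + p * X) * Y' : ℕ) =
      (1 + (p : ℝ) / q * ((X : ℝ) / Y))⁻¹ * ((X' : ℝ) / Y') := by
  have hq' : (0 : ℝ) < q := by exact_mod_cast hq
  have hY' : (0 : ℝ) < Y := by exact_mod_cast hY
  have h : (1 + (p : ℝ) / q * ((X : ℝ) / Y)) = (q * Y + p * X) / (q * Y) := by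
    field_simp
  rw [h, inv_div, div_mul_div_comm]
  push_cast
  ring

/-- The outer induction is on the remaining depth, the inner one on the number d of vertices still
to pass. The stack below the record is arbitrary and comes back unchanged. A record costs at most
one step per vertex and one for its absorption, hence n + 1 steps per node; for the record itself
only the d remaining passes are counted, and the n + 1 on the left avoids a subtraction. -/
theorem machine_frame_run {n : ℕ} (H : SimpleGraph (Fin n)) {I : Instance}
    (hrows : I.rows = adjMatrixVal H) (hI : 0 < I.den) (ℓ : ℕ) :
    ∀ (μ : Fin n → Val) (d i : ℕ), i + d = n → ∀ (U : Finset (Fin n)) (B D x y : ℕ)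
      (g : Frame) (S : List Frame), B.size = ℓ → (∀ u : Fin n, u ∈ U ↔ D.testBit u = false) →
      ∃ (k : ℕ) (f : Frame) (X Y : ℕ),
        (machineStep I)^[k] (⟨B, D, 2 ^ i, .ofList (((List.finRange n).drop i).map (adjRow H)),
          .ofList (((List.finRange n).drop i).map μ), x, y⟩ :: g :: S) = f :: g :: S ∧
        f.Done ∧ 0 < Y ∧ f.num = x * X ∧ f.den = y * Y ∧
        (X : ℝ) / Y = truncRatio ((I.num : ℝ) / I.den) (adjList H) ℓ U
          (flagged μ ((List.finRange n).drop i)) ∧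
        k + (n + 1) ≤ d + (n + 1) * nodeCount (adjList H) ℓ U
          (flagged μ ((List.finRange n).drop i)) := by
  classical
  induction ℓ with
  | zero =>
    intro μ d i _ U B D x y g S hB _
    refine ⟨0, _, 1, 1, rfl, Or.inl (Nat.size_eq_zero.1 hB), one_pos, by simp, by simp,
      by simp [truncRatio], by simp [nodeCount]⟩
  | succ ℓ ih =>
    intro μ d
    induction d with
    | zero =>
      intro i hi U B D x y g S _ _
      have hnil : (List.finRange n).drop i = [] := by simp; omega
      rw [hnil]
      exact ⟨0, _, 1, 1, rfl, Or.inr rfl, one_pos, by simp, by simp,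
        by simp [truncRatio, flagged, children], by simp [nodeCount, flagged, children]⟩
    | succ d ihd =>
      intro i hi U B D x y g S hB hU
      have hin : i < n := by omega
      set u : Fin n := ⟨i, hin⟩ with hu
      have hdrop := drop_finRange hin
      rw [← hu] at hdrop
      have hB0 : B ≠ 0 := by rintro rfl; simp at hB
      rw [hdrop]
      set L := (List.finRange n).drop (i + 1) with hL
      set f₀ : Frame := ⟨B, D, 2 ^ i, .ofList ((u :: L).map (adjRow H)),
        .ofList ((u :: L).map μ), x, y⟩ with hf₀
      have hnd : ¬ f₀.Done := by
        rintro (h | h)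
        · exact hB0 h
        · simp [hf₀, Val.ofList] at h
      have hpow : 2 * 2 ^ i = 2 ^ (i + 1) := by ring
      by_cases hv : f₀.Visits
      · have hflag : μ u ≠ .num 0 := hv.1
        have hbit : D / 2 ^ i % 2 = 0 := hv.2
        have hD : ∀ j, (D + 2 ^ i).testBit j = (D.testBit j || decide (j = i)) :=
          Nat.testBit_add_two_pow hbit
        have huU : u ∈ U := by
          rw [hU, Nat.testBit_eq_decide_div_mod_eq]
          simp [hu, hbit]
        have hU' : ∀ w : Fin n, w ∈ U.erase u ↔ (D + 2 ^ i).testBit w = false := by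
          intro w
          rw [hD, Finset.mem_erase, hU, Bool.or_eq_false_iff, decide_eq_false_iff_not, and_comm,
            hu, Ne, Fin.ext_iff]
        have hfl : flagged μ (u :: L) = u :: flagged μ L := by
          simp [flagged, hflag]
        obtain ⟨k₁, c, X, Y, hk₁, hc, hY, hcn, hcd, hXY, hkc⟩ :=
          ih (fun w => .num (if H.Adj u w then 1 else 0)) n 0 (by omega) (U.erase u) (B / 2)
            (D + 2 ^ i) 1 1 (f₀.advance (D + 2 ^ i)) (g :: S) (Nat.size_half hB) hU'
        rw [List.drop_zero, flagged_adj] at hXY hkc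
        rw [one_mul] at hcn hcd
        obtain ⟨k₂, f, X', Y', hk₂, hf, hY', hfn, hfd, hXY', hkf⟩ :=
          ihd (i + 1) (by omega) (U.erase u) B (D + 2 ^ i) (x * (I.den * Y))
            (y * (I.den * Y + I.num * X)) g S hB hU'
        -- One step pushes the child, k₁ steps run it, one absorbs it, and k₂ steps treat the later
        -- vertices.
        refine ⟨k₂ + (1 + (k₁ + 1)), f, I.den * Y * X', (I.den * Y + I.num * X) * Y', ?_, hf,
          Nat.mul_pos (by positivity) hY', by rw [hfn]; ring, by rw [hfd]; ring, ?_, ?_⟩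
        · have h1 : machineStep I (f₀ :: g :: S) =
              f₀.child I :: f₀.advance (D + 2 ^ i) :: g :: S := by
            rw [machineStep, if_neg hnd, if_pos hv]
          have h2 : f₀.child I = ⟨B / 2, D + 2 ^ i, 2 ^ 0,
              .ofList (((List.finRange n).drop 0).map (adjRow H)),
              .ofList (((List.finRange n).drop 0).map
                fun w => .num (if H.Adj u w then 1 else 0)), 1, 1⟩ := by
            rw [Frame.child, hrows, List.drop_zero, adjMatrixVal, pow_zero]
            rfl
          have h3 : machineStep I (c :: f₀.advance (D + 2 ^ i) :: g :: S) =
              ⟨B, D + 2 ^ i, 2 ^ (i + 1), .ofList (L.map (adjRow H)), .ofList (L.map μ),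
                x * (I.den * Y), y * (I.den * Y + I.num * X)⟩ :: g :: S := by
            rw [machineStep, if_pos hc, Frame.absorb, hcn, hcd, ← hpow]
            rfl
          rw [Function.iterate_add_apply, Function.iterate_add_apply,
            Function.iterate_one, Function.iterate_succ_apply, h1, h2, hk₁, h3, hk₂]
        · rw [mul_ratio_step hI hY, hXY, hXY', hfl]
          simp only [truncRatio]
          rw [children, if_pos huU, List.map_cons, List.prod_cons]
        · rw [hfl]
          simp only [nodeCount] at hkf ⊢
          rw [children, if_pos huU, List.map_cons, List.sum_cons]
          simp only [mul_add, mul_one, ← hL] at hkf ⊢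
          omega
      · have h1 : machineStep I (f₀ :: g :: S) = f₀.advance D :: g :: S := by
          rw [machineStep, if_neg hnd, if_neg hv]
        have h2 : f₀.advance D = ⟨B, D, 2 ^ (i + 1), .ofList (L.map (adjRow H)),
            .ofList (L.map μ), x, y⟩ := by
          rw [← hpow]; rfl
        -- A vertex is passed over either because it is not listed or because it is already deleted;
        -- neither produces a child.
        have hch : children U (flagged μ (u :: L)) = children U (flagged μ L) := by
          by_cases hflag : μ u = .num 0
          · simp [flagged, hflag]
          · have hfl : flagged μ (u :: L) = u :: flagged μ L := by simp [flagged, hflag]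
            have huU : u ∉ U := by
              rw [hU, Nat.testBit_eq_decide_div_mod_eq]
              intro h
              refine hv ⟨hflag, ?_⟩
              have h' : ¬ D / 2 ^ i % 2 = 1 := by simpa [hu] using h
              change D / 2 ^ i % 2 = 0
              omega
            rw [hfl, children, if_neg huU]
        obtain ⟨k, f, X, Y, hk, hf, hY, hfn, hfd, hXY, hkf⟩ :=
          ihd (i + 1) (by omega) U B D x y g S hB hU
        refine ⟨k + 1, f, X, Y, ?_, hf, hY, hfn, hfd, ?_, ?_⟩
        · rw [Function.iterate_succ_apply, h1, h2, hk]
        · rw [hXY]; simp only [truncRatio, hch, ← hL]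
        · simp only [nodeCount, hch, ← hL] at hkf ⊢
          omega

/-- The record at the bottom of the stack. -/
def bottomFrame : Frame := ⟨0, 0, 0, .num 0, .num 0, 1, 1⟩

/-- The record for the whole vertex set. -/
def rootFrame (rows : Val) (B : ℕ) : Frame := ⟨B, 0, 1, rows, rows, 1, 1⟩

/-- The bottom record gives the root result something to be absorbed into, so that the run ends with
a single record; X and Y can be recovered from it up to known factors. -/
theorem machine_run {n : ℕ} (H : SimpleGraph (Fin n)) {I : Instance}
    (hrows : I.rows = adjMatrixVal H) (hI : 0 < I.den) (B : ℕ) :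
    ∃ k X Y : ℕ, (machineStep I)^[k] [rootFrame I.rows B, bottomFrame] =
        [⟨0, 0, 0, .num 0, .num 0, I.den * Y, I.den * Y + I.num * X⟩] ∧ 0 < Y ∧
      (X : ℝ) / Y = truncRatio ((I.num : ℝ) / I.den) (adjList H) B.size Finset.univ
        (List.finRange n) ∧
      k ≤ (n + 1) * nodeCount (adjList H) B.size Finset.univ (List.finRange n) := by
  obtain ⟨k, f, X, Y, hk, hf, hY, hfn, hfd, hXY, hkf⟩ :=
    machine_frame_run H hrows hI B.size (adjRow H) n 0 (by omega) Finset.univ B 0 1 1 bottomFrame []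
      rfl (by simp)
  rw [List.drop_zero, flagged_adjRow] at hXY hkf
  rw [one_mul] at hfn hfd
  refine ⟨k + 1, X, Y, ?_, hY, hXY, by omega⟩
  rw [Function.iterate_succ_apply']
  have h : rootFrame I.rows B = ⟨B, 0, 2 ^ 0, .ofList (((List.finRange n).drop 0).map (adjRow H)),
      .ofList (((List.finRange n).drop 0).map (adjRow H)), 1, 1⟩ := by
    rw [rootFrame, hrows, List.drop_zero, adjMatrixVal, pow_zero]
  rw [h, hk, machineStep, if_pos hf, Frame.absorb, hfn, hfd, bottomFrame]
  simp

theorem stackInv_start (I : Instance) (B : ℕ) :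
    StackInv I B 0 [rootFrame I.rows B, bottomFrame] := by
  have := I.rows.one_le_size
  constructor <;> simp [rootFrame, bottomFrame, Val.size, this]

theorem machineStep_ne_nil {I : Instance} {S : List Frame} (h : S ≠ []) : machineStep I S ≠ [] := by
  match S with
  | [] => exact absurd rfl h
  | [f] => simp [machineStep]
  | f :: g :: S => rw [machineStep]; split_ifs <;> simp

theorem machine_loop_runs :
    ∃ C, ∀ (n : ℕ) (H : SimpleGraph (Fin n)) (I : Instance), I.rows = adjMatrixVal H → 0 < I.den →
      ∀ B N : ℕ, (n + 1) * nodeCount (adjList H) B.size Finset.univ (List.finRange n) ≤ N →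
      ∃ X Y t : ℕ, 0 < Y ∧
        (X : ℝ) / Y = truncRatio ((I.num : ℝ) / I.den) (adjList H) B.size Finset.univ
          (List.finRange n) ∧
        Runs (.loop Prog.machineRunning Prog.machineStep)
          (encState I [rootFrame I.rows B, bottomFrame])
          (encState I [⟨0, 0, 0, .num 0, .num 0, I.den * Y, I.den * Y + I.num * X⟩]) t ∧
        t ≤ C * ((N + 1) * stateBound B.size I.rows.size (I.num + I.den).size N) := by
  classical
  obtain ⟨C, hC⟩ := Prog.loopFree_machineRunning.runs_loop Prog.loopFree_machineStep
  refine ⟨C, fun n H I hrows hI B N hN => ?_⟩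
  obtain ⟨k, X, Y, hk, hY, hXY, hkN⟩ := machine_run H hrows hI B
  set S₀ := [rootFrame I.rows B, bottomFrame] with hS₀
  -- The loop stops at the first single-record state. Such states are fixed by `machineStep`, so
  -- this one is the state reached after k steps, and before it program and machine agree step by
  -- step.
  have hex : ∃ j, ∃ f, (machineStep I)^[j] S₀ = [f] := ⟨k, _, hk⟩
  obtain ⟨f, hf⟩ := Nat.find_spec hex
  set m := Nat.find hex with hm
  have hmk : m ≤ k := Nat.find_min' hex ⟨_, hk⟩
  have hfix : (machineStep I)^[k] S₀ = [f] := by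
    obtain ⟨d, rfl⟩ := Nat.exists_eq_add_of_le' hmk
    rw [Function.iterate_add_apply, hf]
    exact Function.iterate_fixed rfl d
  have hinv : ∀ j, StackInv I B j ((machineStep I)^[j] S₀) := by
    intro j
    induction j with
    | zero => exact stackInv_start I B
    | succ j ih => rw [Function.iterate_succ_apply']; exact ih.step hI
  have hnil : ∀ j, (machineStep I)^[j] S₀ ≠ [] := by
    intro j
    induction j with
    | zero => simp [hS₀]
    | succ j ih => rw [Function.iterate_succ_apply']; exact machineStep_ne_nil ih
  have hlong : ∀ j < m, ∃ f g S, (machineStep I)^[j] S₀ = f :: g :: S := by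
    intro j hj
    have h1 := hnil j
    have h2 := Nat.find_min hex hj
    match h : (machineStep I)^[j] S₀ with
    | [] => exact absurd h h1
    | [f] => exact absurd ⟨f, h⟩ h2
    | f :: g :: S => exact ⟨f, g, S, rfl⟩
  have hev : ∀ j ≤ m, Prog.machineStep.ev^[j] (encState I S₀) =
      encState I ((machineStep I)^[j] S₀) := by
    intro j
    induction j with
    | zero => intro _; rfl
    | succ j ih =>
      intro hj
      obtain ⟨f, g, S, h⟩ := hlong j (by omega)
      rw [Function.iterate_succ_apply', Function.iterate_succ_apply', ih (by omega), h,
        ev_machineStep]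
  obtain ⟨t, ht, htC⟩ := hC m (stateBound B.size I.rows.size (I.num + I.den).size N) (encState I S₀)
    (fun j hj => by
      obtain ⟨f, g, S, h⟩ := hlong j hj
      rw [hev j hj.le, h, ev_machineRunning]
      simp [Val.ofList])
    (by rw [hev m le_rfl, hf, ev_machineRunning]; rfl)
    (fun j hj => by
      rw [hev j hj]
      exact (hinv j).size_le.trans (stateBound_mono (by omega)))
  rw [hev m le_rfl, hf, ← hfix, hk] at ht
  refine ⟨X, Y, t, hY, hXY, ht, htC.trans ?_⟩
  gcongr
  omega

/-! ## The counting algorithm -/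

namespace Prog

/-- The integer `c (n + 1) m`, from the input `(n, matrix, m)`. -/
def precision (c : ℕ) : Prog :=
  bin .mul (const c) (bin .mul (bin .add inp.fst (const 1)) inp.snd.snd)

/-- A fixed power of the result of a program. -/
def power (p : Prog) : ℕ → Prog
  | 0 => const 1
  | k + 1 => bin .mul (power p k) p

/-- The initial state of the stack machine, from the graph and the activity. -/
def setup (c k : ℕ) : Prog :=
  .pair
    (.pair
      (.pair (power (.comp (precision c) inp.fst) k) (.pair (const 0) (.pair (const 1)
        (.pair inp.fst.snd.fst (.pair inp.fst.snd.fst (.pair (const 1) (const 1)))))))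
      (.pair (.pair (const 0) (.pair (const 0) (.pair (const 0) (.pair (const 0)
        (.pair (const 0) (.pair (const 1) (const 1))))))) (const 0)))
    (.pair inp.fst.snd.fst inp.snd)

/-- The partition function, from the final state of the stack machine. -/
def readout : Prog :=
  .pair (bin .mul result.fst inp.snd.snd.fst)
    (bin .mul (bin .sub result.snd result.fst) inp.snd.snd.snd)

/-- The counting algorithm, for an activity approximated by the program `p`. -/
def counting (p : Prog) (c k : ℕ) : Prog :=
  .comp readout (.comp (.loop machineRunning machineStep)
    (.comp (setup c k) (.pair inp (.comp p (precision c)))))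

theorem loopFree_precision (c : ℕ) : (precision c).LoopFree := by
  simp [precision, LoopFree]

theorem loopFree_power {p : Prog} (hp : p.LoopFree) (k : ℕ) : (power p k).LoopFree := by
  induction k with
  | zero => simp [power, LoopFree]
  | succ k ih => simp [power, LoopFree, ih, hp]

theorem loopFree_setup (c k : ℕ) : (setup c k).LoopFree := by
  have h : (Prog.comp (precision c) inp.fst).LoopFree := by
    simp [LoopFree, loopFree_precision]
  have := loopFree_power h k
  simp [setup, LoopFree, this]

theorem loopFree_readout : readout.LoopFree := by
  simp [readout, LoopFree]

theorem ev_precision {n : ℕ} (H : SimpleGraph (Fin n)) (c m : ℕ) :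
    (precision c).ev (graphInput H m) = .num (c * ((n + 1) * m)) := rfl

theorem ev_power {p : Prog} {x : Val} {a : ℕ} (h : p.ev x = .num a) (k : ℕ) :
    (power p k).ev x = .num (a ^ k) := by
  induction k with
  | zero => rfl
  | succ k ih =>
    simp only [power, ev, ih, h, Op.eval, Val.arith_pair, pow_succ]

theorem ev_setup {n : ℕ} (H : SimpleGraph (Fin n)) (c k m p q : ℕ) :
    (setup c k).ev (.pair (graphInput H m) (fracVal p q)) =
      encState ⟨adjMatrixVal H, p, q⟩
        [rootFrame (adjMatrixVal H) ((c * ((n + 1) * m)) ^ k), bottomFrame] := by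
  have h : (Prog.comp (precision c) inp.fst).ev (.pair (graphInput H m) (fracVal p q)) =
      .num (c * ((n + 1) * m)) := rfl
  have h' := ev_power h k
  rw [graphInput_eq] at h'
  simp only [setup, ev, Op.eval, h', Val.fst_pair, Val.snd_pair, graphInput_eq]
  rfl

/-- With a = qY and b = qY + pX the output is the fraction Y/X, the inverse of the truncated ratio;
this requires p > 0. -/
theorem ev_readout (rows : Val) (p q a b : ℕ) :
    readout.ev (encState ⟨rows, p, q⟩ [⟨0, 0, 0, .num 0, .num 0, a, b⟩]) =
      fracVal (a * p) ((b - a) * q) := rfl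

end Prog

theorem truncRatio_pos {V : Type*} [DecidableEq V] {lam : ℝ} {nb : V → List V} (hlam : 0 < lam)
    (ℓ : ℕ) (U : Finset V) (L : List V) : 0 < truncRatio lam nb ℓ U L := by
  cases ℓ with
  | zero => simp [truncRatio]
  | succ ℓ =>
    refine List.prod_pos fun a ha => ?_
    obtain ⟨c, -, rfl⟩ := List.mem_map.1 ha
    have := truncRatio_nonneg (nb := nb) hlam ℓ c.1 (nb c.2)
    positivity

theorem counting_runs (p₀ : Prog) (c k : ℕ) : ∃ C, ∀ (n : ℕ) (H : SimpleGraph (Fin n))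
    (m p q s N : ℕ), Runs p₀ (.num (c * ((n + 1) * m))) (fracVal p q) s → 0 < p → 0 < q →
    (n + 1) * nodeCount (adjList H) ((c * ((n + 1) * m)) ^ k).size Finset.univ (List.finRange n)
      ≤ N →
    ∃ a b t : ℕ, 0 < b ∧ Runs (Prog.counting p₀ c k) (graphInput H m) (fracVal a b) t ∧
      (a : ℝ) / b = (truncRatio ((p : ℝ) / q) (adjList H) ((c * ((n + 1) * m)) ^ k).size
        Finset.univ (List.finRange n))⁻¹ ∧
      t ≤ C * ((graphInput H m).size + s + (N + 1) * stateBound ((c * ((n + 1) * m)) ^ k).size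
        (adjMatrixVal H).size (p + q).size N + 1) := by
  obtain ⟨C₁, h₁⟩ := (Prog.loopFree_precision c).runs
  obtain ⟨C₂, h₂⟩ := (Prog.loopFree_setup c k).runs
  obtain ⟨C₃, h₃⟩ := machine_loop_runs
  obtain ⟨C₄, h₄⟩ := Prog.loopFree_readout.runs
  refine ⟨C₁ + C₂ + C₃ + C₄ * C₃ + 10, fun n H m p q s N hs hp hq hN => ?_⟩
  obtain ⟨t₁, r₁, b₁⟩ := h₁ (graphInput H m)
  rw [Prog.ev_precision] at r₁
  have r₁' := Runs.pair (Runs.op .id (graphInput H m)) (Runs.comp r₁ hs)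
  obtain ⟨t₂, r₂, b₂⟩ := h₂ (.pair (graphInput H m) (fracVal p q))
  rw [Prog.ev_setup] at r₂
  obtain ⟨X, Y, t₃, hY, hXY, r₃, b₃⟩ :=
    h₃ n H ⟨adjMatrixVal H, p, q⟩ rfl hq ((c * ((n + 1) * m)) ^ k) N hN
  obtain ⟨t₄, r₄, b₄⟩ := h₄ (encState ⟨adjMatrixVal H, p, q⟩
    [⟨0, 0, 0, .num 0, .num 0, q * Y, q * Y + p * X⟩])
  rw [Prog.ev_readout] at r₄
  have hpq : (0 : ℝ) < (p : ℝ) / q := by positivity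
  have hX : 0 < X := by
    have h := truncRatio_pos (nb := adjList H) hpq ((c * ((n + 1) * m)) ^ k).size Finset.univ
      (List.finRange n)
    rw [← hXY] at h
    rcases Nat.eq_zero_or_pos X with rfl | hX
    · simp at h
    · exact hX
  rw [Nat.add_sub_cancel_left] at r₄
  refine ⟨_, _, _, by positivity, Runs.comp (Runs.comp (Runs.comp r₁' r₂) r₃) r₄, ?_, ?_⟩
  · rw [← hXY, inv_div]
    have hp' : (p : ℝ) ≠ 0 := by positivity
    have hq' : (q : ℝ) ≠ 0 := by positivity
    push_cast
    field_simp
  · have hsz := r₃.size_le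
    have hfr := hs.size_le
    simp only [Val.size] at b₂
    have hid : (Op.id.eval (graphInput H m)).size = (graphInput H m).size := rfl
    rw [hid]
    set v := (graphInput H m).size
    set w := (N + 1) * stateBound ((c * ((n + 1) * m)) ^ k).size (adjMatrixVal H).size
      (p + q).size N
    have b₂' : t₂ ≤ C₂ * (v + s + 1) := b₂.trans (Nat.mul_le_mul_left _ (by omega))
    have b₄' : t₄ ≤ C₄ * (C₃ * w) := b₄.trans (Nat.mul_le_mul_left _ (hsz.trans b₃))
    have b₃' : t₃ ≤ C₃ * w := b₃
    have hC₁ : 0 ≤ C₁ * (s + w + 1) := Nat.zero_le _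
    have hC₂ : 0 ≤ C₂ * w := Nat.zero_le _
    have hC₃ : 0 ≤ C₃ * (v + s + 1) := Nat.zero_le _
    have hC₄ : 0 ≤ C₄ * C₃ * (v + s + 1) := Nat.zero_le _
    nlinarith

/-! ### Accuracy -/

theorem abs_log_partitionOn_sub_le {V : Type*} {G : SimpleGraph V} {lam mu : ℝ} (hlam : 0 < lam)
    (hmu : 0 < mu) (U : Finset V) :
    |Real.log (partitionOn G mu U) - Real.log (partitionOn G lam U)| ≤
      U.card * |Real.log mu - Real.log lam| := by
  wlog h : lam ≤ mu generalizing lam mu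
  · rw [abs_sub_comm, abs_sub_comm (Real.log mu)]
    exact this hmu hlam (le_of_not_ge h)
  have h1 := partitionOn_pos (G := G) hlam U
  have h2 := Real.log_le_log h1 (partitionOn_activity_mono (G := G) hlam h U)
  have h3 := Real.log_le_log (partitionOn_pos (G := G) hmu U)
    (partitionOn_activity_le (G := G) hlam h U)
  rw [Real.log_mul (by positivity) h1.ne', Real.log_pow, Real.log_div hmu.ne' hlam.ne'] at h3
  rw [abs_of_nonneg (by linarith), abs_of_nonneg (by linarith [Real.log_le_log hlam h])]
  linarith

theorem abs_log_sub_log_le {a x y : ℝ} (ha : 0 < a) (hx : a ≤ x) (hy : a ≤ y) :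
    |Real.log x - Real.log y| ≤ |x - y| / a := by
  wlog h : y ≤ x generalizing x y
  · rw [abs_sub_comm, abs_sub_comm x]
    exact this hy hx (le_of_not_ge h)
  have hy0 : 0 < y := ha.trans_le hy
  have hx0 : 0 < x := ha.trans_le hx
  have h1 := Real.log_le_sub_one_of_pos (x := x / y) (by positivity)
  rw [Real.log_div hx0.ne' hy0.ne'] at h1
  rw [abs_of_nonneg (by linarith [Real.log_le_log hy0 h]), abs_of_nonneg (by linarith)]
  have h2 : x / y - 1 = (x - y) / y := by field_simp
  have h3 : (x - y) / y ≤ (x - y) / a :=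
    div_le_div_of_nonneg_left (by linarith) ha hy
  linarith

/-- Each factor contributes at most η because r ↦ log(1 + r) is 1-Lipschitz on r ≥ 0. -/
theorem abs_log_prod_sub_le {α : Type*} (C : List α) {r r' : α → ℝ} {η : ℝ} (hr : ∀ c, 0 ≤ r c)
    (hr' : ∀ c, 0 ≤ r' c) (h : ∀ c ∈ C, |r c - r' c| ≤ η) :
    |Real.log (C.map fun c => (1 + r c)⁻¹).prod - Real.log (C.map fun c => (1 + r' c)⁻¹).prod| ≤
      C.length * η := by
  induction C with
  | nil => simp
  | cons c C ih =>
    have hpos : ∀ (f : α → ℝ), (∀ c, 0 ≤ f c) → (C.map fun c => (1 + f c)⁻¹).prod ≠ 0 := by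
      intro f hf
      refine (List.prod_pos fun a ha => ?_).ne'
      obtain ⟨c, -, rfl⟩ := List.mem_map.1 ha
      have := hf c
      positivity
    have h1 := hr c
    have h2 := hr' c
    rw [List.forall_mem_cons] at h
    have h3 := ih h.2
    have h4 := abs_log_sub_log_le one_pos (by linarith : 1 ≤ 1 + r c) (by linarith : 1 ≤ 1 + r' c)
    rw [div_one, add_sub_add_left_eq_sub] at h4
    rw [List.map_cons, List.map_cons, List.prod_cons, List.prod_cons,
      Real.log_mul (by positivity) (hpos r hr), Real.log_mul (by positivity) (hpos r' hr'),
      Real.log_inv, Real.log_inv, List.length_cons]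
    push_cast
    have h5 := h.1
    rw [abs_le] at h3 h4 h5 ⊢
    constructor <;> linarith [h3.1, h3.2, h4.1, h4.2, h5.1, h5.2]

theorem length_children_le {V : Type*} [DecidableEq V] (U : Finset V) (L : List V) :
    (children U L).length ≤ L.length := by
  induction L generalizing U with
  | nil => simp [children]
  | cons u L ih =>
    rw [children]
    split_ifs
    · simpa using ih _
    · exact (ih U).trans (by simp)

theorem notMem_of_mem_children {V : Type*} [DecidableEq V] {U : Finset V} {L : List V}
    {c : Finset V × V} (hc : c ∈ children U L) : c.2 ∉ c.1 := fun h =>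
  Finset.notMem_erase _ _ ((mem_children hc).1 h)

theorem nodeCount_succ_le {V : Type*} [DecidableEq V] {nb : V → List V} {ℓ M : ℕ} {U : Finset V}
    {L : List V} (h : ∀ c ∈ children U L, nodeCount nb ℓ c.1 (nb c.2) ≤ M) :
    nodeCount nb (ℓ + 1) U L ≤ 1 + L.length * M := by
  have h1 := List.sum_le_card_nsmul ((children U L).map fun c => nodeCount nb ℓ c.1 (nb c.2)) M
    (by
      intro a ha
      obtain ⟨c, hc, rfl⟩ := List.mem_map.1 ha
      exact h c hc)
  rw [List.length_map, smul_eq_mul] at h1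
  have h2 := Nat.mul_le_mul_right M (length_children_le U L)
  rw [nodeCount]
  omega

/-- The logarithm of the computed value is close to that of the partition function. -/
theorem abs_log_truncRatio_sub_le {n : ℕ} {H : SimpleGraph (Fin n)} {x q L mu : ℝ} (hx : 0 < x)
    (hmu : 0 < mu) (hmuL : mu ≤ L) (hL : L ≤ criticalActivity (1 + x⁻¹))
    (hq : (2 * halfExponent x).HolderConjugate q) {C Δ' : ℝ} (hC : 0 ≤ C) (hΔ' : 0 ≤ Δ') {ℓ : ℕ}
    (hsaw : ∀ v, (sawCount H v ℓ : ℝ) ≤ C * Δ' ^ ℓ) :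
    |Real.log (truncRatio mu (adjList H) (ℓ + 1) Finset.univ (List.finRange n))⁻¹ -
        Real.log (hardCoreZ H mu)| ≤
      n * (2 * (1 + L) * message L * C ^ (1 / q) * ((Δ' * (1 + x⁻¹)⁻¹) ^ (1 / q)) ^ ℓ) := by
  have hempty : partitionOn H mu ∅ = 1 := by
    rw [partitionOn, Finset.powerset_empty, Finset.sum_singleton, indepWeight_of_indep (by simp)]
    simp
  -- Deleting all vertices leaves Z(∅) = 1, so the partition function is an inverse ratio. Its first
  -- level is a product over the vertices, which is why the depth is ℓ + 1 and the errors at depth ℓ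
  -- are multiplied by n.
  have hZ : Real.log (hardCoreZ H mu) =
      -Real.log (deletionRatio H mu Finset.univ (List.finRange n)) := by
    have h : (Finset.univ : Finset (Fin n)) \ (List.finRange n).toFinset = ∅ := by
      ext; simp
    rw [deletionRatio, h, hempty, one_div, Real.log_inv, neg_neg, hardCoreZ_eq_partitionOn]
  have hm := message_nonneg L
  have hmm := message_nonneg mu
  set E := 2 * (1 + L) * message L * C ^ (1 / q) * ((Δ' * (1 + x⁻¹)⁻¹) ^ (1 / q)) ^ ℓ with hE
  have hL0 : 0 < L := hmu.trans_le hmuL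
  have hE0 : 0 ≤ E := by positivity
  have hmess := message_mono hmuL
  have h1 : ∀ c ∈ children Finset.univ (List.finRange n),
      |mu * truncRatio mu (adjList H) ℓ c.1 (adjList H c.2) -
        mu * deletionRatio H mu c.1 (adjList H c.2)| ≤ E := by
    intro c hc
    rw [abs_sub_comm]
    refine (truncRatio_error_of_sawCount_le hx hmu (hmuL.trans hL) hq (mem_adjList H) hC hΔ'
      (hsaw c.2) (notMem_of_mem_children hc)).trans ?_
    rw [hE]
    gcongr
  have h2 := abs_log_prod_sub_le (children Finset.univ (List.finRange n))
    (r := fun c => mu * truncRatio mu (adjList H) ℓ c.1 (adjList H c.2))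
    (r' := fun c => mu * deletionRatio H mu c.1 (adjList H c.2))
    (fun c => mul_nonneg hmu.le (truncRatio_nonneg (nb := adjList H) hmu ℓ c.1 (adjList H c.2)))
    (fun c => mul_nonneg hmu.le (deletionRatio_nonneg (G := H) hmu c.1 (adjList H c.2))) h1
  have h3 : ((children Finset.univ (List.finRange n)).length : ℝ) ≤ n := by
    exact_mod_cast (length_children_le _ _).trans_eq (List.length_finRange)
  rw [Real.log_inv, hZ, neg_sub_neg, abs_sub_comm, deletionRatio_eq_prod hmu (mem_adjList H),
    truncRatio]
  exact h2.trans (by gcongr)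

theorem sawCount_le_of_iso {V W : Type*} {G : SimpleGraph V} {H : SimpleGraph W} (e : H ≃g G)
    (hfin : ∀ v, (G.neighborSet v).Finite) (v : W) (ℓ : ℕ) : sawCount H v ℓ ≤ sawCount G (e v) ℓ := by
  classical
  have hf : {p : Σ w : V, G.Walk (e v) w | p.2.IsPath ∧ p.2.length = ℓ}.Finite :=
    (finite_walks (G := G) (nb := fun v => (hfin v).toFinset.toList) (by simp) (e v) ℓ).subset
      fun p hp => hp.2
  refine Set.ncard_le_ncard_of_injOn (fun p => ⟨e p.1, p.2.map e.toHom⟩) ?_ ?_ hf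
  · rintro ⟨w, p⟩ ⟨hp, hlen⟩
    exact ⟨hp.map e.injective, by simpa using hlen⟩
  · rintro ⟨w, p⟩ - ⟨w', p'⟩ - h
    have hw : w = w' := e.injective (congrArg Sigma.fst h)
    subst hw
    have h' := SimpleGraph.Walk.map_injective_of_injective (f := e.toHom) e.injective v w
      (eq_of_heq (Sigma.mk.inj h).2)
    exact congrArg (Sigma.mk w) h'

/-! ### Running time -/

/-- Bounded by a polynomial. -/
def PolyBounded (f : ℕ → ℕ → ℕ) : Prop := ∃ A, ∀ n m, f n m ≤ A * (n + m + 1) ^ A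

namespace PolyBounded

variable {f g : ℕ → ℕ → ℕ}

theorem const (c : ℕ) : PolyBounded fun _ _ => c :=
  ⟨c, fun n m => Nat.le_mul_of_pos_right _ (by positivity)⟩

theorem left : PolyBounded fun n _ => n := ⟨1, fun n m => by simp; omega⟩

theorem right : PolyBounded fun _ m => m := ⟨1, fun n m => by simp; omega⟩

theorem add (hf : PolyBounded f) (hg : PolyBounded g) : PolyBounded fun n m => f n m + g n m := by
  obtain ⟨A, hA⟩ := hf
  obtain ⟨B, hB⟩ := hg
  refine ⟨A + B, fun n m => ?_⟩
  rw [add_mul]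
  have h1 : (n + m + 1) ^ A ≤ (n + m + 1) ^ (A + B) := Nat.pow_le_pow_right (by omega) (by omega)
  have h2 : (n + m + 1) ^ B ≤ (n + m + 1) ^ (A + B) := Nat.pow_le_pow_right (by omega) (by omega)
  exact add_le_add ((hA n m).trans (Nat.mul_le_mul_left _ h1))
    ((hB n m).trans (Nat.mul_le_mul_left _ h2))

theorem mul (hf : PolyBounded f) (hg : PolyBounded g) : PolyBounded fun n m => f n m * g n m := by
  obtain ⟨A, hA⟩ := hf
  obtain ⟨B, hB⟩ := hg
  refine ⟨A * B + (A + B), fun n m => ?_⟩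
  calc f n m * g n m ≤ (A * (n + m + 1) ^ A) * (B * (n + m + 1) ^ B) :=
        Nat.mul_le_mul (hA n m) (hB n m)
    _ = A * B * (n + m + 1) ^ (A + B) := by rw [pow_add]; ring
    _ ≤ _ := Nat.mul_le_mul (by omega) (Nat.pow_le_pow_right (by omega) (by omega))

theorem pow (hf : PolyBounded f) (k : ℕ) : PolyBounded fun n m => f n m ^ k := by
  induction k with
  | zero => simpa using const 1
  | succ k ih => simpa only [pow_succ] using ih.mul hf

theorem stateBound {b s w j : ℕ → ℕ → ℕ} (hb : PolyBounded b) (hs : PolyBounded s)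
    (hw : PolyBounded w) (hj : PolyBounded j) :
    PolyBounded fun n m => stateBound (b n m) (s n m) (w n m) (j n m) :=
  (((hj.add (const 2)).mul (((((hb.add ((const 2).mul hs)).add (((const 2).mul hw).mul hj)).add
    ((const 2).mul hj)).add (const 16)))).add hs).add ((const 2).mul hw) |>.add (const 8)

end PolyBounded

theorem size_ofList_map_le {α : Type*} {f : α → Val} {c : ℕ} (hf : ∀ a, (f a).size ≤ c)
    (L : List α) : (Val.ofList (L.map f)).size ≤ L.length * (c + 1) + 1 := by
  induction L with
  | nil => simp [Val.ofList, Val.size]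
  | cons a L ih =>
    have := hf a
    simp only [List.map_cons, Val.ofList, Val.size, List.length_cons]
    rw [add_mul]
    omega

theorem size_adjMatrixVal_le {n : ℕ} (H : SimpleGraph (Fin n)) :
    (adjMatrixVal H).size ≤ n * (n * 3 + 2) + 1 := by
  have h1 : ∀ u, (adjRow H u).size ≤ n * 3 + 1 := by
    intro u
    refine (size_ofList_map_le (c := 2) (fun w => ?_) _).trans_eq (by simp)
    split_ifs <;> simp [Val.size]
  exact (size_ofList_map_le h1 _).trans_eq (by simp)

theorem Nat.size_le_self (a : ℕ) : a.size ≤ a := Nat.size_le.2 a.lt_two_pow_self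

theorem stateBound_mono_left {b b' s s' w w' j : ℕ} (hb : b ≤ b') (hs : s ≤ s') (hw : w ≤ w') :
    stateBound b s w j ≤ stateBound b' s' w' j := by
  unfold stateBound
  gcongr

/-- The counting algorithm runs in polynomial time if the recursion tree has polynomial size. -/
theorem counting_runs_polyTime {p₀ : Prog} {C₀ : ℕ} {lam : ℝ} (hp₀ : ∀ m : ℕ, 1 ≤ m →
      ∃ a b t : ℕ, 0 < b ∧ Runs p₀ (.num m) (fracVal a b) t ∧ t ≤ C₀ * m ^ C₀ ∧
        |(a : ℝ) / b - lam| ≤ 1 / m) {c : ℕ} (hc : 0 < c) (hlam : 1 / (c : ℝ) < lam) (k : ℕ)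
    {N : ℕ → ℕ → ℕ} (hN : PolyBounded N) :
    ∃ A : ℕ, ∀ (n : ℕ) (H : SimpleGraph (Fin n)) (m : ℕ), 1 ≤ m →
      (n + 1) * nodeCount (adjList H) ((c * ((n + 1) * m)) ^ k).size Finset.univ (List.finRange n)
        ≤ N n m →
      ∃ (mu : ℝ) (a b t : ℕ), |mu - lam| ≤ 1 / (c * ((n + 1) * m) : ℕ) ∧ 0 < b ∧
        Runs (Prog.counting p₀ c k) (graphInput H m) (fracVal a b) t ∧
        (a : ℝ) / b = (truncRatio mu (adjList H) ((c * ((n + 1) * m)) ^ k).size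
          Finset.univ (List.finRange n))⁻¹ ∧ t ≤ A * (n + m + 1) ^ A := by
  obtain ⟨C, hC⟩ := counting_runs p₀ c k
  open PolyBounded in
  have hprec : PolyBounded fun n m => c * ((n + 1) * m) :=
    (const c).mul ((left.add (const 1)).mul right)
  have hs : PolyBounded fun n m => C₀ * (c * ((n + 1) * m)) ^ C₀ :=
    (PolyBounded.const C₀).mul (hprec.pow C₀)
  have hrows : PolyBounded fun n _ => n * (n * 3 + 2) + 1 :=
    (PolyBounded.left.mul ((PolyBounded.left.mul (.const 3)).add (.const 2))).add (.const 1)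
  have hb : PolyBounded fun n m => (c * ((n + 1) * m)) ^ k := hprec.pow k
  have htime : PolyBounded fun n m => C * ((n + (n * (n * 3 + 2) + 1) + m + 4) +
      C₀ * (c * ((n + 1) * m)) ^ C₀ + (N n m + 1) * stateBound ((c * ((n + 1) * m)) ^ k)
        (n * (n * 3 + 2) + 1) (C₀ * (c * ((n + 1) * m)) ^ C₀ + 1) (N n m) + 1) :=
    (PolyBounded.const C).mul ((((((PolyBounded.left.add hrows).add .right).add (.const 4)).add
      hs).add ((hN.add (.const 1)).mul (.stateBound hb hrows (hs.add (.const 1)) hN))).add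
        (.const 1))
  obtain ⟨A, hA⟩ := htime
  refine ⟨A, fun n H m hm hnode => ?_⟩
  have hprec1 : c ≤ c * ((n + 1) * m) := Nat.le_mul_of_pos_right _ (by positivity)
  obtain ⟨p, q, s, hq, hrun, hsC, happ⟩ := hp₀ (c * ((n + 1) * m)) (hc.trans_le hprec1)
  -- The approximation 0 would be off by lam > 1/c, more than the requested precision.
  have hp : 0 < p := by
    rcases Nat.eq_zero_or_pos p with rfl | hp
    · exfalso
      rw [Nat.cast_zero, zero_div, zero_sub, abs_neg] at happ
      have h1 := (le_abs_self lam).trans happ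
      have h2 : 1 / ((c * ((n + 1) * m) : ℕ) : ℝ) ≤ 1 / c :=
        one_div_le_one_div_of_le (by exact_mod_cast hc) (by exact_mod_cast hprec1)
      linarith
    · exact hp
  obtain ⟨a, b, t, hb0, ht, hab, htC⟩ := hC n H m p q s (N n m) hrun hp hq hnode
  refine ⟨(p : ℝ) / q, a, b, t, happ, hb0, ht, hab, htC.trans (le_trans ?_ (hA n m))⟩
  have hsz := hrun.size_le
  simp only [fracVal, Val.size] at hsz
  have h1 : (graphInput H m).size ≤ n + (n * (n * 3 + 2) + 1) + m + 4 := by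
    have h2 := size_adjMatrixVal_le H
    have h3 := Nat.size_le_self n
    have h4 := Nat.size_le_self m
    rw [graphInput_eq]
    simp only [Val.size]
    omega
  have h2 : (p + q).size ≤ C₀ * (c * ((n + 1) * m)) ^ C₀ + 1 :=
    (Nat.size_add_le p q).trans (by omega)
  have h3 := stateBound_mono_left (j := N n m)
    (Nat.size_le_self ((c * ((n + 1) * m)) ^ k)) (size_adjMatrixVal_le H) h2
  dsimp only
  gcongr

/-! ### Choice of the recursion depth. -/

/-- The budget N ^ K has ℓ + 1 bits. The lower bound on ℓ gives accuracy, and 2 ^ ℓ ≤ N ^ K makes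
anything exponential in ℓ polynomial in N. -/
theorem exists_size_pow_eq {N : ℕ} (hN : 2 ≤ N) (K : ℕ) :
    ∃ ℓ, (N ^ K).size = ℓ + 1 ∧ K * Nat.log 2 N ≤ ℓ ∧ 2 ^ ℓ ≤ N ^ K := by
  have h1 : 0 < (N ^ K).size := Nat.size_pos.2 (by positivity)
  obtain ⟨ℓ, hℓ⟩ := Nat.exists_eq_add_of_le' h1
  refine ⟨ℓ, hℓ, ?_, Nat.lt_size.1 (by omega)⟩
  have h2 : 2 ^ (K * Nat.log 2 N) ≤ N ^ K := by
    rw [mul_comm, pow_mul]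
    exact Nat.pow_le_pow_left (Nat.pow_log_le_self 2 (by omega)) K
  have h3 := Nat.lt_size.2 h2
  omega

theorem pow_le_two_div {ρ : ℝ} (hρ : 0 < ρ) (hρ1 : ρ < 1) {K N ℓ : ℕ} (hK : ρ ^ K ≤ 1 / 2)
    (hN : 2 ≤ N) (hℓ : K * Nat.log 2 N ≤ ℓ) : ρ ^ ℓ ≤ 2 / N := by
  have h1 : (N : ℝ) ≤ 2 ^ (Nat.log 2 N + 1) := by
    exact_mod_cast (Nat.lt_pow_succ_log_self one_lt_two N).le
  have hN0 : (0 : ℝ) < N := by positivity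
  calc ρ ^ ℓ ≤ ρ ^ (K * Nat.log 2 N) := pow_le_pow_of_le_one hρ.le hρ1.le hℓ
    _ = (ρ ^ K) ^ Nat.log 2 N := pow_mul _ _ _
    _ ≤ (1 / 2) ^ Nat.log 2 N := by gcongr
    _ ≤ 2 / N := by
      rw [one_div, inv_pow, ← one_div, div_le_div_iff₀ (by positivity) hN0]
      rw [pow_succ] at h1
      linarith

/-- Makes the depth large enough for the family's bound on walks to apply. -/
theorem mul_log_le_of_le {a : ℝ} {K N n ℓ : ℕ} (hK : 2 * |a| ≤ K) (hN : 2 ≤ N) (hn : n ≤ N)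
    (hℓ : K * Nat.log 2 N ≤ ℓ) : a * Real.log n ≤ ℓ := by
  have hlog : 1 ≤ Nat.log 2 N := Nat.log_pos one_lt_two hN
  have h1 : Real.log n ≤ 2 * Nat.log 2 N := by
    rcases Nat.eq_zero_or_pos n with rfl | hn0
    · simp
    have h2 : (n : ℝ) ≤ 2 ^ (Nat.log 2 N + 1) := by
      exact_mod_cast hn.trans (Nat.lt_pow_succ_log_self one_lt_two N).le
    have h3 := Real.log_le_log (by exact_mod_cast hn0) h2
    rw [Real.log_pow] at h3
    have h4 := Real.log_two_lt_d9
    have h5 : (1 : ℝ) ≤ Nat.log 2 N := by exact_mod_cast hlog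
    push_cast at h3
    nlinarith
  have h0 : 0 ≤ Real.log n := Real.log_natCast_nonneg n
  calc a * Real.log n ≤ |a| * Real.log n := by gcongr; exact le_abs_self a
    _ ≤ |a| * (2 * Nat.log 2 N) := by gcongr
    _ = 2 * |a| * Nat.log 2 N := by ring
    _ ≤ K * Nat.log 2 N := by gcongr
    _ ≤ ℓ := by exact_mod_cast hℓ

theorem sum_sawCount_le_of_iso {ι : Type*} {V : ι → Type*} {G : ∀ i, SimpleGraph (V i)}
    (hfin : ∀ (i : ι) (v : V i), ((G i).neighborSet v).Finite) {Δ a c : ℝ} (hΔ : 0 ≤ Δ)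
    (hac : ∀ i, Finite (V i) → ∀ (v : V i) (ℓ : ℕ), a * Real.log (Nat.card (V i)) ≤ ℓ →
      (∑ j ∈ Finset.Icc 1 ℓ, (sawCount (G i) v j : ℝ)) ≤ c * Δ ^ ℓ)
    {n : ℕ} {H : SimpleGraph (Fin n)} {i : ι} (e : H ≃g G i) {ℓ : ℕ} (hℓ : a * Real.log n ≤ ℓ)
    (v : Fin n) :
    (∑ j ∈ Finset.range (ℓ + 1), (sawCount H v j : ℝ)) ≤ 1 + max c 0 * Δ ^ ℓ := by
  have hf : Finite (V i) := Finite.of_equiv _ e.toEquiv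
  have hcard : Nat.card (V i) = n := by
    rw [← Nat.card_congr e.toEquiv, Nat.card_eq_fintype_card, Fintype.card_fin]
  have h := sawCount_le_of_sum_le (hfin i) hΔ (hac i hf (e v) ℓ (by rwa [hcard]))
  refine le_trans (Finset.sum_le_sum fun j _ => ?_) h
  exact_mod_cast sawCount_le_of_iso e (hfin i) v j

theorem abs_sub_le_of_abs_log_sub_le {x y δ : ℝ} (hx : 0 < x) (hy : 0 < y) (hδ : 2 * δ ≤ 1)
    (h : |Real.log x - Real.log y| ≤ δ) : |x - y| ≤ 2 * δ * y := by
  set s := Real.log x - Real.log y with hs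
  have hxy : x = y * Real.exp s := by
    rw [hs, Real.exp_sub, Real.exp_log hx, Real.exp_log hy, mul_div_cancel₀ _ hy.ne']
  have h1 : |Real.exp s - 1| ≤ 2 * |s| := Real.abs_exp_sub_one_le (by linarith [abs_nonneg s])
  have h2 : x - y = y * (Real.exp s - 1) := by rw [hxy]; ring
  rw [h2, abs_mul, abs_of_pos hy]
  nlinarith

theorem scaled_error_le {m N c E : ℝ} (n : ℕ) (hm : 1 ≤ m) (hc : 0 < c) (hEc : 8 * E ≤ c) (hN : N = c * ((n + 1) * m)) : 2 * n * E / N ≤ 1 / (4 * m) := by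
  have hn := Nat.cast_nonneg (α := ℝ) n
  have hm0 : 0 < m := by linarith
  rw [hN, div_le_div_iff₀ (by positivity) (by positivity)]
  have h : 8 * E * (n * m) ≤ c * ((n + 1) * m) := by
    gcongr
    linarith
  linarith

/-! ### Assembly of the approximation scheme. -/

theorem hasFPTAS {ι : Type*} {V : ι → Type*} (G : ∀ i, SimpleGraph (V i))
    (hfin : ∀ (i : ι) (v : V i), ((G i).neighborSet v).Finite)
    (Δ lam : ℝ) (hΔ : 1 < Δ) (hG : ConnectiveConstantAtMost G Δ)
    (hlam : 0 < lam) (hcrit : lam < criticalActivity Δ) (happ : PolyTimeApproximable lam) :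
    HasFPTAS G lam := by
  obtain ⟨p₀, C₀, hp₀⟩ := happ
  obtain ⟨x, q, Δ', hx, hq, hΔΔ', hΔ'x, hcrit'⟩ := exists_supercritical_parameters hΔ hcrit
  obtain ⟨a, c₀, hac⟩ := hG.1
  have hq0 := hq.symm.pos
  have hΔ'0 : 0 < Δ' := by linarith
  have hD : 0 < 1 + x⁻¹ := by positivity
  set ρ := (Δ' * (1 + x⁻¹)⁻¹) ^ (1 / q) with hρ
  have hρ0 : 0 < ρ := by positivity
  have hρ1 : ρ < 1 := by
    refine Real.rpow_lt_one (by positivity) ?_ (one_div_pos.2 hq0)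
    rwa [← div_eq_mul_inv, div_lt_one hD]
  set L := criticalActivity (1 + x⁻¹) with hL
  set C := 1 + max c₀ 0 with hC
  have hC0 : 0 ≤ C := by positivity
  set E := 2 * (1 + L) * message L * C ^ (1 / q) with hE
  have hE0 : 0 ≤ E := by
    have := message_nonneg L
    have : 0 < L := hlam.trans hcrit'
    positivity
  -- The first condition turns ρ ^ ℓ into at most 2/N, the second secures ℓ ≥ a log n.
  obtain ⟨K, hK, haK⟩ : ∃ K : ℕ, ρ ^ K ≤ 1 / 2 ∧ 2 * |a| ≤ K := by
    obtain ⟨K₀, hK₀⟩ := exists_pow_lt_of_lt_one (by norm_num : (0 : ℝ) < 1 / 2) hρ1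
    refine ⟨max K₀ ⌈2 * |a|⌉₊, ?_, (Nat.le_ceil _).trans (by exact_mod_cast le_max_right _ _)⟩
    exact (pow_le_pow_of_le_one hρ0.le hρ1.le (le_max_left _ _)).trans hK₀.le
  -- Then Δ ^ ℓ ≤ (2 ^ ℓ) ^ e is at most a fixed power of N, which bounds the size of the tree.
  obtain ⟨e, he⟩ := pow_unbounded_of_one_lt Δ (one_lt_two)
  -- The three terms control the truncation error, the error from approximating lam (also keeping
  -- the approximation above lam/2), and its excess over lam, so that it stays at most L. The final
  -- 2 gives N ≥ 2.
  set c := ⌈8 * E / ρ + 8 / lam + 1 / (L - lam)⌉₊ + 2 with hc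
  have hc2 : 2 ≤ c := by omega
  have hLlam : 0 < L - lam := sub_pos.2 hcrit'
  have hc0 : (0 : ℝ) < c := by positivity
  have hcle : 8 * E / ρ + 8 / lam + 1 / (L - lam) ≤ c := by
    have := Nat.le_ceil (8 * E / ρ + 8 / lam + 1 / (L - lam))
    rw [hc]; push_cast; linarith
  have ht1 : 0 ≤ 8 * E / ρ := by positivity
  have ht2 : 0 < 8 / lam := by positivity
  have ht3 : 0 < 1 / (L - lam) := by positivity
  have hcE : 8 * E ≤ c * ρ := by rw [← div_le_iff₀ hρ0]; linarith
  have hclam : 8 ≤ c * lam := by rw [← div_le_iff₀ hlam]; linarith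
  have hcL : 1 ≤ c * (L - lam) := by rw [← div_le_iff₀ hLlam]; linarith
  set c₁ := ⌈max c₀ 0⌉₊ with hc₁
  have hN : PolyBounded fun n m =>
      (n + 1) * (1 + n * (1 + c₁ * ((c * ((n + 1) * m)) ^ K) ^ e)) :=
    (PolyBounded.left.add (.const 1)).mul ((PolyBounded.const 1).add (PolyBounded.left.mul
      ((PolyBounded.const 1).add ((PolyBounded.const c₁).mul
        ((((PolyBounded.const c).mul ((PolyBounded.left.add (.const 1)).mul .right)).pow K).pow e)))))
  obtain ⟨A, hA⟩ := counting_runs_polyTime hp₀ (by omega : 0 < c)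
    (by rw [div_lt_iff₀ hc0]; linarith) K hN
  -- The factor 2 ^ A comes from n + ⌈1/ε⌉ + 1 ≤ 2 (n + 1/ε + 1).
  refine ⟨Prog.counting p₀ c K, A * 2 ^ A, ?_⟩
  rintro n H ⟨i, ⟨iso⟩⟩ ε hε
  set m := ⌈1 / ε⌉₊ with hm
  have hm1 : 1 ≤ m := Nat.ceil_pos.2 (by positivity)
  have hmR : (1 : ℝ) ≤ m := by exact_mod_cast hm1
  set N := c * ((n + 1) * m) with hNdef
  have hcN : c ≤ N := Nat.le_mul_of_pos_right _ (by positivity)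
  have hnN : n ≤ N := by
    have h1 : n + 1 ≤ (n + 1) * m := Nat.le_mul_of_pos_right _ hm1
    have h2 : (n + 1) * m ≤ N := Nat.le_mul_of_pos_left _ (by omega)
    omega
  have hN2 : 2 ≤ N := hc2.trans hcN
  have hN0 : (0 : ℝ) < N := by positivity
  obtain ⟨ℓ, hsize, hKℓ, h2ℓ⟩ := exists_size_pow_eq hN2 K
  have hsum := sum_sawCount_le_of_iso hfin (by linarith) hac iso
    (mul_log_le_of_le haK hN2 hnN hKℓ)
  have hsaw : ∀ v, (sawCount H v ℓ : ℝ) ≤ C * Δ' ^ ℓ := by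
    intro v
    have h1 := Finset.single_le_sum (f := fun j => (sawCount H v j : ℝ))
      (fun j _ => Nat.cast_nonneg _) (Finset.mem_range.2 (Nat.lt_succ_self ℓ))
    have h2 : (1 : ℝ) ≤ Δ' ^ ℓ := one_le_pow₀ (by linarith)
    have h3 : Δ ^ ℓ ≤ Δ' ^ ℓ := by gcongr
    have h4 : max c₀ 0 * Δ ^ ℓ ≤ max c₀ 0 * Δ' ^ ℓ := by gcongr
    rw [hC, add_mul, one_mul]
    linarith [hsum v]
  have hnode : (n + 1) * nodeCount (adjList H) (N ^ K).size Finset.univ (List.finRange n) ≤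
      (n + 1) * (1 + n * (1 + c₁ * (N ^ K) ^ e)) := by
    refine Nat.mul_le_mul_left _ ?_
    rw [hsize]
    refine (nodeCount_succ_le fun c hc => ?_).trans_eq (by rw [List.length_finRange])
    have h1 : nodeCount (adjList H) ℓ c.1 (adjList H c.2) ≤
        ∑ j ∈ Finset.range (ℓ + 1), sawCount H c.2 j :=
      (nodeCount_le_sum_levelCount _ _ _ _).trans (Finset.sum_le_sum fun j _ =>
        levelCount_le_sawCount (mem_adjList H) j (notMem_of_mem_children hc))
    have h2 : max c₀ 0 * Δ ^ ℓ ≤ c₁ * ((N : ℝ) ^ K) ^ e := by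
      have h3 : Δ ^ ℓ ≤ ((N : ℝ) ^ K) ^ e := by
        calc Δ ^ ℓ ≤ ((2 : ℝ) ^ e) ^ ℓ := by gcongr
          _ = ((2 : ℝ) ^ ℓ) ^ e := pow_right_comm _ _ _
          _ ≤ _ := by
            gcongr
            exact_mod_cast h2ℓ
      have h4 : max c₀ 0 ≤ c₁ := Nat.le_ceil _
      gcongr
    have h3 : ((∑ j ∈ Finset.range (ℓ + 1), sawCount H c.2 j : ℕ) : ℝ) ≤
        ((1 + c₁ * (N ^ K) ^ e : ℕ) : ℝ) := by
      push_cast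
      linarith [hsum c.2]
    exact h1.trans (by exact_mod_cast h3)
  obtain ⟨mu, a', b', t, hmu, hb', hrun, hval, htime⟩ := hA n H m hm1 hnode
  refine ⟨a', b', t, hb', hrun, ?_, ?_⟩
  · have h1 : (m : ℝ) ≤ 1 / ε + 1 := (Nat.ceil_lt_add_one (by positivity)).le
    have h2 : (1 : ℝ) ≤ n + 1 / ε + 1 := by
      have : 0 < 1 / ε := by positivity
      have := Nat.cast_nonneg (α := ℝ) n
      linarith
    have h3 : ((n + m + 1 : ℕ) : ℝ) ≤ 2 * (n + 1 / ε + 1) := by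
      push_cast
      have : 0 < 1 / ε := by positivity
      have := Nat.cast_nonneg (α := ℝ) n
      linarith
    calc (t : ℝ) ≤ A * ((n + m + 1 : ℕ) : ℝ) ^ A := by exact_mod_cast htime
      _ ≤ A * (2 * (n + 1 / ε + 1)) ^ A := by gcongr
      _ = (A * 2 ^ A) * (n + 1 / ε + 1) ^ A := by rw [mul_pow]; ring
      _ ≤ (A * 2 ^ A) * (n + 1 / ε + 1) ^ (A * 2 ^ A) := by
        gcongr
        exact Nat.le_mul_of_pos_right _ (by positivity)
      _ = _ := by push_cast; rfl
  · have hNc : (c : ℝ) ≤ N := by exact_mod_cast hcN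
    have hmu' : |mu - lam| ≤ 1 / c := hmu.trans (one_div_le_one_div_of_le hc0 hNc)
    have hcinv : 1 / (c : ℝ) ≤ lam / 2 := by rw [div_le_iff₀ hc0]; linarith
    have hcinv' : 1 / (c : ℝ) ≤ L - lam := by rw [div_le_iff₀ hc0]; linarith
    rw [abs_le] at hmu'
    have hmu0 : lam / 2 ≤ mu := by linarith [hmu'.1]
    have hmupos : 0 < mu := by linarith
    have hmuL : mu ≤ L := by linarith [hmu'.2]
    have hNR : (N : ℝ) = c * ((n + 1) * m) := by rw [hNdef]; push_cast; ring
    have hn0 := Nat.cast_nonneg (α := ℝ) n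
    -- Truncation and approximation of the activity each cost 1/(4m) in the logarithm.
    -- Exponentiating the total 1/(2m) at most doubles it, and 1/m ≤ ε.
    have herr1 : |Real.log (a' / b' : ℝ) - Real.log (hardCoreZ H mu)| ≤ 1 / (4 * m) := by
      rw [hval, hsize]
      refine (abs_log_truncRatio_sub_le hx hmupos hmuL le_rfl hq hC0 hΔ'0.le hsaw).trans ?_
      rw [← hE, ← hρ]
      have h1 := pow_le_two_div hρ0 hρ1 hK hN2 hKℓ
      calc (n : ℝ) * (E * ρ ^ ℓ) ≤ n * (E * (2 / N)) := by gcongr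
        _ = 2 * n * E / N := by ring
        _ ≤ 1 / (4 * m) := scaled_error_le n hmR hc0 (hcE.trans
            (mul_le_of_le_one_right hc0.le hρ1.le)) hNR
    have herr2 : |Real.log (hardCoreZ H mu) - Real.log (hardCoreZ H lam)| ≤ 1 / (4 * m) := by
      rw [hardCoreZ_eq_partitionOn, hardCoreZ_eq_partitionOn]
      refine (abs_log_partitionOn_sub_le hlam hmupos _).trans ?_
      rw [Finset.card_univ, Fintype.card_fin]
      have h1 := abs_log_sub_log_le (half_pos hlam) hmu0 (by linarith : lam / 2 ≤ lam)
      calc (n : ℝ) * |Real.log mu - Real.log lam| ≤ n * ((1 / N) / (lam / 2)) := by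
            gcongr
            refine h1.trans ?_
            gcongr
        _ = 2 * n * (1 / lam) / N := by field_simp
        _ ≤ 1 / (4 * m) := scaled_error_le n hmR hc0 (by
            rw [mul_one_div]; linarith) hNR
    have hZ0 : 0 < hardCoreZ H lam := by
      rw [hardCoreZ_eq_partitionOn]; exact partitionOn_pos hlam _
    have hab0 : (0 : ℝ) < a' / b' := by
      rw [hval]; exact inv_pos.2 (truncRatio_pos hmupos _ _ _)
    have hm4 : 1 / (4 * (m : ℝ)) + 1 / (4 * m) = 1 / (2 * m) := by field_simp; norm_num
    have hfinal := abs_sub_le_of_abs_log_sub_le hab0 hZ0 (δ := 1 / (2 * m))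
      (by rw [mul_one_div, div_le_one (by positivity)]; linarith)
      ((abs_sub_le _ (Real.log (hardCoreZ H mu)) _).trans (by linarith))
    refine hfinal.trans ?_
    have h5 : 2 * (1 / (2 * (m : ℝ))) = 1 / m := by field_simp
    have h6 : 1 / (m : ℝ) ≤ ε := by
      rw [div_le_iff₀ (by positivity), ← div_le_iff₀' hε]
      exact Nat.le_ceil _
    rw [h5]
    gcongr

theorem theorem1p1 {ι : Type*} {V : ι → Type*} (G : ∀ i, SimpleGraph (V i))
    (hfin : ∀ (i : ι) (v : V i), ((G i).neighborSet v).Finite)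
    (Δ lam : ℝ) (hΔ : 1 < Δ) (hG : ConnectiveConstantAtMost G Δ)
    (hlam_pos : 0 < lam) (hlam : lam < criticalActivity Δ) :
    (PolyTimeApproximable lam → HasFPTAS G lam) ∧ StrongSpatialMixing G lam :=
  ⟨hasFPTAS G hfin Δ lam hΔ hG hlam_pos hlam,
    strongSpatialMixing G hfin Δ lam hΔ hG hlam_pos hlam⟩
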